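/- Let $K$ be a field, let $S=K[x_1,\dots,x_n]$ with its standard grading, and write $H_{S/I}(t)=\sum_{j\ge 0}\dim_K (S/I)_j\,t^j$ for the Hilbert series of $S/I$. For integers $c,p\ge 1$ set $$h(c,p)(t)=\sum_{i=0}^{p-1}\binom{c+i-1}{i}t^i .$$ **General homogeneous ideals.** Let $I\subset S$ be a homogeneous ideal with $I\ne 0$, $I\neq S$, let $c=\operatorname{ht}(I)$, $d=n-c$, and let $p$ be the smallest degree of the elements of a set of homogeneous generators of $I$. Then for some integer $\delta\ge 0$ there are integers $s_0,\dots,s_{\delta-1}$ with $$H_{S/I}(t)=\frac{h(c,p)(t)-t^p\sum_{i=1}^{\delta}s_{\delta-i}(1-t)^{i-1}}{(1-t)^{d}}. \qquad (*)$$ Let $\delta(I)$ be the least such $\delta$. For $\delta=\delta(I)$, and also for every $\delta\ge\delta(I)$, there is exactly one sequence of integers $s_0,\dots,s_{\delta-1}$ satisfying $(*)$. For a squarefree monomial ideal $I$, its Alexander dual $I^*$ is the ideal generated by the monomials $x_F=\prod_{i\in F}x_i$, $F\subseteq\{1,\dots,n\}$, such that $x_{\{1,\dots,n\}\setminus F}\notin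 I$. 1. Let $J\ne 0,S$ be a squarefree monomial ideal such that $S/J$ is a Cohen–Macaulay ring of codimension $p$ (that is, $\operatorname{ht}(J)=p$). Put $I=J^*$, $c=\operatorname{ht}(I)$, $d=n-c$. Then $I$ has a $p$-linear resolution, that is, a finite graded free resolution $0\to F_s\to\cdots\to F_1\to I\to 0$ in which $F_1\to I$ is given by forms of degree $p$ and the other maps by matrices of linear forms. Moreover there are integers $s_0,\dots,s_{d-1}$ with $$H_{S/I}(t)=\frac{h(c,p)(t)-t^p\sum_{i=1}^{d}s_{d-i}(1-t)^{i-1}}{(1-t)^{n-c}},\qquad H_{S/J}(t)=\frac{h(p,c)(t)+t^c\sum_{i=1}^{d}s_{d-i}t^{i-1}}{(1-t)^{n-p}},$$ and they are uniquely determined by the first equation. 2. Let $I\ne 0,S$ be any squarefree monomial ideal, $c=\operatorname{ht}(I)$, $p$ the smallest degree of the elements of a set of homogeneous generators of $I$, and $J=I^*$. Then $\operatorname{ht}(J)=p$, $c$ is the smallest degree of the elements of a set of homogeneous generators of $J$, and for $\delta=\delta(I)$, and also for every $\delta\ge\delta(I)$, there are integers $s_0,\dots,s_{\delta-1}$ with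 $$H_{S/I}(t)=\frac{h(c,p)(t)-t^p\sum_{i=1}^{\delta}s_{\delta-i}(1-t)^{i-1}}{(1-t)^{n-c}},\qquad H_{S/J}(t)=\frac{h(p,c)(t)+t^c\sum_{i=1}^{\delta}s_{\delta-i}t^{i-1}}{(1-t)^{n-p}},$$ and they are uniquely determined by the first equation. -/

import Mathlib

open MvPolynomial

attribute [local instance] MvPolynomial.gradedAlgebra

namespace LinearIdeals

noncomputable section

/-- The Hilbert series of `S/I`, where `S = K[x_1, …, x_n]` has the standard grading: its `j`-th
coefficient is the `K`-dimension of the degree `j` component of `S/I`, that is, of the image in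
`S/I` of the space of forms of degree `j`. -/
def hilbertSeries {K : Type*} [Field K] {n : ℕ} (I : Ideal (MvPolynomial (Fin n) K)) :
    PowerSeries ℤ :=
  PowerSeries.mk fun j =>
    (Module.finrank K
      ((homogeneousSubmodule (Fin n) K j).map (Ideal.Quotient.mkₐ K I).toLinearMap) : ℤ)

/-- `p` is the smallest degree of the elements of a set of (nonzero homogeneous) generators
of `I`. -/
def IsLeastGeneratorDegree {K : Type*} [Field K] {n : ℕ} (I : Ideal (MvPolynomial (Fin n) K))
    (p : ℕ) : Prop :=
  ∃ G : Set (MvPolynomial (Fin n) K),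
    (∀ g ∈ G, g ≠ 0 ∧ ∃ j, g.IsHomogeneous j) ∧ Ideal.span G = I ∧
      IsLeast {j | ∃ g ∈ G, g.IsHomogeneous j} p

/-- The polynomial `h(c,p)(t) = ∑_{i=0}^{p-1} binom(c+i-1, i) t^i`, for `c, p ≥ 1`. -/
def hPoly (c p : ℕ) : Polynomial ℤ :=
  ∑ i ∈ Finset.range p, Polynomial.monomial i (((c + i - 1).choose i : ℕ) : ℤ)

/-- The polynomial `h(c,p)(t) - t^p ∑_{i=1}^{δ} s_{δ-i} (1-t)^{i-1}` attached to the integers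
`s_0, …, s_{δ-1}`. The summation index is `i - 1`, and `Fin.rev` sends it to `δ - i`. -/
def numerator (c p : ℕ) {δ : ℕ} (s : Fin δ → ℤ) : Polynomial ℤ :=
  hPoly c p - Polynomial.X ^ p *
    ∑ i : Fin δ, Polynomial.C (s i.rev) * (1 - Polynomial.X) ^ (i : ℕ)

/-- The polynomial `h(p,c)(t) + t^c ∑_{i=1}^{δ} s_{δ-i} t^{i-1}` attached to the integers
`s_0, …, s_{δ-1}`. The summation index is `i - 1`, and `Fin.rev` sends it to `δ - i`. -/
def dualNumerator (c p : ℕ) {δ : ℕ} (s : Fin δ → ℤ) : Polynomial ℤ :=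
  hPoly p c + Polynomial.X ^ c *
    ∑ i : Fin δ, Polynomial.C (s i.rev) * Polynomial.X ^ (i : ℕ)

/-- `H_{S/I}(t) = N(t) / (1-t)^e`. (`1 - t` is a unit in the ring of power series.) -/
def HilbertSeriesEq {K : Type*} [Field K] {n : ℕ} (I : Ideal (MvPolynomial (Fin n) K))
    (N : Polynomial ℤ) (e : ℕ) : Prop :=
  hilbertSeries I * (1 - PowerSeries.X) ^ e = (N : PowerSeries ℤ)

/-- The number `δ(I)`: the least `δ` for which there are integers `s_0, …, s_{δ-1}` such that
`H_{S/I}(t) = (h(c,p)(t) - t^p ∑_{i=1}^{δ} s_{δ-i} (1-t)^{i-1}) / (1-t)^{n-c}`. -/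
def delta {K : Type*} [Field K] {n : ℕ} (I : Ideal (MvPolynomial (Fin n) K)) (c p : ℕ) : ℕ :=
  sInf {δ | ∃ s : Fin δ → ℤ, HilbertSeriesEq I (numerator c p s) (n - c)}

/-- The squarefree monomial `∏_{i ∈ F} x_i`. -/
def sqfreeMonomial (K : Type*) [Field K] {n : ℕ} (F : Finset (Fin n)) : MvPolynomial (Fin n) K :=
  ∏ i ∈ F, X i

/-- `I` is generated by squarefree monomials. -/
def IsSquarefreeMonomialIdeal {K : Type*} [Field K] {n : ℕ}
    (I : Ideal (MvPolynomial (Fin n) K)) : Prop :=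
  ∃ A : Set (Finset (Fin n)), I = Ideal.span (sqfreeMonomial K '' A)

/-- The Alexander dual of a squarefree monomial ideal `I`. If `Δ = {F | x_F ∉ I}` is the simplicial
complex with Stanley-Reisner ideal `I`, it is the Stanley-Reisner ideal of the Alexander dual
complex `{F | Fᶜ ∉ Δ}`, so it is generated by the `x_F` with `Fᶜ ∈ Δ`. -/
def alexanderDual {K : Type*} [Field K] {n : ℕ} (I : Ideal (MvPolynomial (Fin n) K)) :
    Ideal (MvPolynomial (Fin n) K) :=
  Ideal.span (sqfreeMonomial K '' {F | sqfreeMonomial K Fᶜ ∉ I})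

/-- A Noetherian ring is Cohen-Macaulay if each of its localizations at a maximal ideal contains a
regular sequence, made of elements of its maximal ideal, whose length is its Krull dimension. -/
def IsCohenMacaulay (R : Type*) [CommRing R] : Prop :=
  IsNoetherianRing R ∧
    ∀ (m : Ideal R) [m.IsMaximal], ∃ rs : List (Localization.AtPrime m),
      (∀ r ∈ rs, r ∈ IsLocalRing.maximalIdeal (Localization.AtPrime m)) ∧
      RingTheory.Sequence.IsRegular (Localization.AtPrime m) rs ∧
      ((rs.length : ℕ∞) : WithBot ℕ∞) = ringKrullDim (Localization.AtPrime m)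

/-- `I` (equivalently `S/I`) has a `p`-linear resolution: there is an exact complex
`0 → F_s → ⋯ → F_2 → F_1 → I → 0` of free modules of finite rank in which the map `F_1 → I` is given
by forms of degree `p` and all the other maps are given by matrices of linear forms (so that
`F_i = S(-p-i+1)^{β_i}`, and for `p ≥ 1` the resolution is minimal).
Here `F_{i+1}` has rank `β i`, the forms `g` define `F_1 → I`, and `M i` is the matrix of
`F_{i+2} → F_{i+1}`. -/
def HasLinearResolution {K : Type*} [Field K] {n : ℕ} (I : Ideal (MvPolynomial (Fin n) K))
    (p : ℕ) : Prop :=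
  ∃ (s : ℕ) (β : ℕ → ℕ) (g : Fin (β 0) → MvPolynomial (Fin n) K)
    (M : ∀ i : ℕ, Matrix (Fin (β i)) (Fin (β (i + 1))) (MvPolynomial (Fin n) K)),
    (∀ i, s ≤ i → β i = 0) ∧
    (∀ j, (g j).IsHomogeneous p) ∧
    (∀ i a b, (M i a b).IsHomogeneous 1) ∧
    Ideal.span (Set.range g) = I ∧
    (∀ v : Fin (β 0) → MvPolynomial (Fin n) K,
      ∑ j, v j * g j = 0 ↔ ∃ w, v = (M 0).mulVec w) ∧
    (∀ (i : ℕ) (v : Fin (β (i + 1)) → MvPolynomial (Fin n) K),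
      (M i).mulVec v = 0 ↔ ∃ w, v = (M (i + 1)).mulVec w)

end

end LinearIdeals

open LinearIdeals

/-! Numerators. For a homogeneous ideal of height c, the Hilbert-Serre theorem writes the series
with denominator (1-t)^n. Noether normalization bounds the growth of the Hilbert function, so
(1-t)^(n-c) already clears the pole at 1; let N be the numerator. Since I contains no nonzero form
of degree below p, (1-t)^c N is 1 modulo t^p. The polynomial h(c,p) truncates (1-t)^(-c), so N =
h(c,p) - t^p R(1-t) for a unique polynomial R (`exists_remainder`). The s_i are the coefficients of
R in reverse order, and `delta` is the least δ such that R has no coefficient in degrees δ and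
above.

Duality. For squarefree I, grouping the monomials outside I by support gives (1-t)^n H = f(t), where
f is the sum of t^|F| (1-t)^(n-|F|) over the faces F. Over all subsets this sum is 1, so passing to
complements of nonfaces gives f*(t) = 1 - f(1-t) for the dual. The Bezout identity (1-t)^c h(c,p)(t)
+ t^p h(p,c)(1-t) = 1 then carries the remainder R over to the dual
(`hilbertSeriesEq_alexanderDual`). In item 1, δ = d suffices because f has degree at most n.

Linear resolution (Eagon-Reiner). The Koszul homology of the dual of J is computed in each
multidegree. A multidegree that is not squarefree gives a cone; a squarefree one with support W
gives the simplicial chains of the link of the complement of W in the complex of J. Reisner's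
criterion makes the homology of the link vanish below the top, so only the linear strand survives
(`exists_boundary_multidegree`). It is proved from the Koszul complex on the squares of the
variables over the localized Cohen-Macaulay ring, by reading off one multidegree and dualizing.
Linear Koszul homology passes to syzygies by dimension shifting (`IsKoszulLinear.relations`), which
builds the resolution step by step. -/

open LinearIdeals

namespace Koszul

/-! ### Koszul complexes with explicit signs, and depth sensitivity -/

section Complex

open scoped Pointwise

variable {ι : Type*} [DecidableEq ι]

/-- A system of signs making the Koszul differential square to zero. -/
structure IsSignSystem (σ : ι → Finset ι → ℤ) : Prop where
  mul_self : ∀ j G, σ j G * σ j G = 1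
  anticomm : ∀ G j k, j ∉ G → k ∉ G → j ≠ k →
    σ j G * σ k (insert j G) = -(σ k G * σ j (insert k G))

/-- Follows from `anticomm` because signs square to one. In this form it cancels the mixed terms of
the homotopy in `diff_wedge`. -/
lemma IsSignSystem.anticomm' {σ : ι → Finset ι → ℤ} (hσ : IsSignSystem σ) {G : Finset ι} {j k : ι}
    (hj : j ∉ G) (hk : k ∉ G) (hjk : j ≠ k) :
    σ k (insert j G) * σ j (insert k G) = -(σ j G * σ k G) := by
  have h := hσ.anticomm G j k hj hk hjk
  have h1 := hσ.mul_self j G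
  have h2 := hσ.mul_self j (insert k G)
  linear_combination σ j G * σ j (insert k G) * h + (-(σ k (insert j G)) * σ j (insert k G)) * h1
    - σ k G * σ j G * h2

/-- The standard signs of the Koszul complex. -/
def stdSign {n : ℕ} (j : Fin n) (G : Finset (Fin n)) : ℤ := ∏ g ∈ G, if g < j then -1 else 1

lemma stdSign_mul_self {n : ℕ} (j : Fin n) (G : Finset (Fin n)) :
    stdSign j G * stdSign j G = 1 := by
  rw [stdSign, ← Finset.prod_mul_distrib]
  exact Finset.prod_eq_one fun g _ => by split_ifs <;> norm_num

lemma stdSign_union {n : ℕ} (j : Fin n) {F G : Finset (Fin n)} (h : Disjoint F G) :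
    stdSign j (F ∪ G) = stdSign j F * stdSign j G :=
  Finset.prod_union h

lemma isSignSystem_stdSign (n : ℕ) : IsSignSystem (stdSign (n := n)) where
  mul_self := stdSign_mul_self
  anticomm G j k hj hk hjk := by
    simp only [stdSign, Finset.prod_insert hj, Finset.prod_insert hk]
    rcases lt_or_gt_of_ne hjk with h | h
    · rw [if_pos h, if_neg h.not_gt]; ring
    · rw [if_pos h, if_neg h.not_gt]; ring

variable {A M : Type*} [CommRing A] [AddCommGroup M] [Module A M]

/-- Left multiplication by the `j`-th basis vector. -/
def wedge (σ : ι → Finset ι → ℤ) (j : ι) (z : Finset ι → M) : Finset ι → M :=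
  fun G => if j ∈ G then σ j (G.erase j) • z (G.erase j) else 0

@[simp] lemma wedge_zero {σ : ι → Finset ι → ℤ} {j : ι} : wedge σ j (0 : Finset ι → M) = 0 := by
  funext G; simp [wedge]

lemma wedge_support {σ : ι → Finset ι → ℤ} {j : ι} {z : Finset ι → M} {i : ℕ} (hz : ∀ G, G.card ≠ i → z G = 0)
    (G : Finset ι) (hG : G.card ≠ i + 1) : wedge σ j z G = 0 := by
  unfold wedge
  split_ifs with h
  · rw [hz _ (fun h' => hG ?_), smul_zero]
    rw [← Finset.card_erase_add_one h, h']
  · rfl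

variable [Fintype ι]

/-- Signs for the transposed differential: complements of faces, twisted by `ε`. -/
lemma IsSignSystem.compl {σ : ι → Finset ι → ℤ} (hσ : IsSignSystem σ) {ε : ι → ℤ}
    (hε : ∀ j, ε j * ε j = 1) : IsSignSystem fun j G => ε j * σ j (insert j G)ᶜ where
  mul_self j G := by
    linear_combination (σ j (insert j G)ᶜ * σ j (insert j G)ᶜ) * hε j + hσ.mul_self j (insert j G)ᶜ
  anticomm G j k hj hk hjk := by
    have h := hσ.anticomm (insert k (insert j G))ᶜ j k (by simp) (by simp) hjk
    have e1 : insert j (insert k (insert j G))ᶜ = (insert k G)ᶜ := by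
      ext a; by_cases ha : a = j
      · subst ha; simp [hjk, hj]
      · simp [ha]
    have e2 : insert k (insert k (insert j G))ᶜ = (insert j G)ᶜ := by
      ext a; by_cases ha : a = k
      · subst ha; simp [hjk.symm, hk]
      · simp [ha]
    rw [e1, e2] at h
    rw [Finset.insert_comm j k]
    linear_combination (ε j * ε k) * h

/-- The Koszul differential on the family `y`. -/
def diff (σ : ι → Finset ι → ℤ) (y : ι → A) (z : Finset ι → M) : Finset ι → M :=
  fun G => ∑ j ∈ Gᶜ, σ j G • y j • z (insert j G)

variable {σ : ι → Finset ι → ℤ} {y : ι → A}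

lemma diff_add (z w : Finset ι → M) : diff σ y (z + w) = diff σ y z + diff σ y w := by
  funext G; simp [diff, Finset.sum_add_distrib]

lemma diff_sub (z w : Finset ι → M) : diff σ y (z - w) = diff σ y z - diff σ y w := by
  funext G; simp [diff, smul_sub, Finset.sum_sub_distrib]

lemma diff_smul (a : A) (z : Finset ι → M) : diff σ y (a • z) = a • diff σ y z := by
  funext G
  simp only [diff, Pi.smul_apply, Finset.smul_sum]
  exact Finset.sum_congr rfl fun j _ => by rw [smul_comm (y j) a, smul_comm (σ j G) a]

lemma diff_comp {N : Type*} [AddCommGroup N] [Module A N] (f : M →ₗ[A] N) (z : Finset ι → M) :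
    diff σ y (fun G => f (z G)) = fun G => f (diff σ y z G) := by
  funext G; simp [diff]

@[simp] lemma diff_zero : diff σ y (0 : Finset ι → M) = 0 := by
  funext G; simp [diff]

/-- The terms of the ordered pairs (j, k) and (k, j) cancel by anticommutativity of the signs. -/
lemma diff_diff (hσ : IsSignSystem σ) (z : Finset ι → M) : diff σ y (diff σ y z) = 0 := by
  funext G
  have h : diff σ y (diff σ y z) G = ∑ q ∈ Gᶜ.offDiag,
      σ q.1 G • y q.1 • σ q.2 (insert q.1 G) • y q.2 • z (insert q.2 (insert q.1 G)) := by
    simp only [diff, Finset.smul_sum]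
    rw [Finset.sum_sigma']
    refine Finset.sum_bij' (fun q _ => (q.1, q.2)) (fun q _ => ⟨q.1, q.2⟩) ?_ ?_ ?_ ?_ ?_
    · rintro ⟨a, b⟩ h; simp at h ⊢; tauto
    · rintro ⟨a, b⟩ h; simp at h ⊢; tauto
    · simp
    · simp
    · simp
  rw [h]
  refine Finset.sum_involution (fun q _ => (q.2, q.1)) ?_ ?_ ?_ ?_
  · rintro ⟨j, k⟩ hq
    simp only [Finset.mem_offDiag, Finset.mem_compl] at hq
    have h := hσ.anticomm G j k hq.1 hq.2.1 hq.2.2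
    simp only
    rw [Finset.insert_comm j k, smul_comm (y j), smul_comm (y k), smul_smul, smul_smul, smul_smul,
      smul_smul, h, mul_comm (y k), neg_smul, neg_add_cancel]
  · rintro ⟨j, k⟩ hq _ h
    simp only [Finset.mem_offDiag, Finset.mem_compl] at hq
    exact hq.2.2 (congrArg Prod.fst h).symm
  · rintro ⟨j, k⟩ hq
    simp only [Finset.mem_offDiag, Finset.mem_compl] at hq ⊢
    exact ⟨hq.2.1, hq.1, hq.2.2.symm⟩
  · rintro ⟨j, k⟩ hq; rfl

/-- The contracting homotopy for multiplication by `y j`. -/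
lemma diff_wedge (hσ : IsSignSystem σ) (j : ι) (z : Finset ι → M) :
    diff σ y (wedge σ j z) + wedge σ j (diff σ y z) = y j • z := by
  funext G
  simp only [Pi.add_apply, Pi.smul_apply]
  by_cases hj : j ∈ G
  · obtain ⟨H, hH, rfl⟩ : ∃ H, j ∉ H ∧ insert j H = G :=
      ⟨G.erase j, Finset.notMem_erase j G, Finset.insert_erase hj⟩
    have hc : Hᶜ = insert j (insert j H)ᶜ := by
      ext a; by_cases ha : a = j
      · subst ha; simp [hH]
      · simp [ha]
    have hw : wedge σ j (diff σ y z) (insert j H) = y j • z (insert j H) +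
        ∑ k ∈ (insert j H)ᶜ, (σ j H * σ k H) • y k • z (insert k H) := by
      rw [wedge, if_pos (Finset.mem_insert_self _ _), Finset.erase_insert hH, diff, hc,
        Finset.sum_insert (by simp), smul_add, smul_smul, hσ.mul_self, one_smul, Finset.smul_sum]
      simp only [smul_smul]
    have hd : diff σ y (wedge σ j z) (insert j H) =
        ∑ k ∈ (insert j H)ᶜ, (-(σ j H * σ k H)) • y k • z (insert k H) := by
      refine Finset.sum_congr rfl fun k hk => ?_
      simp only [Finset.mem_compl, Finset.mem_insert, not_or] at hk
      rw [wedge, if_pos (by simp), Finset.insert_comm k j,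
        Finset.erase_insert (by simp [hH, Ne.symm hk.1]), smul_comm (y k), smul_smul,
        hσ.anticomm' hH hk.2 (Ne.symm hk.1)]
    rw [hw, hd, add_left_comm, ← Finset.sum_add_distrib]
    simp [neg_smul]
  · have hw : wedge σ j (diff σ y z) G = 0 := if_neg hj
    rw [hw, add_zero, diff, Finset.sum_eq_single j]
    · rw [wedge, if_pos (by simp), Finset.erase_insert hj, smul_comm (y j), smul_smul,
        hσ.mul_self, one_smul]
    · intro k _ hk
      rw [wedge, if_neg (by simp [hj, Ne.symm hk]), smul_zero, smul_zero]
    · intro h; exact absurd (Finset.mem_compl.mpr hj) h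

/-- Every cycle of homological degree `i` is a boundary. -/
def Exact (σ : ι → Finset ι → ℤ) (y : ι → A) (M : Type*) [AddCommGroup M] [Module A M] (i : ℕ) :
    Prop :=
  ∀ z : Finset ι → M, (∀ G, G.card ≠ i → z G = 0) → diff σ y z = 0 →
    ∃ w : Finset ι → M, (∀ G, G.card ≠ i + 1 → w G = 0) ∧ diff σ y w = z

/-- The ideal generated by `y` annihilates Koszul homology. -/
lemma exists_diff_eq_smul (hσ : IsSignSystem σ) {z : Finset ι → M} {i : ℕ}
    (hz : ∀ G, G.card ≠ i → z G = 0) (hc : diff σ y z = 0) {a : A}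
    (ha : a ∈ Ideal.span (Set.range y)) :
    ∃ w : Finset ι → M, (∀ G, G.card ≠ i + 1 → w G = 0) ∧ diff σ y w = a • z := by
  induction ha using Submodule.span_induction with
  | mem a h =>
    obtain ⟨j, rfl⟩ := h
    refine ⟨wedge σ j z, wedge_support hz, ?_⟩
    have h := diff_wedge (y := y) hσ j z
    rwa [hc, wedge_zero, add_zero] at h
  | zero => exact ⟨0, by simp, by simp⟩
  | add a b _ _ ha hb =>
    obtain ⟨u, hu, hu'⟩ := ha
    obtain ⟨v, hv, hv'⟩ := hb
    exact ⟨u + v, fun G hG => by simp [hu G hG, hv G hG], by rw [diff_add, hu', hv', add_smul]⟩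
  | smul c a _ ha =>
    obtain ⟨u, hu, hu'⟩ := ha
    exact ⟨c • u, fun G hG => by simp [hu G hG], by rw [diff_smul, hu', smul_eq_mul, mul_smul]⟩

/-- Depth sensitivity of the Koszul complex. -/
theorem exact_of_isWeaklyRegular (hσ : IsSignSystem σ) (y : ι → A) (rs : List A)
    (hrs : ∀ r ∈ rs, ∃ N : ℕ, r ^ N ∈ Ideal.span (Set.range y)) :
    ∀ (M : Type*) [AddCommGroup M] [Module A M], RingTheory.Sequence.IsWeaklyRegular M rs →
      ∀ i, Fintype.card ι < i + rs.length → Exact σ y M i := by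
  induction rs with
  | nil =>
    intro M _ _ _ i hi z hz _
    refine ⟨0, by simp, ?_⟩
    rw [diff_zero]
    funext G
    refine (hz G fun h => ?_).symm
    have := Finset.card_le_univ G
    simp at hi
    omega
  | cons r rs ih =>
    intro M _ _ hreg i hi
    rw [RingTheory.Sequence.isWeaklyRegular_cons_iff] at hreg
    have hq := ih (fun r hr => hrs r (List.mem_cons_of_mem _ hr)) _ hreg.2 (i + 1)
      (by simp at hi; omega)
    -- Multiplication by `r` is injective on homology in degree `i`. If ∂w = r z, then w is a cycle
    -- modulo r, hence a boundary ∂v modulo r by induction. So w - ∂v = r t, whence r ∂t = r z, and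
    -- r is a nonzerodivisor on `M`.
    have key : ∀ z : Finset ι → M, (∀ G, G.card ≠ i → z G = 0) →
        (∃ w : Finset ι → M, (∀ G, G.card ≠ i + 1 → w G = 0) ∧ diff σ y w = r • z) →
        ∃ w : Finset ι → M, (∀ G, G.card ≠ i + 1 → w G = 0) ∧ diff σ y w = z := by
      rintro z hz ⟨w, hw, hwz⟩
      let π := (r • (⊤ : Submodule A M)).mkQ
      obtain ⟨u, hu, hud⟩ := hq (fun G => π (w G)) (fun G hG => by simp [hw G hG]) (by
        rw [diff_comp]
        funext G
        rw [hwz]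
        exact (Submodule.Quotient.mk_eq_zero _).mpr
          (Submodule.smul_mem_pointwise_smul _ _ _ trivial))
      have hlift : ∀ G, ∃ v : M, π v = u G ∧ (G.card ≠ i + 1 + 1 → v = 0) := by
        intro G
        by_cases hG : G.card ≠ i + 1 + 1
        · exact ⟨0, by rw [map_zero, hu G hG], fun _ => rfl⟩
        · obtain ⟨v, hv⟩ := Submodule.mkQ_surjective _ (u G)
          exact ⟨v, hv, fun h => absurd h hG⟩
      choose v hv hv0 using hlift
      have hdv : ∀ G, ∃ t : M, r • t = w G - diff σ y v G ∧ (G.card ≠ i + 1 → t = 0) := by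
        intro G
        by_cases hG : G.card ≠ i + 1
        · refine ⟨0, ?_, fun _ => rfl⟩
          rw [hw G hG, smul_zero, zero_sub, eq_comm, neg_eq_zero, diff]
          refine Finset.sum_eq_zero fun j hj => ?_
          rw [hv0 _ (fun h => hG ?_), smul_zero, smul_zero]
          rw [Finset.card_insert_of_notMem (Finset.mem_compl.mp hj)] at h
          omega
        · have h0 : π (w G - diff σ y v G) = 0 := by
            have h1 := congrFun (diff_comp (σ := σ) (y := y) π v) G
            rw [map_sub, ← h1, sub_eq_zero]
            have h2 := congrFun hud G
            rw [← h2]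
            congr 1
            funext G'
            exact (hv G').symm
          have h3 := (Submodule.Quotient.mk_eq_zero _).mp h0
          obtain ⟨t, -, ht⟩ := h3
          exact ⟨t, ht, fun h => absurd h hG⟩
      choose t ht ht0 using hdv
      refine ⟨t, ht0, ?_⟩
      have h4 : r • diff σ y t = r • z := by
        rw [← diff_smul, ← hwz]
        have : r • t = w - diff σ y v := by funext G; exact ht G
        rw [this, diff_sub, diff_diff hσ, sub_zero]
      funext G
      exact hreg.1 (congrFun h4 G)
    intro z hz hc
    -- A power of `r` lies in the ideal of `y` and therefore kills homology; by `key` the factors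
    -- `r` can be removed one at a time.
    obtain ⟨N, hN⟩ := hrs r List.mem_cons_self
    have hb := exists_diff_eq_smul hσ hz hc hN
    clear hN
    induction N with
    | zero => rw [pow_zero, one_smul] at hb; exact hb
    | succ N ihN =>
      refine ihN (key (r ^ N • z) (fun G hG => by simp [hz G hG]) ?_)
      rwa [smul_smul, ← pow_succ']

end Complex

/-! ### Koszul chains over the polynomial ring, one multidegree at a time -/

section Multigraded

variable {K : Type*} [Field K] {n : ℕ}

/-- The exponent of the squarefree monomial supported on `G`. -/
noncomputable def ind (G : Finset (Fin n)) : Fin n →₀ ℕ :=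
  Finsupp.equivFunOnFinite.symm fun j => if j ∈ G then 1 else 0

@[simp] lemma ind_apply (G : Finset (Fin n)) (j : Fin n) : ind G j = if j ∈ G then 1 else 0 := rfl

lemma degree_ind (G : Finset (Fin n)) : (ind G).degree = G.card := by
  simp [Finsupp.degree_eq_sum]

lemma ind_le_iff {G : Finset (Fin n)} {b : Fin n →₀ ℕ} : ind G ≤ b ↔ G ⊆ b.support := by
  constructor
  · intro h j hj
    have := h j
    simp only [ind_apply, if_pos hj] at this
    simp; omega
  · intro h j
    rw [ind_apply]
    split_ifs with hj
    · have := h hj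
      simp at this; omega
    · exact Nat.zero_le _

lemma ind_insert {G : Finset (Fin n)} {j : Fin n} (hj : j ∉ G) :
    ind (insert j G) = ind G + Finsupp.single j 1 := by
  ext k
  by_cases hk : k = j
  · subst hk; simp [hj]
  · simp [hk]

/-- The part of multidegree `b` of a Koszul chain. -/
noncomputable def multiPart (b : Fin n →₀ ℕ) (z : Finset (Fin n) → MvPolynomial (Fin n) K) :
    Finset (Fin n) → K :=
  fun G => if ind G ≤ b then coeff (b - ind G) (z G) else 0

lemma ext_multiPart {z w : Finset (Fin n) → MvPolynomial (Fin n) K}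
    (h : ∀ b, multiPart b z = multiPart b w) : z = w := by
  funext G
  ext a
  have := congrFun (h (a + ind G)) G
  simpa [multiPart] using this

/-- In multidegree `b` the coefficient of the basis element of `G` is a scalar times x^(b - ind G),
so every variable acts as 1 and a simplicial boundary over `K` remains. -/
lemma multiPart_diff (σ : Fin n → Finset (Fin n) → ℤ) (b : Fin n →₀ ℕ)
    (z : Finset (Fin n) → MvPolynomial (Fin n) K) :
    multiPart b (diff σ (X : Fin n → MvPolynomial (Fin n) K) z) = diff σ (fun _ => (1 : K)) (multiPart b z) := by
  funext G
  simp only [multiPart, diff, one_smul]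
  split_ifs with hG
  · rw [coeff_sum]
    refine Finset.sum_congr rfl fun j hj => ?_
    rw [Finset.mem_compl] at hj
    have h1 : ind (insert j G) ≤ b ↔ j ∈ (b - ind G).support := by
      rw [ind_le_iff, Finset.insert_subset_iff, ← ind_le_iff (G := G)]
      simp [hj, hG]
    rw [coeff_smul, smul_eq_mul, coeff_X_mul', if_congr h1 rfl rfl, ind_insert hj, tsub_add_eq_tsub_tsub]
  · refine (Finset.sum_eq_zero fun j hj => ?_).symm
    rw [if_neg, smul_zero]
    rw [ind_le_iff] at hG ⊢
    exact fun h => hG ((Finset.subset_insert _ _).trans h)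

/-- Exactness of a Koszul complex of monomials can be checked in each multidegree. -/
theorem exists_boundary_of_multidegree (σ : Fin n → Finset (Fin n) → ℤ)
    (P : (Fin n →₀ ℕ) → Prop) (i t : ℕ)
    (hΓ : ∀ b : Fin n →₀ ℕ, b.degree = t → ∀ c : Finset (Fin n) → K,
      (∀ G, c G ≠ 0 → G.card = i ∧ ind G ≤ b ∧ P (b - ind G)) →
      diff σ (fun _ => (1 : K)) c = 0 →
      ∃ w : Finset (Fin n) → K, (∀ G, w G ≠ 0 → G.card = i + 1 ∧ ind G ≤ b ∧ P (b - ind G)) ∧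
        diff σ (fun _ => (1 : K)) w = c)
    (z : Finset (Fin n) → MvPolynomial (Fin n) K)
    (hz : ∀ G a, coeff a (z G) ≠ 0 → G.card = i ∧ a.degree + i = t ∧ P a)
    (hc : diff σ (X : Fin n → MvPolynomial (Fin n) K) z = 0) :
    ∃ w : Finset (Fin n) → MvPolynomial (Fin n) K,
      (∀ G a, coeff a (w G) ≠ 0 → G.card = i + 1 ∧ a.degree + (i + 1) = t ∧ P a) ∧
      diff σ (X : Fin n → MvPolynomial (Fin n) K) w = z := by
  have key : ∀ b : Fin n →₀ ℕ, ∃ w : Finset (Fin n) → K,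
      (∀ G, w G ≠ 0 → b.degree = t ∧ G.card = i + 1 ∧ ind G ≤ b ∧ P (b - ind G)) ∧
      diff σ (fun _ => (1 : K)) w = multiPart b z := by
    intro b
    have hcb : diff σ (fun _ => (1 : K)) (multiPart b z) = 0 := by
      rw [← multiPart_diff, hc]
      funext G; simp [multiPart]
    have hdeg : ∀ G, ind G ≤ b → (b - ind G).degree + G.card = b.degree := by
      intro G hG
      rw [← degree_ind, ← map_add, tsub_add_cancel_of_le hG]
    by_cases hb : b.degree = t
    · obtain ⟨w, hw, hwd⟩ := hΓ b hb (multiPart b z) (fun G hG => by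
        unfold multiPart at hG
        split_ifs at hG with h
        · exact ⟨(hz _ _ hG).1, h, (hz _ _ hG).2.2⟩
        · exact absurd rfl hG) hcb
      exact ⟨w, fun G hG => ⟨hb, hw G hG⟩, hwd⟩
    · refine ⟨0, by simp, ?_⟩
      rw [diff_zero]
      funext G
      by_contra hG
      have hG' : multiPart b z G ≠ 0 := fun h => hG h.symm
      unfold multiPart at hG'
      split_ifs at hG' with h
      · have h1 := hz _ _ hG'
        have h2 := hdeg G h
        omega
      · exact hG' rfl
  choose w hw hwd using key
  -- The scalar solutions vanish unless `b` has degree `t`, so exponents of degree at most `t`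
  -- suffice to assemble a polynomial chain.
  let A : Finset (Fin n →₀ ℕ) := (Finsupp.finite_of_degree_le (σ := Fin n) t).toFinset
  let W : Finset (Fin n) → MvPolynomial (Fin n) K :=
    fun G => ∑ a ∈ A, monomial a (w (a + ind G) G)
  have hW : ∀ G a, coeff a (W G) = w (a + ind G) G := by
    intro G a
    simp only [W, coeff_sum, coeff_monomial]
    rw [Finset.sum_ite_eq' A a]
    split_ifs with ha
    · rfl
    · by_contra h
      have h1 := (hw _ _ (Ne.symm h)).1
      apply ha
      simp only [A, Set.Finite.mem_toFinset, Set.mem_ofPred_eq]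
      rw [map_add] at h1
      omega
  refine ⟨W, ?_, ?_⟩
  · intro G a ha
    rw [hW] at ha
    obtain ⟨h1, h2, -, h4⟩ := hw _ _ ha
    rw [map_add, degree_ind] at h1
    rw [add_tsub_cancel_right] at h4
    exact ⟨h2, by omega, h4⟩
  · apply ext_multiPart
    intro b
    rw [multiPart_diff, ← hwd]
    congr 1
    funext G
    unfold multiPart
    split_ifs with h
    · rw [hW, tsub_add_cancel_of_le h]
    · by_contra h'
      exact h (hw _ _ (Ne.symm h')).2.2.1

/-- A complex spanned by faces of a cone is exact. -/
lemma exists_boundary_of_cone {σ : Fin n → Finset (Fin n) → ℤ} (hσ : IsSignSystem σ)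
    (Γ : Finset (Fin n) → Prop) (j : Fin n) (hΓ : ∀ G, j ∉ G → Γ G → Γ (insert j G)) (i : ℕ)
    (c : Finset (Fin n) → K) (hc : ∀ G, c G ≠ 0 → G.card = i ∧ Γ G)
    (hd : diff σ (fun _ => (1 : K)) c = 0) :
    ∃ w : Finset (Fin n) → K, (∀ G, w G ≠ 0 → G.card = i + 1 ∧ Γ G) ∧
      diff σ (fun _ => (1 : K)) w = c := by
  refine ⟨wedge σ j c, ?_, ?_⟩
  · intro G hG
    unfold wedge at hG
    split_ifs at hG with hj
    · have h := hc (G.erase j) fun h => hG (by rw [h, smul_zero])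
      refine ⟨by rw [← h.1, Finset.card_erase_add_one hj], ?_⟩
      rw [← Finset.insert_erase hj]
      exact hΓ _ (Finset.notMem_erase _ _) h.2
    · exact absurd rfl hG
  · have h := diff_wedge (y := fun _ => (1 : K)) hσ j c
    rwa [hd, one_smul, wedge_zero, add_zero] at h

/-- The Koszul complex of the polynomial ring is exact outside degree zero. -/
lemma exists_boundary_of_degree_ne_zero {σ : Fin n → Finset (Fin n) → ℤ} (hσ : IsSignSystem σ)
    (i t : ℕ) (ht : t ≠ 0) (z : Finset (Fin n) → MvPolynomial (Fin n) K)
    (hz : ∀ G a, coeff a (z G) ≠ 0 → G.card = i ∧ a.degree + i = t) (hc : diff σ (X : Fin n → MvPolynomial (Fin n) K) z = 0) :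
    ∃ w : Finset (Fin n) → MvPolynomial (Fin n) K,
      (∀ G a, coeff a (w G) ≠ 0 → G.card = i + 1 ∧ a.degree + (i + 1) = t) ∧
      diff σ (X : Fin n → MvPolynomial (Fin n) K) w = z := by
  obtain ⟨w, hw, hd⟩ := exists_boundary_of_multidegree σ (fun _ => True) i t (fun b hb c hcb hcd => by
    -- Any index in the support of `b` is the apex of a cone.
    obtain ⟨j, hj⟩ : b.support.Nonempty := by
      rw [Finset.nonempty_iff_ne_empty, ne_eq, Finsupp.support_eq_empty]
      rintro rfl
      exact ht (by rw [← hb]; simp)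
    refine exists_boundary_of_cone hσ (fun G => ind G ≤ b ∧ True) j ?_ i c hcb hcd
    rintro G - ⟨hG, -⟩
    rw [ind_le_iff] at hG ⊢
    exact ⟨Finset.insert_subset hj hG, trivial⟩) z (fun G a h => by simpa using hz G a h) hc
  exact ⟨w, fun G a h => by simpa using hw G a h, hd⟩

end Multigraded

/-! ### From linear Koszul homology to a linear resolution -/

section Linear

variable {K : Type*} [Field K] {n : ℕ}

/-- A Koszul chain with coefficients in a free module, of homological degree `i` and internal
degree `t`. -/
def Bihomogeneous {b : ℕ} (i t : ℕ)
    (z : Finset (Fin n) → Fin b → MvPolynomial (Fin n) K) : Prop :=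
  ∀ G k a, coeff a (z G k) ≠ 0 → G.card = i ∧ a.degree + i = t

/-- A submodule of a free module which contains the homogeneous components of its elements. -/
def IsGraded {b : ℕ} (U : Submodule (MvPolynomial (Fin n) K) (Fin b → MvPolynomial (Fin n) K)) :
    Prop :=
  ∀ v ∈ U, ∀ d, (fun k => homogeneousComponent d (v k)) ∈ U

/-- The Koszul homology of `U` is concentrated in the linear strand starting in degree `p`, and
vanishes in homological degrees at least `r`. -/
def IsKoszulLinear {b : ℕ}
    (U : Submodule (MvPolynomial (Fin n) K) (Fin b → MvPolynomial (Fin n) K)) (p r : ℕ) : Prop :=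
  ∀ i t, ¬ (t = p + i ∧ i < r) → ∀ z : Finset (Fin n) → Fin b → MvPolynomial (Fin n) K,
    (∀ G, z G ∈ U) → Bihomogeneous i t z →
    diff stdSign (X : Fin n → MvPolynomial (Fin n) K) z = 0 →
    ∃ w : Finset (Fin n) → Fin b → MvPolynomial (Fin n) K, (∀ G, w G ∈ U) ∧
      Bihomogeneous (i + 1) t w ∧ diff stdSign (X : Fin n → MvPolynomial (Fin n) K) w = z

lemma diff_apply {ι : Type*} [DecidableEq ι] [Fintype ι] {A κ : Type*} [CommRing A]
    (σ : ι → Finset ι → ℤ) (y : ι → A) (z : Finset ι → κ → A) (G : Finset ι) (k : κ) :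
    diff σ y z G k = diff σ y (fun G => z G k) G := by
  simp only [diff, Finset.sum_apply, Pi.smul_apply]

lemma Bihomogeneous.diff {b i t : ℕ} {z : Finset (Fin n) → Fin b → MvPolynomial (Fin n) K}
    (hz : Bihomogeneous (i + 1) t z) (σ : Fin n → Finset (Fin n) → ℤ) :
    Bihomogeneous i t (diff σ (X : Fin n → MvPolynomial (Fin n) K) z) := by
  intro G k a ha
  rw [diff_apply, Koszul.diff, coeff_sum] at ha
  obtain ⟨j, hj, hj'⟩ := Finset.exists_ne_zero_of_sum_ne_zero ha
  rw [Finset.mem_compl] at hj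
  rw [coeff_smul, smul_eq_mul, coeff_X_mul'] at hj'
  split_ifs at hj' with h
  · have h0 := hz (insert j G) k (a - Finsupp.single j 1) fun h => hj' (by rw [h, smul_zero])
    rw [Finset.card_insert_of_notMem hj] at h0
    have h1 : Finsupp.single j 1 ≤ a := by
      rw [Finsupp.single_le_iff]
      simp at h; omega
    have h2 : (a - Finsupp.single j 1).degree + 1 = a.degree := by
      conv_rhs => rw [← tsub_add_cancel_of_le h1, map_add, Finsupp.degree_single]
    omega
  · simp at hj'

lemma bihomogeneous_of_isHomogeneous {b i t d : ℕ} (hd : d + i = t)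
    {z : Finset (Fin n) → Fin b → MvPolynomial (Fin n) K}
    (hz : ∀ G k, (z G k).IsHomogeneous d) (h0 : ∀ G, G.card ≠ i → z G = 0) :
    Bihomogeneous i t z := by
  intro G k a ha
  by_cases hG : G.card = i
  · refine ⟨hG, ?_⟩
    have h := hz G k
    rw [← hd]
    by_contra hne
    exact ha (h.coeff_eq_zero fun h' => hne (by rw [h']))
  · rw [h0 G hG] at ha
    simp at ha

lemma Bihomogeneous.isHomogeneous {b i t d : ℕ} (hd : d + i = t)
    {z : Finset (Fin n) → Fin b → MvPolynomial (Fin n) K} (hz : Bihomogeneous i t z)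
    (G : Finset (Fin n)) (k : Fin b) : (z G k).IsHomogeneous d := by
  rw [← mem_homogeneousSubmodule, homogeneousSubmodule_eq_finsupp_supported]
  intro a ha
  have := (hz G k a (mem_support_iff.mp ha)).2
  show a.degree = d
  omega

lemma Bihomogeneous.eq_zero {b i t : ℕ} (hd : t < i)
    {z : Finset (Fin n) → Fin b → MvPolynomial (Fin n) K} (hz : Bihomogeneous i t z) : z = 0 := by
  funext G k
  ext a
  by_contra h
  have := (hz G k a h).2
  omega

lemma Bihomogeneous.apply_eq_zero {b i t : ℕ}
    {z : Finset (Fin n) → Fin b → MvPolynomial (Fin n) K} (hz : Bihomogeneous i t z)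
    {G : Finset (Fin n)} (hG : G.card ≠ i) : z G = 0 := by
  funext k
  ext a
  by_contra h
  exact hG (hz G k a h).1

lemma homogeneousComponent_mul_of_isHomogeneous (f : MvPolynomial (Fin n) K)
    {g : MvPolynomial (Fin n) K} {p : ℕ} (hg : g.IsHomogeneous p) (d : ℕ) :
    homogeneousComponent (d + p) (f * g) = homogeneousComponent d f * g := by
  conv_lhs => rw [← sum_homogeneousComponent f, Finset.sum_mul, map_sum]
  have h : ∀ i, homogeneousComponent (d + p) (homogeneousComponent i f * g) =
      if i = d then homogeneousComponent d f * g else 0 := by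
    intro i
    have := ((homogeneousComponent_isHomogeneous i f).mul hg)
    rw [homogeneousComponent_of_mem this]
    by_cases hi : i = d
    · subst hi; simp
    · rw [if_neg (by omega), if_neg hi]
  simp only [h]
  rw [Finset.sum_ite_eq']
  split_ifs with hd
  · rfl
  · rw [homogeneousComponent_eq_zero, zero_mul]
    simpa using hd

lemma homogeneousComponent_mul_of_lt (f : MvPolynomial (Fin n) K)
    {g : MvPolynomial (Fin n) K} {p : ℕ} (hg : g.IsHomogeneous p) {d : ℕ} (hd : d < p) :
    homogeneousComponent d (f * g) = 0 := by
  conv_lhs => rw [← sum_homogeneousComponent f, Finset.sum_mul, map_sum]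
  refine Finset.sum_eq_zero fun i _ => ?_
  rw [homogeneousComponent_of_mem ((homogeneousComponent_isHomogeneous i f).mul hg), if_neg]
  omega

/-- A Koszul chain concentrated on the empty set. -/
def chainOf {M : Type*} [Zero M] (v : M) : Finset (Fin n) → M := fun G => if G = ∅ then v else 0

lemma diff_chainOf {A M : Type*} [CommRing A] [AddCommGroup M] [Module A M]
    (σ : Fin n → Finset (Fin n) → ℤ) (y : Fin n → A) (v : M) : diff σ y (chainOf v) = 0 := by
  funext G
  refine Finset.sum_eq_zero fun j _ => ?_
  simp [chainOf, Finset.insert_ne_empty]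

variable {b : ℕ} {U : Submodule (MvPolynomial (Fin n) K) (Fin b → MvPolynomial (Fin n) K)}

/-- Graded Nakayama: Koszul homology in degree 0 is `U` modulo the variables times `U`. Off degree p
it vanishes, so a homogeneous element there is a combination of variables times elements of `U` of
degree one less, and induction on the degree applies. -/
lemma IsKoszulLinear.mem_of_isHomogeneous {p r : ℕ} (hU : IsKoszulLinear U p r)
    (V : Submodule (MvPolynomial (Fin n) K) (Fin b → MvPolynomial (Fin n) K))
    (hV : 0 < r → ∀ v ∈ U, (∀ k, (v k).IsHomogeneous p) → v ∈ V) (d : ℕ) :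
    ∀ v ∈ U, (∀ k, (v k).IsHomogeneous d) → v ∈ V := by
  induction d with
  | zero =>
    intro v hv hd
    by_cases h : 0 = p ∧ 0 < r
    · exact hV h.2 v hv (h.1 ▸ hd)
    -- The vector `v`, placed on the empty set, is a cycle of homological degree 0.
    · obtain ⟨w, hw, hwb, hwd⟩ := hU 0 0 (by omega) (chainOf v)
        (fun G => by unfold chainOf; split_ifs; exacts [hv, U.zero_mem])
        (bihomogeneous_of_isHomogeneous (d := 0) rfl
          (fun G k => by unfold chainOf; split_ifs; exacts [hd k, isHomogeneous_zero _ _ _])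
          (fun G hG => if_neg (by simpa using hG))) (diff_chainOf _ _ _)
      rw [hwb.eq_zero (by omega), diff_zero] at hwd
      have := congrFun hwd ∅
      simp only [chainOf, if_true, Pi.zero_apply] at this
      rw [← this]; exact V.zero_mem
  | succ d ih =>
    intro v hv hd
    by_cases h : d + 1 = p ∧ 0 < r
    · exact hV h.2 v hv (h.1 ▸ hd)
    · obtain ⟨w, hw, hwb, hwd⟩ := hU 0 (d + 1) (by omega) (chainOf v)
        (fun G => by unfold chainOf; split_ifs; exacts [hv, U.zero_mem])
        (bihomogeneous_of_isHomogeneous (d := d + 1) rfl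
          (fun G k => by unfold chainOf; split_ifs; exacts [hd k, isHomogeneous_zero _ _ _])
          (fun G hG => if_neg (by simpa using hG))) (diff_chainOf _ _ _)
      have := congrFun hwd ∅
      simp only [chainOf, if_true] at this
      rw [← this]
      refine V.sum_mem fun j _ => ?_
      exact zsmul_mem (V.smul_mem _ (ih _ (hw _) fun k => hwb.isHomogeneous (by omega) _ _)) _

lemma IsGraded.le (hg : IsGraded U)
    {V : Submodule (MvPolynomial (Fin n) K) (Fin b → MvPolynomial (Fin n) K)}
    (hV : ∀ d, ∀ v ∈ U, (∀ k, (v k).IsHomogeneous d) → v ∈ V) : U ≤ V := by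
  intro v hv
  have h : v = ∑ d ∈ Finset.range ((Finset.univ.sup fun k => (v k).totalDegree) + 1),
      fun k => homogeneousComponent d (v k) := by
    funext k
    rw [Finset.sum_apply]
    conv_lhs => rw [← sum_homogeneousComponent (v k)]
    refine Finset.sum_subset ?_ ?_
    · intro d hd
      simp only [Finset.mem_range] at hd ⊢
      have : (v k).totalDegree ≤ Finset.univ.sup fun k => (v k).totalDegree :=
        Finset.le_sup (f := fun k => (v k).totalDegree) (Finset.mem_univ k)
      omega
    · intro d _ hd
      exact homogeneousComponent_eq_zero _ _ (by simpa using hd)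
  rw [h]
  exact V.sum_mem fun d _ => hV d _ (hg v hv d) fun k => homogeneousComponent_isHomogeneous _ _

lemma IsKoszulLinear.eq_bot {p : ℕ} (hg : IsGraded U) (hU : IsKoszulLinear U p 0) : U = ⊥ :=
  le_bot_iff.mp (hg.le fun d => hU.mem_of_isHomogeneous ⊥ (fun h => absurd h (lt_irrefl 0)) d)

/-- The submodule of relations between the vectors `g j`. -/
noncomputable def relations {b' : ℕ} (g : Fin b' → Fin b → MvPolynomial (Fin n) K) :
    Submodule (MvPolynomial (Fin n) K) (Fin b' → MvPolynomial (Fin n) K) :=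
  LinearMap.ker (Fintype.linearCombination (MvPolynomial (Fin n) K) g)

lemma linearCombination_apply' {b' : ℕ} (g : Fin b' → Fin b → MvPolynomial (Fin n) K)
    (v : Fin b' → MvPolynomial (Fin n) K) (k : Fin b) :
    Fintype.linearCombination (MvPolynomial (Fin n) K) g v k = ∑ j, v j * g j k := by
  simp [Fintype.linearCombination_apply, Finset.sum_apply]

lemma homogeneousComponent_linearCombination {b' p : ℕ}
    {g : Fin b' → Fin b → MvPolynomial (Fin n) K} (hgp : ∀ j k, (g j k).IsHomogeneous p)
    (v : Fin b' → MvPolynomial (Fin n) K) (d : ℕ) :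
    (fun k => homogeneousComponent (d + p)
      (Fintype.linearCombination (MvPolynomial (Fin n) K) g v k)) =
    Fintype.linearCombination (MvPolynomial (Fin n) K) g
      (fun j => homogeneousComponent d (v j)) := by
  funext k
  rw [linearCombination_apply', linearCombination_apply', map_sum]
  exact Finset.sum_congr rfl fun j _ => homogeneousComponent_mul_of_isHomogeneous _ (hgp j k) d

lemma isGraded_relations {b' p : ℕ} {g : Fin b' → Fin b → MvPolynomial (Fin n) K}
    (hgp : ∀ j k, (g j k).IsHomogeneous p) : IsGraded (relations g) := by
  intro v hv d
  rw [relations, LinearMap.mem_ker] at hv ⊢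
  rw [← homogeneousComponent_linearCombination hgp, hv]
  funext k; simp

/-- The first syzygies of a module with a linear Koszul homology have linear Koszul homology. -/
lemma IsKoszulLinear.relations {p r b' : ℕ} (hU : IsKoszulLinear U p (r + 1))
    {g : Fin b' → Fin b → MvPolynomial (Fin n) K} (hgp : ∀ j k, (g j k).IsHomogeneous p)
    (hspan : Submodule.span (MvPolynomial (Fin n) K) (Set.range g) = U)
    (hli : LinearIndependent K g) : IsKoszulLinear (relations g) 1 r := by
  intro i t hit z hz hzb hzd
  set π := Fintype.linearCombination (MvPolynomial (Fin n) K) g with hπ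
  have hrange : LinearMap.range π = U := by
    rw [hπ, Fintype.range_linearCombination, hspan]
  have hπh : ∀ v d, (∀ j, (v j).IsHomogeneous d) → ∀ k, (π v k).IsHomogeneous (d + p) := by
    intro v d hv k
    rw [hπ, linearCombination_apply']
    exact IsHomogeneous.sum _ _ _ fun j _ => (hv j).mul (hgp j k)
  -- In internal degree 0 a relation has constant coefficients, so linear independence of `g` over
  -- `K` makes it zero.
  by_cases ht : t = 0
  · subst ht
    refine ⟨0, by simp, by simp [Bihomogeneous], ?_⟩
    rw [diff_zero]
    by_cases hi : i = 0
    · subst hi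
      funext G
      by_cases hG : G.card = 0
      · have hh : ∀ k, (z G k).IsHomogeneous 0 := fun k => hzb.isHomogeneous rfl G k
        have hc : ∀ k, z G k = C (coeff 0 (z G k)) := by
          intro k
          rw [← homogeneousComponent_zero, homogeneousComponent_eq_self (hh k)]
        have h1 : ∑ j, coeff 0 (z G j) • g j = 0 := by
          have h2 := hz G
          rw [Koszul.relations, LinearMap.mem_ker, Fintype.linearCombination_apply] at h2
          rw [← h2]
          refine Finset.sum_congr rfl fun j _ => ?_
          conv_rhs => rw [hc j]
          funext k
          simp [smul_eq_C_mul]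
        have h3 := Fintype.linearIndependent_iff.mp hli _ h1
        funext k
        rw [hc k, h3 k]; simp
      · exact (hzb.apply_eq_zero hG).symm
    · exact (hzb.eq_zero (by omega)).symm
  -- Elsewhere the Koszul complex of the free module is exact, so z = ∂w there. The chain `w` need
  -- not consist of relations; `π w` measures the failure, as in the connecting map of the long
  -- exact sequence.
  · have hcoord : ∀ k, ∃ w : Finset (Fin n) → MvPolynomial (Fin n) K,
        (∀ G a, coeff a (w G) ≠ 0 → G.card = i + 1 ∧ a.degree + (i + 1) = t) ∧
        Koszul.diff stdSign (X : Fin n → MvPolynomial (Fin n) K) w = fun G => z G k := by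
      intro k
      refine exists_boundary_of_degree_ne_zero (isSignSystem_stdSign n) i t ht _
        (fun G a h => hzb G k a h) ?_
      funext G
      rw [← diff_apply, hzd]; rfl
    choose w0 hw0 hw0d using hcoord
    set w : Finset (Fin n) → Fin b' → MvPolynomial (Fin n) K := fun G k => w0 k G with hw
    have hwb : Bihomogeneous (i + 1) t w := fun G k a h => hw0 k G a h
    have hwd : Koszul.diff stdSign (X : Fin n → MvPolynomial (Fin n) K) w = z := by
      funext G k
      rw [diff_apply]
      exact congrFun (hw0d k) G
    by_cases hti : t < i + 1
    · rw [hwb.eq_zero hti, diff_zero] at hwd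
      exact ⟨0, by simp, by simp [Bihomogeneous], by rw [diff_zero, hwd]⟩
    -- `π w` is a cycle in `U` of bidegree (i+1, t+p). It is off the linear strand of `U` exactly
    -- when (i, t) is off the strand starting in degree 1, so it is a boundary ∂u.
    obtain ⟨u, hu, hub, hud⟩ := hU (i + 1) (t + p) (by omega) (fun G => π (w G))
      (fun G => hrange ▸ LinearMap.mem_range_self π _)
      (bihomogeneous_of_isHomogeneous (d := t - (i + 1) + p) (by omega)
        (fun G k => hπh _ _ (fun j => hwb.isHomogeneous (by omega) G j) k)
        (fun G hG => by rw [hwb.apply_eq_zero hG, map_zero])) (by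
          rw [diff_comp, hwd]
          funext G
          exact hz G)
    -- A lift `v` of `u` through `π` makes w - ∂v a chain of relations with the same boundary `z`.
    have hlift : ∀ G, ∃ v : Fin b' → MvPolynomial (Fin n) K, π v = u G ∧
        (∀ k a, coeff a (v k) ≠ 0 → G.card = i + 1 + 1 ∧ a.degree + (i + 1 + 1) = t) := by
      intro G
      by_cases hG : G.card = i + 1 + 1
      · have h1 : u G ∈ LinearMap.range π := hrange ▸ hu G
        obtain ⟨v, hv⟩ := h1
        by_cases hti' : i + 1 + 1 ≤ t
        · refine ⟨fun j => homogeneousComponent (t - (i + 1 + 1)) (v j), ?_, ?_⟩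
          · rw [hπ, ← homogeneousComponent_linearCombination hgp, ← hπ, hv]
            funext k
            exact homogeneousComponent_eq_self (hub.isHomogeneous (by omega) G k)
          · intro k a ha
            rw [coeff_homogeneousComponent] at ha
            split_ifs at ha with h
            · exact ⟨hG, by omega⟩
            · exact absurd rfl ha
        -- Here `u G` would have degree below p, where combinations of the `g j` have no component,
        -- so `u G = 0`.
        · refine ⟨0, ?_, by simp⟩
          rw [map_zero, ← hv]
          funext k
          by_cases hp : i + 1 + 1 ≤ t + p
          · have h2 := homogeneousComponent_eq_self
              (hub.isHomogeneous (d := t + p - (i + 1 + 1)) (by omega) G k)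
            rw [hv, ← h2, ← hv, linearCombination_apply', map_sum, Pi.zero_apply]
            refine (Finset.sum_eq_zero fun j _ => ?_).symm
            exact homogeneousComponent_mul_of_lt _ (hgp j k) (by omega)
          · rw [hv, hub.eq_zero (by omega)]; rfl
      · exact ⟨0, by rw [map_zero, hub.apply_eq_zero hG], by simp⟩
    choose v hv hvb using hlift
    have hvb' : Bihomogeneous (i + 1 + 1) t v := fun G k a h => hvb G k a h
    refine ⟨w - Koszul.diff stdSign (X : Fin n → MvPolynomial (Fin n) K) v, ?_, ?_, ?_⟩
    · intro G
      rw [Koszul.relations, LinearMap.mem_ker, Pi.sub_apply, map_sub, ← hπ, sub_eq_zero]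
      have h1 := congrFun hud G
      rw [← h1, ← congrFun (diff_comp (σ := stdSign) (y := X) π v) G]
      congr 1
      funext G'
      exact (hv G').symm
    · intro G k a ha
      rw [Pi.sub_apply, Pi.sub_apply, coeff_sub] at ha
      by_cases h1 : coeff a (w G k) = 0
      · rw [h1, zero_sub, neg_ne_zero] at ha
        exact hvb'.diff _ G k a ha
      · exact hwb G k a h1
    · rw [diff_sub, diff_diff (isSignSystem_stdSign n), sub_zero, hwd]

/-- Minimal generators of a graded submodule with linear Koszul homology. -/
lemma IsKoszulLinear.exists_generators {p r : ℕ} (hg : IsGraded U) (hU : IsKoszulLinear U p r) :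
    ∃ (b' : ℕ) (g : Fin b' → Fin b → MvPolynomial (Fin n) K),
      (∀ j k, (g j k).IsHomogeneous p) ∧
      Submodule.span (MvPolynomial (Fin n) K) (Set.range g) = U ∧ LinearIndependent K g := by
  let H : Submodule K (Fin b → MvPolynomial (Fin n) K) :=
    Submodule.pi Set.univ fun _ => homogeneousSubmodule (Fin n) K p
  have hH : ∀ v, v ∈ H ↔ ∀ k, (v k).IsHomogeneous p := fun v => by
    simp [H, Submodule.mem_pi]
  let Up : Submodule K (Fin b → MvPolynomial (Fin n) K) := U.restrictScalars K ⊓ H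
  have hfin : Module.Finite K H := by
    have h1 : Module.Finite K (homogeneousSubmodule (Fin n) K p) :=
      Module.Finite.iff_fg.mpr (homogeneousSubmodule_fg _ _ _)
    let f : (Fin b → homogeneousSubmodule (Fin n) K p) →ₗ[K] (Fin b → MvPolynomial (Fin n) K) :=
      LinearMap.pi fun k => (homogeneousSubmodule (Fin n) K p).subtype ∘ₗ LinearMap.proj k
    refine Module.Finite.of_surjective (f.codRestrict H fun v => ?_) ?_
    · rw [hH]; intro k; exact (v k).2
    · rintro ⟨v, hv⟩
      refine ⟨fun k => ⟨v k, (hH v).mp hv k⟩, ?_⟩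
      ext; rfl
  have hfinU : Module.Finite K Up :=
    Submodule.finiteDimensional_of_le (S₂ := H) inf_le_right
  -- A `K`-basis of the degree p part of `U`; it generates `U` by the Nakayama argument.
  let B := Module.finBasis K Up
  refine ⟨_, fun j => (B j : Fin b → MvPolynomial (Fin n) K), ?_, ?_, ?_⟩
  · intro j
    exact (hH _).mp (B j).2.2
  · apply le_antisymm
    · rw [Submodule.span_le]
      rintro _ ⟨j, rfl⟩
      exact (B j).2.1
    · refine hg.le (hU.mem_of_isHomogeneous _ fun _ v hv hvp => ?_)
      have h1 := B.sum_repr ⟨v, hv, (hH v).mpr hvp⟩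
      have h2 := congrArg Subtype.val h1
      simp only [AddSubmonoidClass.coe_finsetSum, SetLike.val_smul] at h2
      rw [← h2]
      refine Submodule.sum_mem _ fun j _ => ?_
      exact Submodule.smul_of_tower_mem _ _ (Submodule.subset_span ⟨j, rfl⟩)
  · exact B.linearIndependent.map' Up.subtype (Submodule.ker_subtype _)

/-- A graded submodule with linear Koszul homology has a finite linear resolution. -/
theorem IsKoszulLinear.exists_resolution (r : ℕ) : ∀ {b p : ℕ}
    {U : Submodule (MvPolynomial (Fin n) K) (Fin b → MvPolynomial (Fin n) K)}, IsGraded U →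
    IsKoszulLinear U p r →
    ∃ (β : ℕ → ℕ) (g : Fin (β 0) → Fin b → MvPolynomial (Fin n) K)
      (M : ∀ i : ℕ, Matrix (Fin (β i)) (Fin (β (i + 1))) (MvPolynomial (Fin n) K)),
      (∀ i, r ≤ i → β i = 0) ∧ (∀ j k, (g j k).IsHomogeneous p) ∧
      (∀ i a b, (M i a b).IsHomogeneous 1) ∧
      Submodule.span (MvPolynomial (Fin n) K) (Set.range g) = U ∧
      (∀ v : Fin (β 0) → MvPolynomial (Fin n) K,
        v ∈ Koszul.relations g ↔ ∃ w, v = (M 0).mulVec w) ∧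
      (∀ (i : ℕ) (v : Fin (β (i + 1)) → MvPolynomial (Fin n) K),
        (M i).mulVec v = 0 ↔ ∃ w, v = (M (i + 1)).mulVec w) := by
  induction r with
  | zero =>
    intro b p U hg hU
    refine ⟨fun _ => 0, Fin.elim0, fun _ => 0, fun _ _ => rfl, fun j => j.elim0,
      fun _ a => a.elim0, ?_, ?_, ?_⟩
    · rw [hU.eq_bot hg, Set.range_eq_empty, Submodule.span_empty]
    · exact fun v => ⟨fun _ => ⟨0, Subsingleton.elim _ _⟩,
        fun _ => (Subsingleton.elim 0 v) ▸ Submodule.zero_mem _⟩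
    · exact fun i v => ⟨fun _ => ⟨0, Subsingleton.elim _ _⟩, fun _ => Subsingleton.elim _ _⟩
  | succ r ih =>
    intro b p U hg hU
    obtain ⟨b', g, hgp, hspan, hli⟩ := hU.exists_generators hg
    obtain ⟨β, g', M, hβ, hg', hM, hspan', h0, hex⟩ :=
      ih (isGraded_relations hgp) (hU.relations hgp hspan hli)
    have hcols : ∀ w : Fin (β 0) → MvPolynomial (Fin n) K,
        (Matrix.of fun a c => g' c a).mulVec w =
          Fintype.linearCombination (MvPolynomial (Fin n) K) g' w := by
      intro w
      funext a
      rw [linearCombination_apply', Matrix.mulVec, dotProduct]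
      exact Finset.sum_congr rfl fun c _ => mul_comm _ _
    -- The resolution of the relations is shifted by one place: its generators `g'` become the
    -- columns of the first matrix, and `g` goes in front.
    refine ⟨fun i => Nat.casesOn i b' β, g, fun i => Nat.casesOn i (Matrix.of fun a c => g' c a) M,
      ?_, hgp, ?_, hspan, ?_, ?_⟩
    · rintro (_ | i) hi
      · omega
      · exact hβ i (by omega)
    · rintro (_ | i) a c
      · exact hg' c a
      · exact hM i a c
    · intro v
      rw [← hspan', ← Fintype.range_linearCombination]
      constructor
      · rintro ⟨w, hw⟩
        exact ⟨w, by rw [← hw]; exact (hcols w).symm⟩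
      · rintro ⟨w, hw⟩
        exact ⟨w, by rw [hw]; exact (hcols w).symm⟩
    · rintro (_ | i) v
      · refine Iff.trans ?_ (h0 v)
        show (Matrix.of fun a c => g' c a).mulVec v = 0 ↔ _
        rw [hcols]
        exact LinearMap.mem_ker.symm
      · exact hex i v

end Linear

end Koszul

namespace Squarefree

open Koszul

/-! ### Squarefree monomial ideals and Alexander duality -/

section Basic

variable {K : Type*} [Field K] {n : ℕ}

lemma sqfreeMonomial_eq (F : Finset (Fin n)) : sqfreeMonomial K F = monomial (ind F) 1 := by
  unfold sqfreeMonomial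
  induction F using Finset.induction_on with
  | empty =>
    have : ind (∅ : Finset (Fin n)) = 0 := by ext; simp
    rw [this]; simp
  | insert j F hj ih =>
    rw [Finset.prod_insert hj, ih, ind_insert hj, X, monomial_mul, add_comm, one_mul]

/-- Membership in a squarefree monomial ideal depends only on the supports of the exponents. -/
lemma mem_iff {I : Ideal (MvPolynomial (Fin n) K)} (hI : IsSquarefreeMonomialIdeal I)
    (f : MvPolynomial (Fin n) K) :
    f ∈ I ↔ ∀ a, coeff a f ≠ 0 → sqfreeMonomial K a.support ∈ I := by
  obtain ⟨A, rfl⟩ := hI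
  have h : ∀ f : MvPolynomial (Fin n) K, f ∈ Ideal.span (sqfreeMonomial K '' A) ↔
      ∀ a ∈ f.support, ∃ F ∈ A, F ⊆ a.support := by
    intro f
    have h1 : sqfreeMonomial K '' A = (fun s => monomial s (1 : K)) '' (ind '' A) := by
      rw [Set.image_image]
      exact Set.image_congr fun F _ => sqfreeMonomial_eq F
    rw [h1, mem_ideal_span_monomial_image]
    simp [ind_le_iff]
  rw [h]
  refine forall_congr' fun a => ?_
  rw [mem_support_iff, h, sqfreeMonomial_eq]
  refine imp_congr_right fun _ => ?_
  classical
  rw [support_monomial, if_neg one_ne_zero]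
  have : (ind a.support).support = a.support := by ext j; simp
  simp [this]

lemma sqfreeMonomial_mem_of_subset {I : Ideal (MvPolynomial (Fin n) K)} {F G : Finset (Fin n)}
    (h : F ⊆ G) (hF : sqfreeMonomial K F ∈ I) : sqfreeMonomial K G ∈ I :=
  I.mem_of_dvd (Finset.prod_dvd_prod_of_subset _ _ _ h) hF

lemma sqfreeMonomial_notMem_mono {I : Ideal (MvPolynomial (Fin n) K)} {F G : Finset (Fin n)}
    (h : F ⊆ G) (hG : sqfreeMonomial K G ∉ I) : sqfreeMonomial K F ∉ I :=
  fun hF => hG (sqfreeMonomial_mem_of_subset h hF)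

lemma sqfreeMonomial_mem_span_iff (A : Set (Finset (Fin n))) (F : Finset (Fin n)) :
    sqfreeMonomial K F ∈ Ideal.span (sqfreeMonomial K '' A) ↔ ∃ G ∈ A, G ⊆ F := by
  constructor
  · intro h
    have h1 : sqfreeMonomial K '' A = (fun s => monomial s (1 : K)) '' (ind '' A) := by
      rw [Set.image_image]
      exact Set.image_congr fun F _ => sqfreeMonomial_eq F
    classical
    rw [h1, mem_ideal_span_monomial_image, sqfreeMonomial_eq, support_monomial,
      if_neg one_ne_zero] at h
    have h2 : (ind F).support = F := by ext j; simp
    simpa [ind_le_iff, h2] using h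
  · rintro ⟨G, hG, hGF⟩
    exact sqfreeMonomial_mem_of_subset hGF (Ideal.subset_span ⟨G, hG, rfl⟩)

lemma isSquarefreeMonomialIdeal_alexanderDual (I : Ideal (MvPolynomial (Fin n) K)) :
    IsSquarefreeMonomialIdeal (alexanderDual I) := ⟨_, rfl⟩

/-- Nonmembership in `I` passes to subsets, so the index set of the generators of the dual is
already closed under supersets. -/
lemma sqfreeMonomial_mem_alexanderDual (I : Ideal (MvPolynomial (Fin n) K))
    (F : Finset (Fin n)) :
    sqfreeMonomial K F ∈ alexanderDual I ↔ sqfreeMonomial K Fᶜ ∉ I := by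
  rw [alexanderDual, sqfreeMonomial_mem_span_iff]
  constructor
  · rintro ⟨G, hG, hGF⟩
    exact sqfreeMonomial_notMem_mono (Finset.compl_subset_compl.mpr hGF) hG
  · exact fun h => ⟨F, h, subset_rfl⟩

lemma ext_of_sqfreeMonomial {I J : Ideal (MvPolynomial (Fin n) K)}
    (hI : IsSquarefreeMonomialIdeal I) (hJ : IsSquarefreeMonomialIdeal J)
    (h : ∀ F, sqfreeMonomial K F ∈ I ↔ sqfreeMonomial K F ∈ J) : I = J := by
  ext f
  rw [mem_iff hI, mem_iff hJ]
  simp only [h]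

lemma alexanderDual_alexanderDual {I : Ideal (MvPolynomial (Fin n) K)}
    (hI : IsSquarefreeMonomialIdeal I) : alexanderDual (alexanderDual I) = I :=
  ext_of_sqfreeMonomial (isSquarefreeMonomialIdeal_alexanderDual _) hI fun F => by
    rw [sqfreeMonomial_mem_alexanderDual, sqfreeMonomial_mem_alexanderDual, compl_compl, not_not]

lemma sqfreeMonomial_empty_notMem {I : Ideal (MvPolynomial (Fin n) K)} (hI : I ≠ ⊤) :
    sqfreeMonomial K ∅ ∉ I := fun h => hI ((Ideal.eq_top_iff_one I).mpr (by
      simpa [sqfreeMonomial] using h))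

lemma sqfreeMonomial_univ_mem {I : Ideal (MvPolynomial (Fin n) K)}
    (hI : IsSquarefreeMonomialIdeal I) (h0 : I ≠ ⊥) :
    sqfreeMonomial K Finset.univ ∈ I := by
  obtain ⟨f, hf, hf0⟩ := Submodule.exists_mem_ne_zero_of_ne_bot h0
  obtain ⟨a, ha⟩ := ne_zero_iff.mp hf0
  exact sqfreeMonomial_mem_of_subset (Finset.subset_univ _) ((mem_iff hI f).mp hf a ha)

lemma alexanderDual_ne_bot {I : Ideal (MvPolynomial (Fin n) K)} (hI : I ≠ ⊤) :
    alexanderDual I ≠ ⊥ := by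
  intro h
  have h1 : sqfreeMonomial K (Finset.univ : Finset (Fin n)) ∈ alexanderDual I := by
    rw [sqfreeMonomial_mem_alexanderDual, Finset.compl_univ]
    exact sqfreeMonomial_empty_notMem hI
  rw [h, Ideal.mem_bot, sqfreeMonomial_eq, monomial_eq_zero] at h1
  exact one_ne_zero h1

lemma alexanderDual_ne_top {I : Ideal (MvPolynomial (Fin n) K)}
    (hI : IsSquarefreeMonomialIdeal I) (h0 : I ≠ ⊥) : alexanderDual I ≠ ⊤ := by
  intro h
  have h1 : sqfreeMonomial K (∅ : Finset (Fin n)) ∈ alexanderDual I := h ▸ trivial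
  rw [sqfreeMonomial_mem_alexanderDual, Finset.compl_empty] at h1
  exact h1 (sqfreeMonomial_univ_mem hI h0)

end Basic

/-! ### Heights through faces and coordinate primes -/

section Height

variable {K : Type*} [Field K] {n : ℕ}

/-- The prime ideal generated by a set of variables. -/
noncomputable def varIdeal (K : Type*) [Field K] {n : ℕ} (s : Finset (Fin n)) :
    Ideal (MvPolynomial (Fin n) K) :=
  Ideal.span (X '' (s : Set (Fin n)))

lemma mem_varIdeal {s : Finset (Fin n)} {f : MvPolynomial (Fin n) K} :
    f ∈ varIdeal K s ↔ ∀ a, coeff a f ≠ 0 → ¬ Disjoint a.support s := by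
  rw [varIdeal, mem_ideal_span_X_image]
  simp only [mem_support_iff, Finset.not_disjoint_iff, Finsupp.mem_support_iff]
  refine forall₂_congr fun a _ => ⟨?_, ?_⟩
  · rintro ⟨i, hi, h⟩; exact ⟨i, h, hi⟩
  · rintro ⟨i, hi, h⟩; exact ⟨i, h, hi⟩

lemma X_mem_varIdeal {s : Finset (Fin n)} {i : Fin n} :
    (X i : MvPolynomial (Fin n) K) ∈ varIdeal K s ↔ i ∈ s := by
  rw [mem_varIdeal]
  constructor
  · intro h
    have := h (Finsupp.single i 1) (by simp)
    simpa [Finsupp.support_single] using this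
  · intro h a ha
    rw [coeff_X, ne_eq, ite_eq_right_iff, Classical.not_imp] at ha
    rw [← ha.1]
    simpa [Finsupp.support_single] using h

/-- It is the kernel of the substitution killing the variables in `s` and fixing the others, which
is the identity modulo the ideal; the target is a domain. -/
instance isPrime_varIdeal (s : Finset (Fin n)) : (varIdeal K s).IsPrime := by
  let φ : MvPolynomial (Fin n) K →ₐ[K] MvPolynomial (Fin n) K :=
    aeval fun i => if i ∈ s then 0 else X i
  have h : varIdeal K s = RingHom.ker φ := by
    apply le_antisymm
    · rw [varIdeal, Ideal.span_le]
      rintro _ ⟨i, hi, rfl⟩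
      simp only [Finset.mem_coe] at hi
      simp [φ, hi]
    · intro f hf
      rw [RingHom.mem_ker] at hf
      have hcomp : (Ideal.Quotient.mkₐ K (varIdeal K s)).comp φ =
          Ideal.Quotient.mkₐ K (varIdeal K s) := by
        ext i
        simp only [φ, AlgHom.comp_apply, aeval_X]
        split_ifs with hi
        · rw [map_zero, eq_comm]
          exact Ideal.Quotient.eq_zero_iff_mem.mpr (X_mem_varIdeal.mpr hi)
        · rfl
      have h1 := DFunLike.congr_fun hcomp f
      rw [AlgHom.comp_apply, hf, map_zero] at h1
      exact Ideal.Quotient.eq_zero_iff_mem.mp h1.symm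
  rw [h]
  exact RingHom.ker_isPrime φ

lemma varIdeal_mono {s t : Finset (Fin n)} (h : s ⊆ t) : varIdeal K s ≤ varIdeal K t :=
  Ideal.span_mono (Set.image_mono (Finset.coe_subset.mpr h))

lemma varIdeal_lt_insert {s : Finset (Fin n)} {j : Fin n} (hj : j ∉ s) :
    varIdeal K s < varIdeal K (insert j s) :=
  lt_of_le_of_ne (varIdeal_mono (Finset.subset_insert _ _)) fun h => hj (by
    rw [← X_mem_varIdeal (K := K), h, X_mem_varIdeal]; exact Finset.mem_insert_self _ _)

/-- A family of primes indexed by finite sets which strictly increases has large heights. -/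
lemma card_le_height {A ι : Type*} [CommRing A] [DecidableEq ι] (P : Finset ι → Ideal A)
    (F : Finset ι) (hP : ∀ H ⊆ F, (P H).IsPrime)
    (hlt : ∀ H ⊆ F, ∀ j ∈ F, j ∉ H → P H < P (insert j H)) :
    ∀ H ⊆ F, (H.card : ℕ∞) ≤ (P H).height := by
  intro H
  induction H using Finset.induction_on with
  | empty => intro _; simp
  | insert j H hj ih =>
    intro hF
    have hH := (Finset.subset_insert j H).trans hF
    have h1 := hP H hH
    have h2 := hP _ hF
    rw [Finset.card_insert_of_notMem hj]
    push_cast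
    exact (add_le_add_left (ih hH) 1).trans (Ideal.height_add_one_le_of_lt_of_isPrime
      (hlt H hH j (hF (Finset.mem_insert_self _ _)) hj))

/-- Krull's height theorem gives the upper bound, the chain of coordinate primes the lower one. -/
lemma height_varIdeal (s : Finset (Fin n)) : (varIdeal K s).height = s.card := by
  classical
  apply le_antisymm
  · have h1 : varIdeal K s ∈ (Ideal.span ((s.image X : Finset (MvPolynomial (Fin n) K)) :
        Set (MvPolynomial (Fin n) K))).minimalPrimes := by
      rw [Finset.coe_image]
      change varIdeal K s ∈ (varIdeal K s).minimalPrimes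
      rw [Ideal.minimalPrimes_eq_subsingleton_self]
      exact Set.mem_singleton _
    refine (Ideal.height_le_card_of_mem_minimalPrimes_span_finset h1).trans ?_
    exact_mod_cast Finset.card_image_le
  · exact card_le_height (varIdeal K) Finset.univ (fun H _ => inferInstance)
      (fun H _ j _ hj => varIdeal_lt_insert hj) s (Finset.subset_univ _)

/-- A monomial of `I` cannot have its support inside the face `F`, so it involves a variable outside
`F`. -/
lemma le_varIdeal {I : Ideal (MvPolynomial (Fin n) K)} (hI : IsSquarefreeMonomialIdeal I)
    {F : Finset (Fin n)} (hF : sqfreeMonomial K F ∉ I) : I ≤ varIdeal K Fᶜ := by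
  intro f hf
  rw [mem_varIdeal]
  intro a ha hd
  rw [disjoint_compl_right_iff] at hd
  exact hF (sqfreeMonomial_mem_of_subset hd ((mem_iff hI f).mp hf a ha))

lemma height_add_card_le {I : Ideal (MvPolynomial (Fin n) K)} (hI : IsSquarefreeMonomialIdeal I)
    {F : Finset (Fin n)} (hF : sqfreeMonomial K F ∉ I) {c : ℕ} (hc : I.height = c) :
    c + F.card ≤ n := by
  have h := (Ideal.height_mono (le_varIdeal hI hF)).trans_eq (height_varIdeal _)
  rw [hc, Finset.card_compl, Fintype.card_fin] at h
  have h1 : c ≤ n - F.card := by exact_mod_cast h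
  have h2 := Finset.card_le_univ F
  rw [Fintype.card_fin] at h2
  omega

/-- Take a minimal prime of height at most c. The variables outside it form a face, since their
product is not in the prime; those inside generate a coordinate prime contained in it, so there are
at most c of them. -/
lemma exists_face {I : Ideal (MvPolynomial (Fin n) K)} {c : ℕ}
    (hc : I.height = c) : ∃ F : Finset (Fin n), sqfreeMonomial K F ∉ I ∧ n ≤ c + F.card := by
  have h1 : ¬ ((c : ℕ∞) + 1 ≤ I.height) := by
    rw [hc]; exact_mod_cast Nat.not_succ_le_self c
  rw [Ideal.height_eq_inf_minimalPrimes, le_iInf₂_iff] at h1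
  push Not at h1
  obtain ⟨Q, hQ, hQc⟩ := h1
  have hQp := hQ.isPrime
  classical
  refine ⟨Finset.univ.filter fun i => (X i : MvPolynomial (Fin n) K) ∉ Q, ?_, ?_⟩
  · intro h
    have h2 := hQ.le h
    rw [sqfreeMonomial, hQp.prod_mem_iff] at h2
    obtain ⟨i, hi, hiQ⟩ := h2
    exact (Finset.mem_filter.mp hi).2 hiQ
  · set F := Finset.univ.filter fun i => (X i : MvPolynomial (Fin n) K) ∉ Q
    have h2 : varIdeal K Fᶜ ≤ Q := by
      rw [varIdeal, Ideal.span_le]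
      rintro _ ⟨i, hi, rfl⟩
      simpa [F] using hi
    have h3 := ((height_varIdeal (K := K) Fᶜ).symm.trans_le (Ideal.height_mono h2)).trans_lt hQc
    rw [Finset.card_compl, Fintype.card_fin] at h3
    have h4 : n - F.card < c + 1 := by exact_mod_cast h3
    omega

/-- The height is n minus the largest size of a face: the given face shows finiteness and the upper
bound, the face from `exists_face` the lower one. -/
lemma height_eq_of_forall {I : Ideal (MvPolynomial (Fin n) K)}
    (hI : IsSquarefreeMonomialIdeal I) {c : ℕ}
    (h1 : ∀ F, sqfreeMonomial K F ∉ I → c + F.card ≤ n)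
    (h2 : ∃ F, sqfreeMonomial K F ∉ I ∧ n ≤ c + F.card) : I.height = c := by
  obtain ⟨F, hF, hFc⟩ := h2
  have hle := (Ideal.height_mono (le_varIdeal hI hF)).trans_eq (height_varIdeal _)
  obtain ⟨c', hc'⟩ := ENat.ne_top_iff_exists.mp (ne_top_of_le_ne_top (ENat.natCast_ne_top _) hle)
  have h3 := height_add_card_le hI hF hc'.symm
  obtain ⟨F', hF', hFc'⟩ := exists_face hc'.symm
  have h4 := h1 F' hF'
  rw [← hc']
  congr 1
  omega

end Height

/-! ### Least generator degrees and their duality with heights -/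

section GeneratorDegree

variable {K : Type*} [Field K] {n : ℕ}

lemma _root_.LinearIdeals.IsLeastGeneratorDegree.coeff_eq_zero
    {I : Ideal (MvPolynomial (Fin n) K)} {p : ℕ} (hp : IsLeastGeneratorDegree I p)
    {f : MvPolynomial (Fin n) K} (hf : f ∈ I) {a : Fin n →₀ ℕ} (ha : a.degree < p) :
    coeff a f = 0 := by
  obtain ⟨G, hG, rfl, hp⟩ := hp
  have key : ∀ f ∈ Ideal.span G, ∀ a : Fin n →₀ ℕ, a.degree < p → coeff a f = 0 := by
    intro f hf
    induction hf using Submodule.span_induction with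
    | mem g hg =>
      intro a ha
      obtain ⟨hg0, j, hj⟩ := hG g hg
      have := hp.2 ⟨g, hg, hj⟩
      exact hj.coeff_eq_zero (by omega)
    | zero => simp
    | add f g _ _ hf hg => exact fun a ha => by rw [coeff_add, hf a ha, hg a ha, add_zero]
    | smul r f _ hf =>
      intro a ha
      rw [smul_eq_mul, coeff_mul]
      refine Finset.sum_eq_zero fun x hx => ?_
      rw [hf x.2, mul_zero]
      have h1 := congrArg Finsupp.degree (Finset.HasAntidiagonal.mem_antidiagonal.mp hx)
      rw [map_add] at h1
      omega
  exact key f hf a ha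

lemma _root_.LinearIdeals.IsLeastGeneratorDegree.exists_mem
    {I : Ideal (MvPolynomial (Fin n) K)} {p : ℕ} (hp : IsLeastGeneratorDegree I p) :
    ∃ f ∈ I, f ≠ 0 ∧ f.IsHomogeneous p := by
  obtain ⟨G, hG, rfl, ⟨g, hg, hgp⟩, -⟩ := hp
  exact ⟨g, Ideal.subset_span hg, (hG g hg).1, hgp⟩

/-- All squarefree monomials of `I` together serve as the generating set, so only cardinalities
matter. -/
lemma isLeastGeneratorDegree_of_forall {I : Ideal (MvPolynomial (Fin n) K)}
    (hI : IsSquarefreeMonomialIdeal I) {p : ℕ}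
    (h1 : ∀ F, sqfreeMonomial K F ∈ I → p ≤ F.card)
    (h2 : ∃ F, sqfreeMonomial K F ∈ I ∧ F.card ≤ p) : IsLeastGeneratorDegree I p := by
  have hhom : ∀ F : Finset (Fin n), (sqfreeMonomial K F).IsHomogeneous F.card := fun F => by
    rw [sqfreeMonomial_eq]; exact isHomogeneous_monomial _ (degree_ind F)
  have hne : ∀ F : Finset (Fin n), sqfreeMonomial K F ≠ 0 := fun F => by
    rw [sqfreeMonomial_eq, ne_eq, monomial_eq_zero]; exact one_ne_zero
  refine ⟨sqfreeMonomial K '' {F | sqfreeMonomial K F ∈ I}, ?_, ?_, ?_, ?_⟩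
  · rintro _ ⟨F, _, rfl⟩
    exact ⟨hne F, _, hhom F⟩
  · apply le_antisymm
    · rw [Ideal.span_le]
      rintro _ ⟨F, hF, rfl⟩
      exact hF
    · obtain ⟨A, rfl⟩ := hI
      refine Ideal.span_mono (Set.image_mono fun F hF => Ideal.subset_span ⟨F, hF, rfl⟩)
  · obtain ⟨F, hF, hFp⟩ := h2
    refine ⟨_, ⟨F, hF, rfl⟩, ?_⟩
    rw [le_antisymm (h1 F hF) hFp]
    exact hhom F
  · rintro j ⟨_, ⟨F, hF, rfl⟩, hj⟩
    rw [hj.inj_right (hhom F) (hne F)]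
    exact h1 F hF

lemma _root_.LinearIdeals.IsLeastGeneratorDegree.le_card {I : Ideal (MvPolynomial (Fin n) K)}
    {p : ℕ} (hp : IsLeastGeneratorDegree I p) {F : Finset (Fin n)}
    (hF : sqfreeMonomial K F ∈ I) : p ≤ F.card := by
  by_contra h
  have h1 := hp.coeff_eq_zero hF (a := ind F) (by rw [degree_ind]; omega)
  rw [sqfreeMonomial_eq, coeff_monomial, if_pos rfl] at h1
  exact one_ne_zero h1

lemma exists_card_le {I : Ideal (MvPolynomial (Fin n) K)} (hI : IsSquarefreeMonomialIdeal I)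
    {p : ℕ} (hp : IsLeastGeneratorDegree I p) :
    ∃ F : Finset (Fin n), sqfreeMonomial K F ∈ I ∧ F.card ≤ p := by
  obtain ⟨f, hf, hf0, hfp⟩ := hp.exists_mem
  obtain ⟨a, ha⟩ := ne_zero_iff.mp hf0
  refine ⟨a.support, (mem_iff hI f).mp hf a ha, ?_⟩
  have h1 : a.degree = p := by
    by_contra h
    exact ha (hfp.coeff_eq_zero h)
  rw [← h1, ← degree_ind]
  apply Finsupp.degree_mono
  rw [ind_le_iff]

/-- The height of the Alexander dual is the least degree of a generator. -/
lemma height_alexanderDual {I : Ideal (MvPolynomial (Fin n) K)}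
    (hI : IsSquarefreeMonomialIdeal I) {p : ℕ} (hp : IsLeastGeneratorDegree I p) :
    (alexanderDual I).height = p := by
  refine height_eq_of_forall (isSquarefreeMonomialIdeal_alexanderDual I) ?_ ?_
  · intro F hF
    rw [sqfreeMonomial_mem_alexanderDual, not_not] at hF
    have h1 := hp.le_card hF
    have h2 := Finset.card_add_card_compl F
    rw [Fintype.card_fin] at h2
    omega
  · obtain ⟨F, hF, hFp⟩ := exists_card_le hI hp
    refine ⟨Fᶜ, by rwa [sqfreeMonomial_mem_alexanderDual, not_not, compl_compl], ?_⟩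
    have h2 := Finset.card_add_card_compl F
    rw [Fintype.card_fin] at h2
    omega

/-- The least degree of a generator of the Alexander dual is the height. -/
lemma isLeastGeneratorDegree_alexanderDual {I : Ideal (MvPolynomial (Fin n) K)}
    (hI : IsSquarefreeMonomialIdeal I) {c : ℕ} (hc : I.height = c) :
    IsLeastGeneratorDegree (alexanderDual I) c := by
  refine isLeastGeneratorDegree_of_forall (isSquarefreeMonomialIdeal_alexanderDual I) ?_ ?_
  · intro F hF
    rw [sqfreeMonomial_mem_alexanderDual] at hF
    have h1 := height_add_card_le hI hF hc
    have h2 := Finset.card_add_card_compl F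
    rw [Fintype.card_fin] at h2
    omega
  · obtain ⟨F, hF, hFc⟩ := exists_face hc
    refine ⟨Fᶜ, by rwa [sqfreeMonomial_mem_alexanderDual, compl_compl], ?_⟩
    have h2 := Finset.card_add_card_compl F
    rw [Fintype.card_fin] at h2
    omega

end GeneratorDegree

open Koszul

/-! ### Reisner's criterion for Cohen-Macaulay Stanley-Reisner rings -/

section CohenMacaulay

variable {K : Type*} [Field K] {n : ℕ}

lemma mem_varIdeal_univ {f : MvPolynomial (Fin n) K} :
    f ∈ varIdeal K (Finset.univ : Finset (Fin n)) ↔ coeff 0 f = 0 := by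
  rw [mem_varIdeal]
  constructor
  · intro h
    by_contra h0
    exact h 0 h0 (by simp)
  · intro h a ha hd
    have h1 : a = 0 := Finsupp.support_eq_empty.mp (disjoint_top.mp hd)
    exact ha (h1 ▸ h)

instance isMaximal_varIdeal_univ : (varIdeal K (Finset.univ : Finset (Fin n))).IsMaximal := by
  have h : varIdeal K (Finset.univ : Finset (Fin n)) = RingHom.ker (constantCoeff (R := K)) := by
    ext f
    rw [mem_varIdeal_univ, RingHom.mem_ker, constantCoeff_eq]
  rw [h]
  exact RingHom.ker_isMaximal_of_surjective _ fun a => ⟨C a, by simp⟩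

/-- The maximal ideal of `S/J` generated by the variables. -/
noncomputable def irrelevant (J : Ideal (MvPolynomial (Fin n) K)) :
    Ideal (MvPolynomial (Fin n) K ⧸ J) :=
  (varIdeal K Finset.univ).map (Ideal.Quotient.mk J)

lemma le_varIdeal_univ {J : Ideal (MvPolynomial (Fin n) K)} (hJ : IsSquarefreeMonomialIdeal J)
    (hJ1 : J ≠ ⊤) : J ≤ varIdeal K Finset.univ := by
  have := le_varIdeal hJ (sqfreeMonomial_empty_notMem hJ1)
  rwa [Finset.compl_empty] at this

lemma comap_irrelevant {J : Ideal (MvPolynomial (Fin n) K)} (hJ : IsSquarefreeMonomialIdeal J)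
    (hJ1 : J ≠ ⊤) :
    (irrelevant J).comap (Ideal.Quotient.mk J) = varIdeal K Finset.univ :=
  Ideal.comap_map_mk (le_varIdeal_univ hJ hJ1)

lemma isMaximal_irrelevant {J : Ideal (MvPolynomial (Fin n) K)}
    (hJ : IsSquarefreeMonomialIdeal J) (hJ1 : J ≠ ⊤) : (irrelevant J).IsMaximal := by
  refine (Ideal.map_eq_top_or_isMaximal_of_surjective _ Ideal.Quotient.mk_surjective
    isMaximal_varIdeal_univ).resolve_left fun h => ?_
  have h1 := comap_irrelevant hJ hJ1
  rw [irrelevant, h, Ideal.comap_top] at h1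
  exact (isMaximal_varIdeal_univ (K := K) (n := n)).ne_top h1.symm

/-- For a face `F` with at least n - p elements, start at the coordinate prime of its complement and
adjoin the variables of `F` one by one; the images in the quotient form a strict chain ending at the
irrelevant ideal. -/
lemma le_height_irrelevant {J : Ideal (MvPolynomial (Fin n) K)}
    (hJ : IsSquarefreeMonomialIdeal J) {p : ℕ} (hp : J.height = p) :
    ((n - p : ℕ) : ℕ∞) ≤ (irrelevant J).height := by
  obtain ⟨F, hF, hFp⟩ := exists_face hp
  have hle : ∀ H : Finset (Fin n), J ≤ varIdeal K (Fᶜ ∪ H) := fun H =>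
    (le_varIdeal hJ hF).trans (varIdeal_mono Finset.subset_union_left)
  have hcomap : ∀ H : Finset (Fin n),
      ((varIdeal K (Fᶜ ∪ H)).map (Ideal.Quotient.mk J)).comap (Ideal.Quotient.mk J) =
        varIdeal K (Fᶜ ∪ H) := fun H => Ideal.comap_map_mk (hle H)
  have h := card_le_height (fun H => (varIdeal K (Fᶜ ∪ H)).map (Ideal.Quotient.mk J)) F
    (fun H _ => Ideal.map_isPrime_of_surjective Ideal.Quotient.mk_surjective
      (by rw [Ideal.mk_ker]; exact hle H))
    (fun H _ j hj hjH => by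
      have hlt : varIdeal K (Fᶜ ∪ H) < varIdeal K (Fᶜ ∪ insert j H) := by
        rw [Finset.union_insert]
        exact varIdeal_lt_insert (by simp [hj, hjH])
      refine lt_of_le_of_ne (Ideal.map_mono hlt.le) fun h => hlt.ne ?_
      rw [← hcomap H, ← hcomap (insert j H)]
      exact congrArg _ h) F subset_rfl
  rw [Finset.union_comm, Finset.union_compl] at h
  refine le_trans ?_ h
  exact_mod_cast (by omega : n - p ≤ F.card)

/-- Vanishing of the Koszul homology of the squares of the variables on the localization of a
Cohen-Macaulay quotient. -/
lemma exact_localization {J : Ideal (MvPolynomial (Fin n) K)}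
    (hJ : IsSquarefreeMonomialIdeal J) (hCM : IsCohenMacaulay (MvPolynomial (Fin n) K ⧸ J))
    {p : ℕ} (hp : J.height = p) [hm : (irrelevant J).IsMaximal]
    {σ : Fin n → Finset (Fin n) → ℤ} (hσ : IsSignSystem σ) {i : ℕ} (hi : p < i) :
    Koszul.Exact σ (fun j => algebraMap (MvPolynomial (Fin n) K ⧸ J)
      (Localization.AtPrime (irrelevant J)) (Ideal.Quotient.mk J (X j ^ 2)))
      (Localization.AtPrime (irrelevant J)) i := by
  obtain ⟨rs, hrs, hreg, hlen⟩ := hCM.2 (irrelevant J)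
  refine exact_of_isWeaklyRegular hσ _ rs (fun r hr => ?_) _ hreg.toIsWeaklyRegular i ?_
  · have h1 := hrs r hr
    rw [← Localization.AtPrime.map_eq_maximalIdeal] at h1
    -- The maximal ideal lies in the radical of the ideal of the squares, so each member of the
    -- regular sequence has a power in that ideal.
    suffices h : (irrelevant J).map (algebraMap (MvPolynomial (Fin n) K ⧸ J)
        (Localization.AtPrime (irrelevant J))) ≤ (Ideal.span (Set.range fun j =>
        algebraMap (MvPolynomial (Fin n) K ⧸ J)
      (Localization.AtPrime (irrelevant J)) (Ideal.Quotient.mk J (X j ^ 2)))).radical from h h1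
    change Ideal.map _ (Ideal.map _ _) ≤ _
    rw [Ideal.map_map, varIdeal, Ideal.map_span, Ideal.span_le]
    rintro _ ⟨_, ⟨j, -, rfl⟩, rfl⟩
    refine ⟨2, ?_⟩
    rw [← map_pow]
    exact Ideal.subset_span ⟨j, rfl⟩
  · rw [IsLocalization.AtPrime.ringKrullDim_eq_height (irrelevant J)] at hlen
    have h1 : ((rs.length : ℕ) : ℕ∞) = (irrelevant J).height := WithBot.coe_injective hlen
    have h2 := le_height_irrelevant hJ hp
    rw [← h1] at h2
    have h3 : n - p ≤ rs.length := by exact_mod_cast h2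
    rw [Fintype.card_fin]
    omega

/-- The exponent which is `1` outside `W`, `0` on `G` and `2` on the rest of `W`. -/
noncomputable def shiftedExponent (W G : Finset (Fin n)) : Fin n →₀ ℕ :=
  Finsupp.equivFunOnFinite.symm fun j => if j ∈ W then if j ∈ G then 0 else 2 else 1

lemma shiftedExponent_apply (W G : Finset (Fin n)) (j : Fin n) :
    shiftedExponent W G j = if j ∈ W then if j ∈ G then 0 else 2 else 1 := rfl

lemma support_shiftedExponent {W G : Finset (Fin n)} (h : G ⊆ W) :
    (shiftedExponent W G).support = Gᶜ := by
  ext j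
  have := @h j
  simp only [Finsupp.mem_support_iff, shiftedExponent_apply, Finset.mem_compl]
  split_ifs <;> simp_all

lemma shiftedExponent_insert {W G : Finset (Fin n)} {j : Fin n} (hj : j ∈ W) (hjG : j ∉ G) :
    shiftedExponent W G = Finsupp.single j 2 + shiftedExponent W (insert j G) := by
  ext k
  by_cases hk : k = j
  · subst hk; simp [shiftedExponent_apply, hj, hjG]
  · simp [shiftedExponent_apply, hk]

lemma diff_map {ι A B : Type*} [DecidableEq ι] [Fintype ι] [CommRing A] [CommRing B] (g : A →+* B)
    (σ : ι → Finset ι → ℤ) (y : ι → A) (u : Finset ι → A) (G : Finset ι) :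
    diff σ (fun j => g (y j)) (fun G => g (u G)) G = g (diff σ y u G) := by
  simp only [diff, map_sum, map_zsmul, smul_eq_mul, map_mul]

/-- Vanishing of Koszul homology after localization, in a single multidegree. -/
theorem exists_primitive_of_exact {J : Ideal (MvPolynomial (Fin n) K)}
    (hJ : IsSquarefreeMonomialIdeal J) (hJ1 : J ≠ ⊤) [(irrelevant J).IsMaximal]
    (A : Type*) [CommRing A] [Algebra (MvPolynomial (Fin n) K ⧸ J) A]
    [IsLocalization.AtPrime A (irrelevant J)] {σ : Fin n → Finset (Fin n) → ℤ} {i : ℕ}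
    (hex : Koszul.Exact σ (fun j => algebraMap (MvPolynomial (Fin n) K ⧸ J) A
      (Ideal.Quotient.mk J (X j ^ 2))) A i) (W : Finset (Fin n)) (c : Finset (Fin n) → K)
    (hc : ∀ G, c G ≠ 0 → G.card = i ∧ G ⊆ W)
    (hd : ∀ G ⊆ W, sqfreeMonomial K Gᶜ ∉ J → diff σ (fun _ => (1 : K)) c G = 0) :
    ∃ c' : Finset (Fin n) → K, (∀ G, c' G ≠ 0 → G ⊆ W) ∧
      ∀ G ⊆ W, sqfreeMonomial K Gᶜ ∉ J → diff σ (fun _ => (1 : K)) c' G = c G := by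
  set R := MvPolynomial (Fin n) K ⧸ J
  let f : MvPolynomial (Fin n) K →+* A := (algebraMap R A).comp (Ideal.Quotient.mk J)
  let y : Fin n → MvPolynomial (Fin n) K := fun j => X j ^ 2
  -- The strand of multidegree 2 on `W` and 1 elsewhere. Squares are essential: off `W` each
  -- variable divides the coefficient, but its square does not, so only sets `G ⊆ W` occur and the
  -- support of the coefficient is `Gᶜ`.
  let z : Finset (Fin n) → MvPolynomial (Fin n) K :=
    fun G => monomial (shiftedExponent W G) (c G)
  have hzd : ∀ G, diff σ y z G = monomial (shiftedExponent W G) (diff σ (fun _ => (1 : K)) c G) := by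
    intro G
    simp only [diff, map_sum, one_smul]
    refine Finset.sum_congr rfl fun j hj => ?_
    rw [Finset.mem_compl] at hj
    simp only [z, y, smul_eq_mul]
    by_cases h0 : c (insert j G) = 0
    · simp [h0]
    · have hjW := (hc _ h0).2 (Finset.mem_insert_self j G)
      rw [X_pow_eq_monomial, monomial_mul, ← shiftedExponent_insert hjW hj, one_mul, map_zsmul]
  -- Where `Gᶜ` is a face the boundary vanishes by hypothesis; elsewhere its monomial lies in `J`.
  -- So `z` is a cycle modulo `J`.
  have hzJ : ∀ G, diff σ y z G ∈ J := by
    intro G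
    rw [hzd]
    by_cases hGW : G ⊆ W
    · by_cases hG : sqfreeMonomial K Gᶜ ∈ J
      · rw [mem_iff hJ]
        intro a ha
        rw [coeff_monomial, ne_eq, ite_eq_right_iff, Classical.not_imp] at ha
        rw [← ha.1, support_shiftedExponent hGW]
        exact hG
      · rw [hd G hGW hG, map_zero]
        exact J.zero_mem
    · have h0 : diff σ (fun _ => (1 : K)) c G = 0 := by
        refine Finset.sum_eq_zero fun j _ => ?_
        by_cases h0 : c (insert j G) = 0
        · simp [h0]
        · exact absurd ((Finset.subset_insert j G).trans (hc _ h0).2) hGW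
      rw [h0, map_zero]
      exact J.zero_mem
  obtain ⟨w, -, hw⟩ := hex (fun G => f (z G))
    (fun G hG => by
      have : c G = 0 := by
        by_contra h
        exact hG (hc G h).1
      simp [z, this])
    (by
      funext G
      refine (diff_map f σ y z G).trans ?_
      simp only [f, RingHom.comp_apply]
      rw [Ideal.Quotient.eq_zero_iff_mem.mpr (hzJ G), map_zero]; rfl)
  -- Denominators are cleared: `u` is common to the entries of `w`, and each `t G` turns an equality
  -- in the localization into one in S/J.
  obtain ⟨u, hu⟩ := IsLocalization.exist_integer_multiples_of_finite (irrelevant J).primeCompl w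
  choose v hv using hu
  have hclear : ∀ G, ∃ t : (irrelevant J).primeCompl,
      (t : R) * (u * Ideal.Quotient.mk J (z G)) =
        t * diff σ (fun j => Ideal.Quotient.mk J (y j)) v G := by
    intro G
    apply (IsLocalization.eq_iff_exists (irrelevant J).primeCompl A).mp
    have h1 : algebraMap R A (diff σ (fun j => Ideal.Quotient.mk J (y j)) v G) =
        diff σ (fun j => f (y j)) (fun G => algebraMap R A (v G)) G :=
      (diff_map (algebraMap R A) σ (fun j => Ideal.Quotient.mk J (y j)) v G).symm
    rw [h1, map_mul]
    have h2 : (fun G => algebraMap R A (v G)) = algebraMap R A u • w := by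
      funext G
      rw [hv, Algebra.smul_def]
      rfl
    rw [h2, diff_smul]
    have h3 := congrFun hw G
    change algebraMap R A u * f (z G) = algebraMap R A u • _
    rw [← h3]; rfl
  choose t ht using hclear
  obtain ⟨u', hu'⟩ := Ideal.Quotient.mk_surjective (u : R)
  choose v' hv' using fun G => Ideal.Quotient.mk_surjective (v G)
  choose t' ht' using fun G => Ideal.Quotient.mk_surjective (t G : R)
  have hne : ∀ (s : MvPolynomial (Fin n) K) (r : (irrelevant J).primeCompl),
      Ideal.Quotient.mk J s = r → coeff 0 s ≠ 0 := by
    intro s r hs h0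
    apply r.2
    rw [← hs]
    change s ∈ (irrelevant J).comap (Ideal.Quotient.mk J)
    rwa [comap_irrelevant hJ hJ1, mem_varIdeal_univ]
  -- One multiplier for all sets `G`. Like `u'`, it has nonzero constant term, being a product of
  -- elements outside the irrelevant ideal.
  let T : MvPolynomial (Fin n) K := ∏ G, t' G
  have hT0 : coeff 0 (T * u') ≠ 0 := by
    have h1 : coeff 0 (T * u') = (∏ G, coeff 0 (t' G)) * coeff 0 u' := by
      simp only [← constantCoeff_eq, T, map_mul, map_prod]
    rw [h1]
    exact mul_ne_zero (Finset.prod_ne_zero_iff.mpr fun G _ => hne _ _ (ht' G)) (hne _ _ hu')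
  have hmem : ∀ G, T * u' * z G - diff σ y (fun G => T * v' G) G ∈ J := by
    intro G
    rw [← Ideal.Quotient.eq_zero_iff_mem, map_sub, sub_eq_zero]
    have h1 : diff σ y (fun G => T * v' G) G = T * diff σ y v' G :=
      congrFun (diff_smul (σ := σ) (y := y) T v') G
    rw [h1, map_mul, map_mul, map_mul, mul_assoc, ← diff_map, hu', funext hv']
    have h2 : T = (∏ H ∈ Finset.univ.erase G, t' H) * t' G :=
      (Finset.prod_erase_mul _ _ (Finset.mem_univ G)).symm
    rw [h2, map_mul, mul_assoc, mul_assoc, ht', ht]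
  -- The chosen multidegree sees only the constant term of `T * u'` on the left side, so its
  -- coefficients divided by that constant give the primitive.
  refine ⟨fun G => if G ⊆ W then (coeff 0 (T * u'))⁻¹ *
    coeff (shiftedExponent W G) (T * v' G) else 0, fun G hG => ?_, fun G hGW hG => ?_⟩
  · by_contra h
    exact hG (if_neg h)
  · have h0 : coeff (shiftedExponent W G)
        (T * u' * z G - diff σ y (fun G => T * v' G) G) = 0 := by
      by_contra h
      have := (mem_iff hJ _).mp (hmem G) _ h
      rw [support_shiftedExponent hGW] at this
      exact hG this
    have h1 : coeff (shiftedExponent W G) (T * u' * z G) = coeff 0 (T * u') * c G := by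
      have := coeff_mul_monomial 0 (shiftedExponent W G) (c G) (T * u')
      rwa [zero_add] at this
    rw [coeff_sub, h1, sub_eq_zero] at h0
    have h2 : c G = (coeff 0 (T * u'))⁻¹ *
        coeff (shiftedExponent W G) (diff σ y (fun G => T * v' G) G) := by
      rw [← h0, inv_mul_cancel_left₀ hT0]
    rw [h2]
    simp only [diff, coeff_sum, Finset.mul_sum, one_smul]
    refine Finset.sum_congr rfl fun j hj => ?_
    rw [Finset.mem_compl] at hj
    rw [coeff_smul, mul_smul_comm, smul_eq_mul]
    congr 1
    simp only [y]
    rw [X_pow_eq_monomial, coeff_monomial_mul', one_mul]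
    by_cases hjW : j ∈ W
    · rw [if_pos (Finset.insert_subset hjW hGW), shiftedExponent_insert hjW hj,
        if_pos le_self_add, add_tsub_cancel_left]
    · rw [if_neg fun h => hjW (h (Finset.mem_insert_self _ _)), if_neg, mul_zero]
      rw [Finsupp.single_le_iff, shiftedExponent_apply, if_neg hjW]
      omega

/-- A coefficient form of the vanishing of local cohomology of a Cohen-Macaulay
Stanley-Reisner ring. -/
theorem exists_primitive {J : Ideal (MvPolynomial (Fin n) K)}
    (hJ : IsSquarefreeMonomialIdeal J) (hJ1 : J ≠ ⊤)
    (hCM : IsCohenMacaulay (MvPolynomial (Fin n) K ⧸ J))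
    {p : ℕ} (hp : J.height = p) {σ : Fin n → Finset (Fin n) → ℤ} (hσ : IsSignSystem σ)
    {i : ℕ} (hi : p < i) (W : Finset (Fin n)) (c : Finset (Fin n) → K)
    (hc : ∀ G, c G ≠ 0 → G.card = i ∧ G ⊆ W)
    (hd : ∀ G ⊆ W, sqfreeMonomial K Gᶜ ∉ J → diff σ (fun _ => (1 : K)) c G = 0) :
    ∃ c' : Finset (Fin n) → K, (∀ G, c' G ≠ 0 → G ⊆ W) ∧
      ∀ G ⊆ W, sqfreeMonomial K Gᶜ ∉ J → diff σ (fun _ => (1 : K)) c' G = c G := by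
  have hm := isMaximal_irrelevant hJ hJ1
  exact exists_primitive_of_exact hJ hJ1 (Localization.AtPrime (irrelevant J))
    (exact_localization hJ hCM hp hσ hi) W c hc hd

lemma diff_single {ι : Type*} [DecidableEq ι] [Fintype ι] (σ : ι → Finset ι → ℤ) (H : Finset ι) :
    diff σ (fun _ => (1 : K)) (Pi.single H 1) =
      ∑ j ∈ H, σ j (H.erase j) • (Pi.single (H.erase j) 1 : Finset ι → K) := by
  funext G
  simp only [diff, Finset.sum_apply, Pi.smul_apply, one_smul, Pi.single_apply]
  rw [← Finset.sum_subset (s₁ := Gᶜ ∩ H) (s₂ := Gᶜ) Finset.inter_subset_left,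
    ← Finset.sum_subset (s₁ := Gᶜ ∩ H) (s₂ := H) Finset.inter_subset_right]
  · refine Finset.sum_congr rfl fun j hj => ?_
    simp only [Finset.mem_inter, Finset.mem_compl] at hj
    have h1 : insert j G = H ↔ G = H.erase j := by
      constructor
      · rintro rfl; rw [Finset.erase_insert hj.1]
      · rintro rfl; rw [Finset.insert_erase hj.2]
    by_cases h : G = H.erase j
    · rw [if_pos (h1.mpr h), if_pos h, ← h]
    · rw [if_neg (fun h' => h (h1.mp h')), if_neg h, smul_zero, smul_zero]
  · intro j hj hj'
    rw [if_neg, smul_zero]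
    rintro rfl
    exact hj' (by simp [hj])
  · intro j hj hj'
    rw [if_neg, smul_zero]
    rintro rfl
    exact hj' (by simpa using hj)

/-- The Koszul differential over a field, as a linear map. -/
noncomputable def diffLinear (σ : Fin n → Finset (Fin n) → ℤ) :
    (Finset (Fin n) → K) →ₗ[K] (Finset (Fin n) → K) where
  toFun := diff σ fun _ => (1 : K)
  map_add' := diff_add
  map_smul' := diff_smul

/-- Reisner's criterion: the links in a Cohen-Macaulay complex have no homology below their
dimension. -/
theorem exists_boundary_of_isCohenMacaulay {J : Ideal (MvPolynomial (Fin n) K)}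
    (hJ : IsSquarefreeMonomialIdeal J) (hJ1 : J ≠ ⊤)
    (hCM : IsCohenMacaulay (MvPolynomial (Fin n) K ⧸ J))
    {p : ℕ} (hp : J.height = p) (W : Finset (Fin n)) {i : ℕ} (hi : i + p < W.card)
    (a : Finset (Fin n) → K)
    (ha : ∀ H, a H ≠ 0 → H.card = i ∧ H ⊆ W ∧ sqfreeMonomial K (W \ H)ᶜ ∉ J)
    (had : diff stdSign (fun _ => (1 : K)) a = 0) :
    ∃ a' : Finset (Fin n) → K,
      (∀ H, a' H ≠ 0 → H.card = i + 1 ∧ H ⊆ W ∧ sqfreeMonomial K (W \ H)ᶜ ∉ J) ∧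
      diff stdSign (fun _ => (1 : K)) a' = a := by
  -- Since `(W \ H)ᶜ = H ∪ Wᶜ`, these are the chains on the link of `Wᶜ`.
  let E : Submodule K (Finset (Fin n) → K) :=
    { carrier := {v | ∀ H, v H ≠ 0 → H.card = i + 1 ∧ H ⊆ W ∧ sqfreeMonomial K (W \ H)ᶜ ∉ J}
      zero_mem' := fun H h => absurd rfl h
      add_mem' := fun {u v} hu hv H h => by
        by_cases h0 : u H = 0
        · exact hv H fun h1 => h (by rw [Pi.add_apply, h0, h1, add_zero])
        · exact hu H h0
      smul_mem' := fun r v hv H h => hv H fun h0 => h (by rw [Pi.smul_apply, h0, smul_zero]) }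
  by_contra hcon
  have hnot : a ∉ E.map (diffLinear stdSign) := by
    rintro ⟨a', h1, h2⟩
    exact hcon ⟨a', h1, h2⟩
  -- A chain that is not a boundary is detected by a functional killing all boundaries, that is, by
  -- a cocycle; it remains to show that this cocycle is a coboundary.
  obtain ⟨φ, hφa, hφ⟩ := Submodule.exists_le_ker_of_notMem hnot
  -- Passing from `H` to `W \ H` turns the coboundary into a Koszul differential. The twist by
  -- `stdSign j Wᶜ` removes the sign contributed by indices outside `W`.
  have hε : ∀ j : Fin n, stdSign j Wᶜ * stdSign j Wᶜ = 1 := fun j => stdSign_mul_self j _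
  have hσ := (isSignSystem_stdSign n).compl hε
  have hsign : ∀ H ⊆ W, ∀ j ∈ H,
      stdSign j Wᶜ * stdSign j (insert j (W \ H))ᶜ = stdSign j (H.erase j) := by
    intro H hH j hj
    have h1 : (insert j (W \ H))ᶜ = Wᶜ ∪ H.erase j := by
      ext k
      have := @hH k
      simp only [Finset.mem_compl, Finset.mem_insert, Finset.mem_sdiff, Finset.mem_union,
        Finset.mem_erase]
      by_cases hk : k = j
      · subst hk; simp [hH hj]
      · tauto
    have h2 : Disjoint Wᶜ (H.erase j) :=
      (disjoint_compl_left).mono_right ((Finset.erase_subset _ _).trans hH)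
    rw [h1, stdSign_union j h2, ← mul_assoc, stdSign_mul_self, one_mul]
  have hins : ∀ H ⊆ W, ∀ j ∈ H, insert j (W \ H) = W \ H.erase j := by
    intro H hH j hj
    ext k
    simp only [Finset.mem_insert, Finset.mem_sdiff, Finset.mem_erase]
    by_cases hk : k = j
    · subst hk; simp [hH hj]
    · simp [hk]
  have hcompl : ∀ H ⊆ W, H ⊆ (W \ H)ᶜ := fun H _ k hk => by simp [hk]
  have hsdiff : ∀ c : Finset (Fin n) → K, (∀ G, c G ≠ 0 → G ⊆ W) → ∀ H ⊆ W,
      diff (fun j G => stdSign j Wᶜ * stdSign j (insert j G)ᶜ) (fun _ => (1 : K)) c (W \ H) =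
        ∑ j ∈ H, stdSign j (H.erase j) • c (W \ H.erase j) := by
    intro c hc H hH
    rw [diff, ← Finset.sum_subset (hcompl H hH)]
    · refine Finset.sum_congr rfl fun j hj => ?_
      rw [hsign H hH j hj, hins H hH j hj, one_smul]
    · intro j hj hjH
      have : c (insert j (W \ H)) = 0 := by
        by_contra h
        have h1 := hc _ h (Finset.mem_insert_self _ _)
        simp only [Finset.mem_compl, Finset.mem_sdiff, not_and_not_right] at hj
        exact hjH (hj h1)
      rw [this, smul_zero, smul_zero]
  -- The cocycle `φ` transported to complements in `W`, hence in homological degree |W| - i > p.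
  let c : Finset (Fin n) → K := fun G =>
    if G.card = W.card - i ∧ G ⊆ W then φ (Pi.single (W \ G) 1) else 0
  have hc : ∀ G, c G ≠ 0 → G.card = W.card - i ∧ G ⊆ W := fun G hG => by
    by_contra h
    exact hG (if_neg h)
  obtain ⟨c', hc', hcc'⟩ := exists_primitive hJ hJ1 hCM hp hσ (i := W.card - i) (by omega) W c hc
    (by
      intro G hGW hG
      obtain ⟨H, hHW, rfl⟩ : ∃ H ⊆ W, W \ H = G :=
        ⟨W \ G, Finset.sdiff_subset, Finset.sdiff_sdiff_eq_self hGW⟩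
      rw [hsdiff c (fun G h => (hc G h).2) H hHW]
      by_cases hcard : H.card = i + 1
      · have h1 : (Pi.single H 1 : Finset (Fin n) → K) ∈ E := by
          intro H' hH'
          rw [Pi.single_apply, ne_eq, ite_eq_right_iff, Classical.not_imp] at hH'
          rw [hH'.1]
          exact ⟨hcard, hHW, hG⟩
        have h2 : φ (diff stdSign (fun _ => (1 : K)) (Pi.single H 1)) = 0 :=
          hφ ⟨_, h1, rfl⟩
        rw [diff_single, map_sum] at h2
        rw [← h2]
        refine Finset.sum_congr rfl fun j hj => ?_
        have h3 : (H.erase j).card = i := by rw [Finset.card_erase_of_mem hj, hcard]; rfl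
        have h4 : H.erase j ⊆ W := (Finset.erase_subset _ _).trans hHW
        rw [map_zsmul]
        simp only [c]
        rw [if_pos ⟨by rw [Finset.card_sdiff_of_subset h4, h3], Finset.sdiff_subset⟩,
          Finset.sdiff_sdiff_eq_self h4]
      · refine Finset.sum_eq_zero fun j hj => ?_
        have h4 : H.erase j ⊆ W := (Finset.erase_subset _ _).trans hHW
        have h5 := Finset.card_le_card h4
        have h6 := Finset.card_erase_add_one hj
        simp only [c]
        rw [if_neg, smul_zero]
        rw [Finset.card_sdiff_of_subset h4]
        omega)
  -- The primitive, read back as a functional: φ(a) = ψ(∂a) = 0, contradicting the choice of φ.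
  let ψ : (Finset (Fin n) → K) →ₗ[K] K :=
    ∑ H, (c' (W \ H)) • LinearMap.proj H
  have hψ : ∀ H, ψ (Pi.single H 1) = c' (W \ H) := by
    intro H
    simp [ψ, LinearMap.sum_apply, Pi.single_apply]
  have hsum : ∀ v : Finset (Fin n) → K, v = ∑ H, v H • (Pi.single H 1 : Finset (Fin n) → K) := by
    intro v
    funext H
    simp [Finset.sum_apply, Pi.single_apply]
  apply hφa
  have h0 : ψ (diffLinear stdSign a) = 0 := by
    have : diffLinear stdSign a = 0 := had
    rw [this, map_zero]
  rw [hsum a, map_sum, map_sum] at h0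
  rw [hsum a, map_sum, ← h0]
  refine Finset.sum_congr rfl fun H _ => ?_
  rw [map_smul, map_smul, map_smul]
  by_cases haH : a H = 0
  · rw [haH, zero_smul, zero_smul]
  · obtain ⟨h1, h2, h3⟩ := ha H haH
    congr 1
    have h4 := hcc' (W \ H) Finset.sdiff_subset h3
    rw [hsdiff c' hc' H h2] at h4
    have h5 : c (W \ H) = φ (Pi.single H 1) := by
      simp only [c]
      rw [if_pos ⟨by rw [Finset.card_sdiff_of_subset h2, h1], Finset.sdiff_subset⟩,
        Finset.sdiff_sdiff_eq_self h2]
    rw [← h5, ← h4]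
    change _ = ψ (diff stdSign (fun _ => (1 : K)) (Pi.single H 1))
    rw [diff_single, map_sum]
    refine Finset.sum_congr rfl fun j hj => ?_
    rw [map_zsmul, hψ]

end CohenMacaulay

open Koszul

/-! ### The Eagon-Reiner theorem -/

section EagonReiner

variable {K : Type*} [Field K] {n : ℕ}

/-- The strand of the Koszul complex of the Alexander dual in multidegree `b`. -/
lemma exists_boundary_multidegree {J : Ideal (MvPolynomial (Fin n) K)}
    (hJ : IsSquarefreeMonomialIdeal J) (hJ1 : J ≠ ⊤)
    (hCM : IsCohenMacaulay (MvPolynomial (Fin n) K ⧸ J)) {p : ℕ} (hp : J.height = p)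
    {i : ℕ} (b : Fin n →₀ ℕ) (hi : b.degree ≠ p + i) (c : Finset (Fin n) → K)
    (hc : ∀ G, c G ≠ 0 → G.card = i ∧ ind G ≤ b ∧
      sqfreeMonomial K (b - ind G).support ∈ alexanderDual J)
    (hcd : diff stdSign (fun _ => (1 : K)) c = 0) :
    ∃ w : Finset (Fin n) → K, (∀ G, w G ≠ 0 → G.card = i + 1 ∧ ind G ≤ b ∧
      sqfreeMonomial K (b - ind G).support ∈ alexanderDual J) ∧
      diff stdSign (fun _ => (1 : K)) w = c := by
  by_cases hb : ∃ j, 2 ≤ b j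
  -- Subtracting one from an exponent at least 2 keeps `j` in the support, so `j` is a cone apex.
  · obtain ⟨j, hj⟩ := hb
    refine exists_boundary_of_cone (isSignSystem_stdSign n) (fun G => ind G ≤ b ∧
      sqfreeMonomial K (b - ind G).support ∈ alexanderDual J) j ?_ i c hc hcd
    rintro G hjG ⟨hG, hGm⟩
    rw [ind_le_iff] at hG ⊢
    refine ⟨Finset.insert_subset (by simp; omega) hG, ?_⟩
    refine sqfreeMonomial_mem_of_subset ?_ hGm
    intro k hk
    simp only [Finsupp.mem_support_iff, Finsupp.tsub_apply, ind_apply, Finset.mem_insert] at hk ⊢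
    by_cases hkj : k = j
    · subst hkj; simp; omega
    · simpa [hkj] using hk
  · push Not at hb
    obtain ⟨W, rfl⟩ : ∃ W : Finset (Fin n), b = ind W := ⟨b.support, by
      ext j
      have := hb j
      simp only [ind_apply, Finsupp.mem_support_iff]
      split_ifs <;> omega⟩
    have hΓ : ∀ G, (ind G ≤ ind W ∧
        sqfreeMonomial K (ind W - ind G).support ∈ alexanderDual J) ↔
        (G ⊆ W ∧ sqfreeMonomial K (W \ G)ᶜ ∉ J) := by
      intro G
      have h1 : (ind W).support = W := by ext j; simp
      have h2 : (ind W - ind G).support = W \ G := by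
        ext j
        simp only [Finsupp.mem_support_iff, Finsupp.tsub_apply, ind_apply, Finset.mem_sdiff]
        split_ifs <;> simp_all
      rw [ind_le_iff, h1, h2, sqfreeMonomial_mem_alexanderDual]
    rw [degree_ind] at hi
    simp only [hΓ] at hc ⊢
    by_cases hlt : i + p < W.card
    · exact exists_boundary_of_isCohenMacaulay hJ hJ1 hCM hp W hlt c hc hcd
    -- Now |W| < p + i. Faces of the complex of `J` have at most n - p elements, so the link has no
    -- faces of size `i` and the chain is zero.
    · refine ⟨0, by simp, ?_⟩
      rw [diff_zero]
      funext G
      by_contra hG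
      obtain ⟨h1, h2, h3⟩ := hc G (Ne.symm hG)
      have h4 := height_add_card_le hJ h3 hp
      have h5 := Finset.card_add_card_compl (W \ G)
      rw [Fintype.card_fin, Finset.card_sdiff_of_subset h2] at h5
      have h6 := Finset.card_le_card h2
      omega

/-- The Eagon-Reiner theorem: the Alexander dual of a Cohen-Macaulay squarefree monomial ideal
has a linear resolution. -/
theorem hasLinearResolution_alexanderDual {J : Ideal (MvPolynomial (Fin n) K)}
    (hJ : IsSquarefreeMonomialIdeal J) (hJ1 : J ≠ ⊤)
    (hCM : IsCohenMacaulay (MvPolynomial (Fin n) K ⧸ J)) {p : ℕ} (hp : J.height = p) :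
    HasLinearResolution (alexanderDual J) p := by
  let U : Submodule (MvPolynomial (Fin n) K) (Fin 1 → MvPolynomial (Fin n) K) :=
    Submodule.comap (LinearMap.proj 0) (alexanderDual J)
  have hI := isSquarefreeMonomialIdeal_alexanderDual J
  have hU : ∀ v, v ∈ U ↔ ∀ a, coeff a (v 0) ≠ 0 →
      sqfreeMonomial K a.support ∈ alexanderDual J := fun v => mem_iff hI (v 0)
  have hgr : IsGraded U := by
    intro v hv d
    rw [hU] at hv ⊢
    intro a ha
    rw [coeff_homogeneousComponent] at ha
    split_ifs at ha with h
    · exact hv a ha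
    · exact absurd rfl ha
  -- Koszul chains in n variables vanish above homological degree n, which explains the bound n + 1.
  have hlin : IsKoszulLinear U p (n + 1) := by
    intro i t hit z hz hzb hzd
    by_cases hi : i < n + 1
    · obtain ⟨w, hw, hwd⟩ := exists_boundary_of_multidegree stdSign
        (fun a => sqfreeMonomial K a.support ∈ alexanderDual J) i t
        (fun b hb c hc hcd => exists_boundary_multidegree hJ hJ1 hCM hp b
          (fun h => hit ⟨by omega, hi⟩) c hc hcd) (fun G => z G 0)
        (fun G a ha => ⟨(hzb G 0 a ha).1, (hzb G 0 a ha).2, (hU _).mp (hz G) a ha⟩) (by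
          funext G
          rw [← diff_apply, hzd]; rfl)
      refine ⟨fun G _ => w G, fun G => (hU _).mpr fun a ha => (hw G a ha).2.2,
        fun G k a ha => ⟨(hw G a ha).1, (hw G a ha).2.1⟩, ?_⟩
      funext G k
      rw [diff_apply, Subsingleton.elim k 0]
      exact congrFun hwd G
    · refine ⟨0, by simp, by simp [Bihomogeneous], ?_⟩
      rw [diff_zero]
      funext G
      refine (hzb.apply_eq_zero fun h => ?_).symm
      have := Finset.card_le_univ G
      rw [Fintype.card_fin] at this
      omega
  obtain ⟨β, g, M, hβ, hg, hM, hspan, h0, hex⟩ := hlin.exists_resolution _ hgr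
  refine ⟨n + 1, β, fun j => g j 0, M, hβ, fun j => hg j 0, hM, ?_, ?_, hex⟩
  · have h1 : Ideal.span (Set.range fun j => g j 0) = Submodule.map
        (LinearMap.proj (R := MvPolynomial (Fin n) K)
          (φ := fun _ : Fin 1 => MvPolynomial (Fin n) K) 0) U := by
      rw [← hspan, Submodule.map_span, ← Set.range_comp]
      rfl
    rw [h1]
    exact Submodule.map_comap_eq_of_surjective (fun x => ⟨fun _ => x, rfl⟩) _
  · intro v
    rw [← h0, relations, LinearMap.mem_ker, funext_iff, Unique.forall_iff,
      linearCombination_apply']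
    rfl

end EagonReiner

end Squarefree

namespace Hilbert

/-! ### The Hilbert-Serre theorem -/

section HilbertSerre

variable {K : Type*} [Field K] {n : ℕ}

instance finite_homogeneousSubmodule (j : ℕ) :
    Module.Finite K (homogeneousSubmodule (Fin n) K j) :=
  Module.Finite.iff_fg.mpr (homogeneousSubmodule_fg _ _ _)

/-- The dimension of the space of forms of degree `j` in `I`. -/
noncomputable def gradedDim (I : Ideal (MvPolynomial (Fin n) K)) (j : ℕ) : ℕ :=
  Module.finrank K ↥(homogeneousSubmodule (Fin n) K j ⊓ I.restrictScalars K)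

/-- The Hilbert series of the ideal `I`. -/
noncomputable def idealSeries (I : Ideal (MvPolynomial (Fin n) K)) : PowerSeries ℤ :=
  PowerSeries.mk fun j => (gradedDim I j : ℤ)

lemma finrank_map_add_finrank_inf_ker {V V' : Type*} [AddCommGroup V] [Module K V]
    [AddCommGroup V'] [Module K V'] (f : V →ₗ[K] V') (W : Submodule K V) [Module.Finite K W] :
    Module.finrank K (W.map f) + Module.finrank K ↥(W ⊓ LinearMap.ker f) =
      Module.finrank K W := by
  have h := (f.domRestrict W).finrank_range_add_finrank_ker
  rw [LinearMap.range_domRestrict, LinearMap.ker_domRestrict] at h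
  rw [← h, ← Submodule.map_comap_subtype, Submodule.finrank_map_subtype_eq]

lemma hilbertSeries_eq (I : Ideal (MvPolynomial (Fin n) K)) :
    hilbertSeries I = idealSeries (⊤ : Ideal (MvPolynomial (Fin n) K)) - idealSeries I := by
  ext j
  have h := finrank_map_add_finrank_inf_ker (Ideal.Quotient.mkₐ K I).toLinearMap
    (homogeneousSubmodule (Fin n) K j)
  have hker : LinearMap.ker (Ideal.Quotient.mkₐ K I).toLinearMap = I.restrictScalars K := by
    ext x
    simp [Ideal.Quotient.eq_zero_iff_mem]
  rw [hker] at h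
  have htop : gradedDim (⊤ : Ideal (MvPolynomial (Fin n) K)) j =
      Module.finrank K (homogeneousSubmodule (Fin n) K j) := by
    rw [gradedDim, Submodule.restrictScalars_top, inf_top_eq]
  simp only [hilbertSeries, idealSeries, map_sub, PowerSeries.coeff_mk, htop, ← h]
  rw [gradedDim]
  push_cast
  ring

lemma gradedDim_congr {I J : Ideal (MvPolynomial (Fin n) K)} {j : ℕ}
    (h : ∀ f : MvPolynomial (Fin n) K, f.IsHomogeneous j → (f ∈ I ↔ f ∈ J)) :
    gradedDim I j = gradedDim J j := by
  have h0 : homogeneousSubmodule (Fin n) K j ⊓ I.restrictScalars K =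
      homogeneousSubmodule (Fin n) K j ⊓ J.restrictScalars K :=
    Submodule.ext fun f => and_congr_right (h f)
  rw [gradedDim, gradedDim, h0]

/-- An ideal containing the homogeneous components of its elements. -/
def IsGradedIdeal (I : Ideal (MvPolynomial (Fin n) K)) : Prop :=
  ∀ f ∈ I, ∀ d, homogeneousComponent d f ∈ I

/-- Multiplication by a variable. -/
noncomputable def mulVar (K : Type*) [Field K] {n : ℕ} (i : Fin n) :
    MvPolynomial (Fin n) K →ₗ[MvPolynomial (Fin n) K] MvPolynomial (Fin n) K :=
  LinearMap.mul _ _ (X i)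

@[simp] lemma mulVar_apply (i : Fin n) (f : MvPolynomial (Fin n) K) : mulVar K i f = X i * f := rfl

lemma homogeneousComponent_X_mul (i : Fin n) (f : MvPolynomial (Fin n) K) (d : ℕ) :
    homogeneousComponent (d + 1) (X i * f) = X i * homogeneousComponent d f := by
  rw [mul_comm, Koszul.homogeneousComponent_mul_of_isHomogeneous _ (isHomogeneous_X K i), mul_comm]

lemma homogeneousComponent_zero_X_mul (i : Fin n) (f : MvPolynomial (Fin n) K) :
    homogeneousComponent 0 (X i * f) = 0 := by
  rw [mul_comm, Koszul.homogeneousComponent_mul_of_lt _ (isHomogeneous_X K i) one_pos]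

variable {A B : Ideal (MvPolynomial (Fin n) K)}

lemma IsGradedIdeal.sup_map (hA : IsGradedIdeal A) (hB : IsGradedIdeal B) (i : Fin n) :
    IsGradedIdeal (A ⊔ Submodule.map (mulVar K i) B) := by
  intro f hf d
  obtain ⟨a, ha, _, ⟨b, hb, rfl⟩, rfl⟩ := Submodule.mem_sup.mp hf
  rw [map_add]
  refine add_mem (Submodule.mem_sup_left (hA a ha d)) (Submodule.mem_sup_right ?_)
  cases d with
  | zero => rw [mulVar_apply, homogeneousComponent_zero_X_mul]; exact Submodule.zero_mem _
  | succ d => exact ⟨_, hB b hb d, (homogeneousComponent_X_mul i b d).symm⟩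

lemma IsGradedIdeal.inf_comap (hA : IsGradedIdeal A) (hB : IsGradedIdeal B) (i : Fin n) :
    IsGradedIdeal (B ⊓ Submodule.comap (mulVar K i) A) := by
  rintro f ⟨hfB, hfA⟩ d
  refine ⟨hB f hfB d, ?_⟩
  show X i * _ ∈ A
  rw [← homogeneousComponent_X_mul]
  exact hA _ hfA _

/-- Multiplication by a variable relates the Hilbert functions of four ideals. -/
lemma gradedDim_step (hA : IsGradedIdeal A) (hB : IsGradedIdeal B) (i : Fin n) (j : ℕ) :
    gradedDim (A ⊔ Submodule.map (mulVar K i) B) (j + 1) + gradedDim (B ⊓ Submodule.comap (mulVar K i) A) j =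
      gradedDim A (j + 1) + gradedDim B j := by
  let q : MvPolynomial (Fin n) K →ₗ[K] MvPolynomial (Fin n) K ⧸ A :=
    (Ideal.Quotient.mkₐ K A).toLinearMap
  have hker : LinearMap.ker q = A.restrictScalars K := by
    ext x
    simp [q, Ideal.Quotient.eq_zero_iff_mem]
  let f : MvPolynomial (Fin n) K →ₗ[K] MvPolynomial (Fin n) K ⧸ A :=
    q ∘ₗ (mulVar K i).restrictScalars K
  have hkerf : LinearMap.ker f = (Submodule.comap (mulVar K i) A).restrictScalars K := by
    ext x
    exact Ideal.Quotient.eq_zero_iff_mem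
  set S' := homogeneousSubmodule (Fin n) K (j + 1) ⊓ (A ⊔ Submodule.map (mulVar K i) B).restrictScalars K
    with hS'
  have hfin : Module.Finite K S' := Submodule.finiteDimensional_of_le inf_le_left
  have h1 := finrank_map_add_finrank_inf_ker q S'
  have hfin2 : Module.Finite K
    ↥(homogeneousSubmodule (Fin n) K j ⊓ B.restrictScalars K) :=
      Submodule.finiteDimensional_of_le inf_le_left
  have h2 := finrank_map_add_finrank_inf_ker f
    (homogeneousSubmodule (Fin n) K j ⊓ B.restrictScalars K)
  have e1 : S' ⊓ LinearMap.ker q =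
      homogeneousSubmodule (Fin n) K (j + 1) ⊓ A.restrictScalars K := by
    rw [hker, hS', inf_assoc]
    congr 1
    exact inf_eq_right.mpr fun x hx => Submodule.mem_sup_left hx
  have e2 : homogeneousSubmodule (Fin n) K j ⊓ B.restrictScalars K ⊓ LinearMap.ker f =
      homogeneousSubmodule (Fin n) K j ⊓ (B ⊓ Submodule.comap (mulVar K i) A).restrictScalars K := by
    rw [hkerf, inf_assoc]; rfl
  -- In degree j + 1, the quotient (A + xB)/A is the image of the degree j part of B under
  -- multiplication by x.
  have e3 : S'.map q = (homogeneousSubmodule (Fin n) K j ⊓ B.restrictScalars K).map f := by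
    apply le_antisymm
    · rintro _ ⟨v, ⟨hv1, hv2⟩, rfl⟩
      obtain ⟨a, ha, _, ⟨b, hb, rfl⟩, hab⟩ := Submodule.mem_sup.mp hv2
      refine ⟨homogeneousComponent j b, ⟨homogeneousComponent_isHomogeneous _ _, hB b hb j⟩, ?_⟩
      have h3 := homogeneousComponent_eq_self ((mem_homogeneousSubmodule _ _).mp hv1)
      rw [← hab, map_add, mulVar_apply, homogeneousComponent_X_mul] at h3
      rw [mulVar_apply] at hab
      rw [← hab, ← h3, map_add]
      have h4 : q (homogeneousComponent (j + 1) a) = 0 := by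
        rw [← LinearMap.mem_ker, hker]
        exact hA a ha _
      rw [h4, zero_add]; rfl
    · rintro _ ⟨b, ⟨hb1, hb2⟩, rfl⟩
      refine ⟨X i * b, ⟨?_, Submodule.mem_sup_right ⟨b, hb2, rfl⟩⟩, rfl⟩
      rw [SetLike.mem_coe, mem_homogeneousSubmodule, add_comm]
      exact (isHomogeneous_X K i).mul hb1
  rw [e1] at h1
  rw [e2, ← e3] at h2
  unfold gradedDim
  rw [← hS']
  omega

lemma gradedDim_zero_step (hA : IsGradedIdeal A) (i : Fin n) :
    gradedDim (A ⊔ Submodule.map (mulVar K i) B) 0 = gradedDim A 0 := by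
  refine gradedDim_congr fun v hv => ?_
  constructor
  · intro h
    obtain ⟨a, ha, _, ⟨b, hb, rfl⟩, hab⟩ := Submodule.mem_sup.mp h
    have h3 := homogeneousComponent_eq_self ((mem_homogeneousSubmodule _ _).mp hv)
    rw [← hab, map_add, mulVar_apply, homogeneousComponent_zero_X_mul, add_zero] at h3
    rw [mulVar_apply] at hab
    rw [← hab, ← h3]
    exact hA a ha 0
  · exact fun h => Submodule.mem_sup_left h

/-- For A ≤ B, multiplication by x from B/A, shifted by one degree, to B/A has kernel (B ∩ (A :
x))/A and cokernel B/(A + xB); this compares the Hilbert series. -/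
lemma idealSeries_step (hA : IsGradedIdeal A) (hB : IsGradedIdeal B) (i : Fin n) :
    (idealSeries B - idealSeries A) * (1 - PowerSeries.X) =
      (idealSeries B - idealSeries (A ⊔ Submodule.map (mulVar K i) B)) -
        PowerSeries.X * (idealSeries (B ⊓ Submodule.comap (mulVar K i) A) - idealSeries A) := by
  have h : idealSeries (A ⊔ Submodule.map (mulVar K i) B) - idealSeries A =
      PowerSeries.X * (idealSeries B - idealSeries (B ⊓ Submodule.comap (mulVar K i) A)) := by
    ext j
    cases j with
    | zero => simp [idealSeries, gradedDim_zero_step hA i]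
    | succ j =>
      rw [PowerSeries.coeff_succ_X_mul]
      simp only [idealSeries, map_sub, PowerSeries.coeff_mk]
      have := gradedDim_step hA hB i j
      omega
  linear_combination h

/-- The **Hilbert-Serre theorem** for quotients of ideals annihilated by all but the first `k`
variables. -/
theorem exists_polynomial_of_annihilated (k : ℕ) : ∀ {A B : Ideal (MvPolynomial (Fin n) K)},
    A ≤ B → IsGradedIdeal A → IsGradedIdeal B →
    (∀ i : Fin n, k ≤ i → ∀ b ∈ B, X i * b ∈ A) →
    ∃ Q : Polynomial ℤ, (idealSeries B - idealSeries A) * (1 - PowerSeries.X) ^ k =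
      (Q : PowerSeries ℤ) := by
  induction k with
  | zero =>
    intro A B hAB hA hB hX
    obtain ⟨s, hs⟩ := (IsNoetherian.noetherian B : B.FG)
    have hvar : ∀ r ∈ Squarefree.varIdeal K (Finset.univ : Finset (Fin n)), ∀ b ∈ B,
        r * b ∈ A := by
      intro r hr b hb
      unfold Squarefree.varIdeal at hr
      induction hr using Submodule.span_induction with
      | mem x hx =>
        obtain ⟨i, -, rfl⟩ := hx
        exact hX i (Nat.zero_le _) b hb
      | zero => rw [zero_mul]; exact A.zero_mem
      | add x y _ _ hx hy => rw [add_mul]; exact A.add_mem hx hy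
      | smul c x _ hx => rw [smul_eq_mul, mul_assoc]; exact A.mul_mem_left _ hx
    -- All variables act as zero on B/A, so scalar combinations of finitely many generators
    -- represent every class; B/A vanishes above their maximal degree.
    have key : ∀ b ∈ B, ∃ a ∈ A, (b - a).totalDegree ≤ s.sup totalDegree := by
      intro b hb
      rw [← hs] at hb
      induction hb using Submodule.span_induction with
      | mem x hx => exact ⟨0, A.zero_mem, by rw [sub_zero]; exact Finset.le_sup hx⟩
      | zero => exact ⟨0, A.zero_mem, by simp⟩
      | add x y _ _ hx hy =>
        obtain ⟨u, hu, hu'⟩ := hx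
        obtain ⟨v, hv, hv'⟩ := hy
        refine ⟨u + v, A.add_mem hu hv, ?_⟩
        rw [add_sub_add_comm]
        exact (totalDegree_add _ _).trans (max_le hu' hv')
      | smul r x hxs hx =>
        obtain ⟨u, hu, hu'⟩ := hx
        have hxB : x ∈ B := hs ▸ hxs
        refine ⟨(r - C (coeff 0 r)) * x + C (coeff 0 r) * u, A.add_mem (hvar _ ?_ x hxB)
          (A.mul_mem_left _ hu), ?_⟩
        · rw [Squarefree.mem_varIdeal_univ]; simp
        · have : r • x - ((r - C (coeff 0 r)) * x + C (coeff 0 r) * u) =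
              (coeff 0 r) • (x - u) := by
            rw [smul_eq_mul, smul_eq_C_mul]; ring
          rw [this]
          exact (totalDegree_smul_le _ _).trans hu'
    have hvan : ∀ j, s.sup totalDegree < j → gradedDim B j = gradedDim A j := by
      intro j hj
      refine gradedDim_congr fun v hv => ⟨fun hvB => ?_, fun h => hAB h⟩
      obtain ⟨a, ha, hd⟩ := key v hvB
      have h1 := homogeneousComponent_eq_zero j (v - a) (hd.trans_lt hj)
      rw [map_sub, homogeneousComponent_eq_self ((mem_homogeneousSubmodule _ _).mp hv),
        sub_eq_zero] at h1
      rw [h1]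
      exact hA a ha j
    refine ⟨PowerSeries.trunc (s.sup totalDegree + 1) (idealSeries B - idealSeries A), ?_⟩
    rw [pow_zero, mul_one]
    ext j
    rw [Polynomial.coeff_coe, PowerSeries.coeff_trunc]
    split_ifs with h
    · rfl
    · simp only [idealSeries, map_sub, PowerSeries.coeff_mk]
      rw [hvan j (by omega), sub_self]
  | succ k ih =>
    intro A B hAB hA hB hX
    by_cases hk : k < n
    · let i : Fin n := ⟨k, hk⟩
      have hmap : Submodule.map (mulVar K i) B ≤ B := by
        rintro _ ⟨b, hb, rfl⟩
        exact B.mul_mem_left _ hb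
      -- The variable of index `k` kills both the cokernel and the kernel of its multiplication on
      -- B/A, so induction applies to each.
      obtain ⟨Q₁, h₁⟩ := ih (sup_le hAB hmap) (hA.sup_map hB i) hB (by
        intro j hj b hb
        by_cases hji : j = i
        · subst hji
          exact Submodule.mem_sup_right ⟨b, hb, rfl⟩
        · refine Submodule.mem_sup_left (hX j ?_ b hb)
          have : (j : ℕ) ≠ k := fun h => hji (Fin.ext h)
          omega)
      obtain ⟨Q₂, h₂⟩ := ih (A := A) (B := B ⊓ Submodule.comap (mulVar K i) A)
        (le_inf hAB fun a ha => A.mul_mem_left _ ha) hA (hA.inf_comap hB i) (by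
        rintro j hj b ⟨hb, hb'⟩
        by_cases hji : j = i
        · subst hji
          exact hb'
        · refine hX j ?_ b hb
          have : (j : ℕ) ≠ k := fun h => hji (Fin.ext h)
          omega)
      refine ⟨Q₁ - Polynomial.X * Q₂, ?_⟩
      rw [pow_succ', ← mul_assoc, idealSeries_step hA hB i]
      push_cast
      rw [← h₁, ← h₂]
      ring
    · obtain ⟨Q, h⟩ := ih hAB hA hB (fun i hi => absurd i.2 (by omega))
      refine ⟨Q * (1 - Polynomial.X), ?_⟩
      rw [pow_succ, ← mul_assoc, h]
      push_cast
      ring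

/-- The **Hilbert-Serre theorem**. -/
theorem exists_polynomial {I : Ideal (MvPolynomial (Fin n) K)} (hI : IsGradedIdeal I) :
    ∃ Q : Polynomial ℤ, hilbertSeries I * (1 - PowerSeries.X) ^ n = (Q : PowerSeries ℤ) := by
  rw [hilbertSeries_eq]
  exact exists_polynomial_of_annihilated n le_top hI (fun _ _ _ => trivial)
    fun i hi => absurd i.2 (by omega)

end HilbertSerre

/-! ### Growth of the Hilbert function through Noether normalization -/

section Growth

variable {K : Type*} [Field K] {n : ℕ}

lemma finrank_restrictDegree_le (s q : ℕ) :
    Module.finrank K (restrictDegree (Fin s) K q) ≤ (q + 1) ^ s := by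
  have hinj : Function.Injective (fun f : {f : Fin s →₀ ℕ | ∀ a, f a ≤ q} =>
      fun a : Fin s => (⟨f.1 a, Nat.lt_succ_of_le (f.2 a)⟩ : Fin (q + 1))) := by
    intro f g h
    apply Subtype.ext
    ext a
    exact Fin.mk.inj_iff.mp (congrFun h a)
  have hfin : Finite {f : Fin s →₀ ℕ | ∀ a, f a ≤ q} := Finite.of_injective _ hinj
  have := Fintype.ofFinite {f : Fin s →₀ ℕ | ∀ a, f a ≤ q}
  have h1 : Module.finrank K (restrictDegree (Fin s) K q) =
      Fintype.card {f : Fin s →₀ ℕ | ∀ a, f a ≤ q} :=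
    Module.finrank_eq_card_basis (basisRestrictSupport K _)
  rw [h1]
  refine (Fintype.card_le_of_injective _ hinj).trans ?_
  simp

lemma mem_restrictDegree_iff {s q : ℕ} {f : MvPolynomial (Fin s) K} :
    f ∈ restrictDegree (Fin s) K q ↔ ∀ i, degreeOf i f ≤ q := by
  rw [mem_restrictDegree]
  simp only [degreeOf_le_iff]
  exact ⟨fun h i m hm => h m hm i, fun h m hm i => h i m hm⟩

lemma mul_mem_restrictDegree {s q r : ℕ} {f g : MvPolynomial (Fin s) K}
    (hf : f ∈ restrictDegree (Fin s) K q) (hg : g ∈ restrictDegree (Fin s) K r) :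
    f * g ∈ restrictDegree (Fin s) K (q + r) := by
  rw [mem_restrictDegree_iff] at *
  exact fun i => (degreeOf_mul_le i f g).trans (add_le_add (hf i) (hg i))

lemma exists_mem_restrictDegree {s : ℕ} {ι : Type*} [Finite ι] (f : ι → MvPolynomial (Fin s) K) :
    ∃ D, ∀ i, f i ∈ restrictDegree (Fin s) K D := by
  have := Fintype.ofFinite ι
  refine ⟨∑ i, (f i).totalDegree, fun i => mem_restrictDegree_iff.mpr fun k =>
    (degreeOf_le_totalDegree _ _).trans ?_⟩
  exact Finset.single_le_sum (f := fun i => (f i).totalDegree) (fun _ _ => Nat.zero_le _)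
    (Finset.mem_univ i)

/-- A finite algebra over a polynomial ring in `s` variables has growth at most `s`. -/
lemma exists_growth_of_finite {R : Type*} [CommRing R] [Algebra K R] {s : ℕ}
    (g : MvPolynomial (Fin s) K →ₐ[K] R) (hg : g.Finite) (x : Fin n → R) :
    ∃ N D : ℕ, ∀ j : ℕ, ∃ T : Submodule K R, Module.Finite K T ∧
      Module.finrank K T ≤ N * (D * (j + 1) + 1) ^ s ∧
      ∀ f : MvPolynomial (Fin n) K, f.totalDegree ≤ j → aeval x f ∈ T := by
  obtain ⟨N, m, hm⟩ : ∃ (N : ℕ) (m : Fin N → R), ∀ r : R, ∃ f : Fin N → MvPolynomial (Fin s) K,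
      ∑ l, g (f l) * m l = r := by
    let := g.toRingHom.toAlgebra
    have hfin : Module.Finite (MvPolynomial (Fin s) K) R := hg
    obtain ⟨N, m, hm⟩ := Module.Finite.exists_fin (R := MvPolynomial (Fin s) K) (M := R)
    refine ⟨N, m, fun r => ?_⟩
    have h1 : r ∈ Submodule.span (MvPolynomial (Fin s) K) (Set.range m) := hm ▸ trivial
    obtain ⟨f, hf⟩ := (Submodule.mem_span_range_iff_exists_fun _).mp h1
    refine ⟨f, ?_⟩
    rw [← hf]
    exact Finset.sum_congr rfl fun l _ => (Algebra.smul_def _ _).symm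
  choose e he using hm
  -- `D` bounds the degrees of the coefficients of 1 (the case `none`) and of all products `x i * m
  -- k` in terms of the module generators `m`.
  obtain ⟨D, hD⟩ := exists_mem_restrictDegree (K := K) (s := s)
    (fun q : Option (Fin n × Fin N) × Fin N =>
      e (q.1.elim 1 fun ik => x ik.1 * m ik.2) q.2)
  let φ : ∀ q, (Fin N → restrictDegree (Fin s) K q) →ₗ[K] R := fun q =>
    ∑ l, (LinearMap.mulRight K (m l)) ∘ₗ g.toLinearMap ∘ₗ
      (restrictDegree (Fin s) K q).subtype ∘ₗ LinearMap.proj l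
  have hφ : ∀ q v, φ q v = ∑ l, g (v l) * m l := fun q v => by
    simp [φ, LinearMap.sum_apply]
  have hmemφ : ∀ q r, (∃ f : Fin N → MvPolynomial (Fin s) K,
      (∀ l, f l ∈ restrictDegree (Fin s) K q) ∧ ∑ l, g (f l) * m l = r) →
      r ∈ LinearMap.range (φ q) := by
    rintro q r ⟨f, hf, rfl⟩
    exact ⟨fun l => ⟨f l, hf l⟩, by rw [hφ]⟩
  have hone : (1 : R) ∈ LinearMap.range (φ D) :=
    hmemφ _ _ ⟨e 1, fun l => hD (none, l), he 1⟩
  have hmono : ∀ q q', q ≤ q' → LinearMap.range (φ q) ≤ LinearMap.range (φ q') := by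
    rintro q q' hq _ ⟨v, rfl⟩
    rw [hφ]
    refine hmemφ _ _ ⟨fun l => v l, fun l => ?_, rfl⟩
    have := (v l).2
    rw [mem_restrictDegree_iff] at this ⊢
    exact fun i => (this i).trans hq
  have hstep : ∀ q r (i : Fin n), r ∈ LinearMap.range (φ q) →
      x i * r ∈ LinearMap.range (φ (q + D)) := by
    rintro q _ i ⟨v, rfl⟩
    refine hmemφ _ _ ⟨fun l => ∑ k, v k * e (x i * m k) l, fun l => ?_, ?_⟩
    · exact Submodule.sum_mem _ fun k _ =>
        mul_mem_restrictDegree (v k).2 (hD (some (i, k), l))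
    · rw [hφ, Finset.mul_sum]
      simp only [map_sum, map_mul, Finset.sum_mul]
      rw [Finset.sum_comm]
      refine Finset.sum_congr rfl fun k _ => ?_
      rw [mul_left_comm, ← he (x i * m k), Finset.mul_sum]
      exact Finset.sum_congr rfl fun l _ => by rw [mul_assoc, he]
  -- Starting from 1, which costs `D`, each variable factor costs another `D`.
  have hmon : ∀ a : Fin n →₀ ℕ, aeval x (monomial a (1 : K)) ∈
      LinearMap.range (φ (D * (a.degree + 1))) := by
    intro a
    induction hd : a.degree generalizing a with
    | zero =>
      rw [Finsupp.degree_eq_zero_iff] at hd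
      subst hd
      have e1 : monomial (0 : Fin n →₀ ℕ) (1 : K) = 1 := rfl
      rw [zero_add, mul_one, e1, map_one]
      exact hone
    | succ d ih =>
      have h0 : a ≠ 0 := by rintro rfl; simp at hd
      obtain ⟨i, hi⟩ := Finsupp.support_nonempty_iff.mpr h0
      have h1 : Finsupp.single i 1 ≤ a := by
        rw [Finsupp.single_le_iff]
        simp at hi; omega
      have h2 : a = Finsupp.single i 1 + (a - Finsupp.single i 1) :=
        (add_tsub_cancel_of_le h1).symm
      have h3 : (a - Finsupp.single i 1).degree = d := by
        have := congrArg Finsupp.degree h2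
        rw [map_add, Finsupp.degree_single] at this
        omega
      have h4 := hstep _ _ i (ih _ h3)
      have h5 : monomial a (1 : K) = X i * monomial (a - Finsupp.single i 1) 1 := by
        rw [X, monomial_mul, ← h2, one_mul]
      rw [h5, map_mul, aeval_X]
      have e1 : D * (d + 1 + 1) = D * (d + 1) + D := by ring
      rw [e1]
      exact h4
  refine ⟨N, D, fun j => ⟨LinearMap.range (φ (D * (j + 1))), inferInstance, ?_, ?_⟩⟩
  · refine (LinearMap.finrank_range_le _).trans ?_
    rw [Module.finrank_pi_fintype, Finset.sum_const, Finset.card_univ, Fintype.card_fin,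
      smul_eq_mul]
    exact Nat.mul_le_mul_left _ (finrank_restrictDegree_le _ _)
  · intro f hf
    rw [f.as_sum, map_sum]
    refine Submodule.sum_mem _ fun a ha => ?_
    have h1 : monomial a (coeff a f) = coeff a f • monomial a (1 : K) := by
      rw [smul_monomial, smul_eq_mul, mul_one]
    rw [h1, map_smul]
    refine Submodule.smul_mem _ _ (hmono _ _ ?_ (hmon a))
    have h2 : a.degree ≤ j := (le_totalDegree ha).trans hf
    gcongr

/-- The number of variables in a Noether normalization of `S/I` is at most `n - ht I`. -/
lemma add_height_le {R : Type*} [CommRing R] {s : ℕ}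
    (g : MvPolynomial (Fin s) K →+* R) (hinj : Function.Injective g) (hg : g.Finite)
    (π : MvPolynomial (Fin n) K →+* R) (hπ : Function.Surjective π) {c : ℕ}
    (hc : (RingHom.ker π).height = c) : s + c ≤ n := by
  let := g.toAlgebra
  have hfin : Module.Finite (MvPolynomial (Fin s) K) R := hg
  have hint : Algebra.IsIntegral (MvPolynomial (Fin s) K) R := inferInstance
  let P : ℕ → Ideal (MvPolynomial (Fin s) K) := fun k =>
    Squarefree.varIdeal K (Finset.univ.filter fun i : Fin s => (i : ℕ) < k)
  -- Going up lifts the flag of coordinate primes to a chain in `R`. Its preimages under `π`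
  -- increase strictly from a prime containing ker π, so the k-th one has height at least k + c.
  have key : ∀ k ≤ s, ∃ Q : Ideal (R), Q.IsPrime ∧
      Q.comap g = P k ∧
      ((k + c : ℕ) : ℕ∞) ≤ (Q.comap (π)).height := by
    intro k
    induction k with
    | zero =>
      intro _
      obtain ⟨Q, -, hQ, hQP⟩ := Ideal.exists_ideal_over_prime_of_isIntegral (P 0)
        (⊥ : Ideal (R)) (by
          have h0 : RingHom.ker g = ⊥ := (RingHom.injective_iff_ker_eq_bot _).mp hinj
          exact h0.trans_le bot_le)
      refine ⟨Q, hQ, hQP, ?_⟩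
      rw [zero_add, ← hc]
      apply Ideal.height_mono
      exact Ideal.ker_le_comap _
    | succ k ih =>
      intro hk
      obtain ⟨Q, hQ, hQP, hQh⟩ := ih (by omega)
      obtain ⟨Q', hle, hQ', hQP'⟩ := Ideal.exists_ideal_over_prime_of_isIntegral (P (k + 1)) Q (by
        refine hQP.trans_le ?_
        refine Squarefree.varIdeal_mono fun i hi => ?_
        simp only [Finset.mem_filter, Finset.mem_univ, true_and] at hi ⊢
        omega)
      refine ⟨Q', hQ', hQP', ?_⟩
      have hlt : Q.comap (π) < Q'.comap (π) := by
        refine lt_of_le_of_ne (Ideal.comap_mono hle) fun h => ?_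
        have h1 : Q = Q' := Ideal.comap_injective_of_surjective _ hπ h
        have h2 : P k = P (k + 1) := by rw [← hQP, h1]; exact hQP'
        have h3 : (X ⟨k, by omega⟩ : MvPolynomial (Fin s) K) ∈ P (k + 1) := by
          simp only [P]
          rw [Squarefree.X_mem_varIdeal]
          simp
        rw [← h2] at h3
        simp only [P] at h3
        rw [Squarefree.X_mem_varIdeal] at h3
        simp at h3
      have h1 := Ideal.height_add_one_le_of_lt_of_isPrime hlt
      refine le_trans ?_ h1
      have h2 : ((k + 1 + c : ℕ) : ℕ∞) = ((k + c : ℕ) : ℕ∞) + 1 := by push_cast; ring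
      rw [h2]
      exact add_le_add_left hQh 1
  obtain ⟨Q, hQ, -, hQh⟩ := key s le_rfl
  have hp : (Q.comap (π)).IsPrime := inferInstance
  have h1 := Ideal.height_le_ringKrullDim_of_ne_top hp.ne_top
  rw [MvPolynomial.ringKrullDim_of_isNoetherianRing, ringKrullDim_eq_zero_of_field, zero_add,
    Nat.card_eq_fintype_card, Fintype.card_fin] at h1
  have h2 : (Q.comap (π)).height ≤ (n : ℕ∞) := by exact_mod_cast h1
  exact_mod_cast hQh.trans h2

/-- The sums of the Hilbert function of `S/I` are bounded by a polynomial of degree `n - ht I`. -/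
theorem exists_sum_coeff_le {I : Ideal (MvPolynomial (Fin n) K)} (hI : IsGradedIdeal I)
    (hI1 : I ≠ ⊤) {c : ℕ} (hc : I.height = c) :
    c ≤ n ∧ ∃ N D : ℕ, ∀ j, ∑ i ∈ Finset.range (j + 1), PowerSeries.coeff i (hilbertSeries I) ≤
      ((N * (D * (j + 1) + 1) ^ (n - c) : ℕ) : ℤ) := by
  have hnt : Nontrivial (MvPolynomial (Fin n) K ⧸ I) := Ideal.Quotient.nontrivial_iff.mpr hI1
  obtain ⟨s, g, hinj, hg⟩ := exists_finite_inj_algHom_of_fg K (MvPolynomial (Fin n) K ⧸ I)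
  have hs := add_height_le g.toRingHom hinj hg (Ideal.Quotient.mk I) Ideal.Quotient.mk_surjective
    (by rw [Ideal.mk_ker]; exact hc)
  obtain ⟨N, D, h⟩ := exists_growth_of_finite g hg fun i => Ideal.Quotient.mk I (X i)
  refine ⟨by omega, N, D, fun j => ?_⟩
  obtain ⟨T, hT, hTr, hTm⟩ := h j
  have haeval : ∀ f : MvPolynomial (Fin n) K,
      aeval (fun i => Ideal.Quotient.mk I (X i)) f = Ideal.Quotient.mk I f := by
    intro f
    have : aeval (fun i => Ideal.Quotient.mk I (X i)) = Ideal.Quotient.mkₐ K I := by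
      ext i; simp
    rw [this]; rfl
  let W : Fin (j + 1) → Submodule K (MvPolynomial (Fin n) K ⧸ I) := fun i =>
    (homogeneousSubmodule (Fin n) K i).map (Ideal.Quotient.mkₐ K I).toLinearMap
  let ψ : (∀ i, W i) →ₗ[K] (MvPolynomial (Fin n) K ⧸ I) :=
    ∑ i, (W i).subtype ∘ₗ LinearMap.proj i
  have hψ : ∀ w, ψ w = ∑ i, (w i : MvPolynomial (Fin n) K ⧸ I) := fun w => by
    simp [ψ, LinearMap.sum_apply]
  have hψT : ∀ w, ψ w ∈ T := by
    intro w
    rw [hψ]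
    refine Submodule.sum_mem _ fun i _ => ?_
    obtain ⟨f, hf, hfw⟩ := (w i).2
    rw [← hfw]
    have h1 := hTm f ((((mem_homogeneousSubmodule _ _).mp hf).totalDegree_le).trans
      (Nat.lt_succ_iff.mp i.2))
    rwa [haeval] at h1
  -- `I` is graded, so the components of S/I in degrees at most `j` are independent and their direct
  -- sum embeds in `T`.
  have hψi : Function.Injective (ψ.codRestrict T hψT) := by
    rw [← LinearMap.ker_eq_bot, LinearMap.ker_codRestrict, LinearMap.ker_eq_bot']
    intro w hw
    rw [hψ] at hw
    choose f hf hfw using fun i => (w i).2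
    have h1 : ∑ i, f i ∈ I := by
      rw [← Ideal.Quotient.eq_zero_iff_mem, map_sum, ← hw]
      exact Finset.sum_congr rfl fun i _ => hfw i
    funext i
    have h2 := hI _ h1 i
    rw [map_sum, Finset.sum_eq_single i] at h2
    · rw [homogeneousComponent_eq_self ((mem_homogeneousSubmodule _ _).mp (hf i))] at h2
      apply Subtype.ext
      rw [← hfw i]
      exact Ideal.Quotient.eq_zero_iff_mem.mpr h2
    · intro k _ hk
      rw [homogeneousComponent_of_mem (hf k), if_neg]
      exact fun h => hk (Fin.ext h.symm)
    · simp
  have hle := (LinearMap.finrank_le_finrank_of_injective hψi).trans hTr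
  rw [Module.finrank_pi_fintype] at hle
  have h3 : ∑ i ∈ Finset.range (j + 1), PowerSeries.coeff i (hilbertSeries I) =
      ((∑ i, Module.finrank K (W i) : ℕ) : ℤ) := by
    rw [Finset.sum_range]
    push_cast
    exact Finset.sum_congr rfl fun i _ => by simp [hilbertSeries, W]
  rw [h3]
  refine Int.ofNat_le.mpr (hle.trans ?_)
  refine Nat.mul_le_mul_left _ (Nat.pow_le_pow_right (Nat.succ_pos _) (by omega))

end Growth

/-! ### Bounding the pole of the Hilbert series -/

section Rationality

lemma one_sub_X_ne_zero : (1 - PowerSeries.X : PowerSeries ℤ) ≠ 0 := by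
  intro h
  have := congrArg (PowerSeries.coeff 0) h
  simp at this

lemma coe_one_sub_X_pow (k : ℕ) :
    (((1 - Polynomial.X : Polynomial ℤ) ^ k : Polynomial ℤ) : PowerSeries ℤ) =
      (1 - PowerSeries.X) ^ k := by
  rw [Polynomial.coe_pow, Polynomial.coe_sub, Polynomial.coe_one, Polynomial.coe_X]

/-- The partial sums of the coefficients of `Q / (1 - X) ^ n` grow like a polynomial of degree
`n - m`, where `m` is the multiplicity of the root `1` of `Q`. -/
lemma sum_coeff_eq_eval_hilbertPoly {H : PowerSeries ℤ} {n : ℕ} {Q : Polynomial ℤ}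
    (hQ : H * (1 - PowerSeries.X : PowerSeries ℤ) ^ n = (Q : PowerSeries ℤ)) {j : ℕ} (hj : Q.natDegree < j) :
    ((∑ i ∈ Finset.range (j + 1), PowerSeries.coeff i H : ℤ) : ℝ) =
      ((Q.map (Int.castRingHom ℝ)).hilbertPoly (n + 1)).eval (j : ℝ) := by
  have hj' : (Q.map (Int.castRingHom ℝ)).natDegree < j :=
    Polynomial.natDegree_map_le.trans_lt hj
  rw [← Polynomial.coeff_mul_invOneSubPow_eq_hilbertPoly_eval _ hj']
  have h1 : ((Q.map (Int.castRingHom ℝ) : Polynomial ℝ) : PowerSeries ℝ) =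
      PowerSeries.map (Int.castRingHom ℝ) H * (1 - PowerSeries.X) ^ n := by
    rw [Polynomial.polynomial_map_coe, ← hQ]
    simp
  rw [h1, mul_assoc, add_comm n 1,
    PowerSeries.one_sub_pow_mul_invOneSubPow_val_add_eq_invOneSubPow_val,
    PowerSeries.invOneSubPow_val_succ_eq_mk_add_choose, PowerSeries.coeff_mul,
    Finset.Nat.sum_antidiagonal_eq_sum_range_succ_mk]
  push_cast
  refine Finset.sum_congr rfl fun i _ => ?_
  simp

open Filter Topology in
/-- If the partial sums of the coefficients of a rational function with a pole at `1` grow at most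
like a polynomial of degree `s`, then the pole has order at most `s`. -/
lemma exists_mul_one_sub_pow_eq {H : PowerSeries ℤ} {n s : ℕ} (hs : s ≤ n) {Q : Polynomial ℤ}
    (hQ : H * (1 - PowerSeries.X : PowerSeries ℤ) ^ n = (Q : PowerSeries ℤ)) (hH : ∀ i, 0 ≤ PowerSeries.coeff i H) {N D : ℕ}
    (hN : ∀ j, ∑ i ∈ Finset.range (j + 1), PowerSeries.coeff i H ≤
      ((N * (D * (j + 1) + 1) ^ s : ℕ) : ℤ)) :
    ∃ P : Polynomial ℤ, H * (1 - PowerSeries.X : PowerSeries ℤ) ^ s = (P : PowerSeries ℤ) := by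
  rcases eq_or_ne Q 0 with rfl | hQ0
  · refine ⟨0, ?_⟩
    rw [Polynomial.coe_zero, mul_eq_zero, or_iff_left (pow_ne_zero _ one_sub_X_ne_zero)] at hQ
    rw [hQ, zero_mul, Polynomial.coe_zero]
  -- If 1 is a root of sufficient multiplicity, the surplus factors cancel.
  by_cases hm : n - s ≤ Q.rootMultiplicity 1
  · have h1 : (1 - Polynomial.X : Polynomial ℤ) ^ (n - s) ∣ Q := by
      have h2 := (pow_dvd_pow _ hm).trans (Polynomial.pow_rootMultiplicity_dvd Q 1)
      rw [map_one] at h2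
      refine (pow_dvd_pow_of_dvd ?_ _).trans h2
      exact ⟨-1, by ring⟩
    obtain ⟨P, rfl⟩ := h1
    refine ⟨P, mul_right_cancel₀ (pow_ne_zero (n - s) one_sub_X_ne_zero) ?_⟩
    rw [mul_assoc, ← pow_add, Nat.add_sub_cancel' hs, hQ, Polynomial.coe_mul, coe_one_sub_X_pow,
      mul_comm]
  -- Otherwise the partial sums eventually agree with a polynomial of degree n minus the
  -- multiplicity, which exceeds s and outgrows the bound `B`. The index n + 1 of `hilbertPoly`
  -- reflects the extra factor 1/(1-X) from summation.
  exfalso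
  push Not at hm
  set P := (Q.map (Int.castRingHom ℝ)).hilbertPoly (n + 1) with hP
  have hinj : Function.Injective (Int.castRingHom ℝ) := Int.cast_injective
  have hroot : (Q.map (Int.castRingHom ℝ)).rootMultiplicity 1 = Q.rootMultiplicity 1 := by
    rw [Polynomial.eq_rootMultiplicity_map hinj, map_one]
  have hdeg : s < P.natDegree := by
    rw [hP, Polynomial.natDegree_hilbertPoly_of_ne_zero_of_rootMultiplicity_lt, hroot]
    · omega
    · exact (Polynomial.map_ne_zero_iff hinj).mpr hQ0
    · omega
  let B : Polynomial ℝ := Polynomial.C (N : ℝ) *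
    (Polynomial.C (D : ℝ) * (Polynomial.X + 1) + 1) ^ s
  have hB : B.natDegree ≤ s := by
    refine (Polynomial.natDegree_C_mul_le _ _).trans (Polynomial.natDegree_pow_le.trans ?_)
    refine (Nat.mul_le_mul_left s (?_ : _ ≤ 1)).trans_eq (mul_one s)
    compute_degree
  have hBP : B.degree < P.degree := Polynomial.degree_lt_degree (hB.trans_lt hdeg)
  have hP0 : 0 < P.degree := Polynomial.natDegree_pos_iff_degree_pos.mp (by omega)
  have h1 := (B.div_tendsto_atTop_zero_of_degree_lt P hBP).comp tendsto_natCast_atTop_atTop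
  have h2 := (P.abs_tendsto_atTop hP0).comp tendsto_natCast_atTop_atTop
  obtain ⟨j, hj1, hj2, hj3⟩ := ((h1.eventually (gt_mem_nhds one_pos)).and
    ((h2.eventually_ge_atTop 1).and (eventually_gt_atTop Q.natDegree))).exists
  simp only [Function.comp_apply] at hj1 hj2
  have h3 := sum_coeff_eq_eval_hilbertPoly hQ hj3
  rw [← hP] at h3
  have h4 : 0 ≤ P.eval (j : ℝ) := by
    rw [← h3]
    exact_mod_cast Finset.sum_nonneg fun i _ => hH i
  rw [abs_of_nonneg h4] at hj2
  have h5 : P.eval (j : ℝ) ≤ B.eval (j : ℝ) := by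
    rw [← h3]
    have h6 : B.eval (j : ℝ) = (((N * (D * (j + 1) + 1) ^ s : ℕ) : ℤ) : ℝ) := by
      simp [B]
    rw [h6]
    exact_mod_cast hN j
  rw [div_lt_one (by linarith)] at hj1
  linarith

/-- The Hilbert series of `S/I` has a pole at `1` of order at most `n - ht I`. -/
theorem exists_hilbertSeriesEq {K : Type*} [Field K] {n : ℕ} {I : Ideal (MvPolynomial (Fin n) K)}
    (hI : IsGradedIdeal I) (hI1 : I ≠ ⊤) {c : ℕ} (hc : I.height = c) :
    c ≤ n ∧ ∃ N : Polynomial ℤ, HilbertSeriesEq I N (n - c) := by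
  obtain ⟨hcn, N, D, h⟩ := exists_sum_coeff_le hI hI1 hc
  obtain ⟨Q, hQ⟩ := exists_polynomial hI
  exact ⟨hcn, exists_mul_one_sub_pow_eq (Nat.sub_le _ _) hQ (fun i => by simp [hilbertSeries]) h⟩

end Rationality

end Hilbert

namespace Squarefree

/-! ### Face polynomials and Alexander duality -/

section HilbertSeries

variable {K : Type*} [Field K] {n : ℕ}

open Hilbert

open Classical in
lemma gradedDim_eq_card {I : Ideal (MvPolynomial (Fin n) K)} (hI : IsSquarefreeMonomialIdeal I)
    (j : ℕ) : gradedDim I j = ((Finset.univ.finsuppAntidiag j).filter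
      fun a : Fin n →₀ ℕ => sqfreeMonomial K a.support ∈ I).card := by
  have hdeg : ∀ a : Fin n →₀ ℕ, a ∈ Finset.univ.finsuppAntidiag j ↔ a.degree = j := fun a => by
    simp [Finset.mem_finsuppAntidiag, Finsupp.degree_eq_sum]
  have h : homogeneousSubmodule (Fin n) K j ⊓ I.restrictScalars K =
      restrictSupport K {a | a ∈ (Finset.univ.finsuppAntidiag j).filter
        fun a : Fin n →₀ ℕ => sqfreeMonomial K a.support ∈ I} := by
    ext f
    rw [mem_restrictSupport_iff, Submodule.mem_inf, mem_homogeneousSubmodule,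
      Submodule.restrictScalars_mem, mem_iff hI]
    constructor
    · rintro ⟨h1, h2⟩ a ha
      have ha' := mem_support_iff.mp ha
      refine Finset.mem_filter.mpr ⟨(hdeg a).mpr ?_, h2 a ha'⟩
      rw [Finsupp.degree_eq_weight_one]
      exact h1 ha'
    · intro h1
      refine ⟨fun a ha => ?_, fun a ha => ?_⟩
      · have := (hdeg a).mp (Finset.mem_filter.mp (h1 (mem_support_iff.mpr ha))).1
        rwa [Finsupp.degree_eq_weight_one] at this
      · exact (Finset.mem_filter.mp (h1 (mem_support_iff.mpr ha))).2
  rw [gradedDim, h, Module.finrank_eq_nat_card_basis (basisRestrictSupport K _)]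
  exact Nat.card_eq_card_toFinset _ |>.trans (by simp)

lemma isSquarefreeMonomialIdeal_top :
    IsSquarefreeMonomialIdeal (⊤ : Ideal (MvPolynomial (Fin n) K)) := by
  refine ⟨{∅}, ?_⟩
  rw [Set.image_singleton, sqfreeMonomial, Finset.prod_empty]
  exact Ideal.span_singleton_one.symm

open Classical in
lemma coeff_hilbertSeries {I : Ideal (MvPolynomial (Fin n) K)} (hI : IsSquarefreeMonomialIdeal I)
    (j : ℕ) : PowerSeries.coeff j (hilbertSeries I) = (((Finset.univ.finsuppAntidiag j).filter
      fun a : Fin n →₀ ℕ => sqfreeMonomial K a.support ∉ I).card : ℤ) := by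
  rw [hilbertSeries_eq, map_sub, idealSeries, idealSeries, PowerSeries.coeff_mk,
    PowerSeries.coeff_mk, gradedDim_eq_card isSquarefreeMonomialIdeal_top, gradedDim_eq_card hI]
  have h := Finset.card_filter_add_card_filter_not (s := Finset.univ.finsuppAntidiag j)
    (fun a : Fin n →₀ ℕ => sqfreeMonomial K a.support ∈ I)
  have h1 : (Finset.univ.finsuppAntidiag j).filter (fun a : Fin n →₀ ℕ =>
      sqfreeMonomial K a.support ∈ (⊤ : Ideal (MvPolynomial (Fin n) K))) =
      Finset.univ.finsuppAntidiag j := Finset.filter_true_of_mem fun _ _ => trivial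
  rw [h1]
  omega

/-- The series counting the monomials whose support is a given set. -/
noncomputable def supportSeries (F : Finset (Fin n)) : PowerSeries ℤ :=
  ∏ i, if i ∈ F then PowerSeries.X * PowerSeries.mk 1 else 1

lemma coeff_supportSeries (F : Finset (Fin n)) (j : ℕ) :
    PowerSeries.coeff j (supportSeries F) =
      ∑ a ∈ (Finset.univ : Finset (Fin n)).finsuppAntidiag j, if a.support = F then 1 else 0 := by
  rw [supportSeries, PowerSeries.coeff_prod]
  refine Finset.sum_congr rfl fun a _ => ?_
  have h : ∀ i ∈ Finset.univ, PowerSeries.coeff (a i)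
      (if i ∈ F then PowerSeries.X * PowerSeries.mk 1 else 1 : PowerSeries ℤ) =
      if (i ∈ a.support ↔ i ∈ F) then 1 else 0 := by
    intro i _
    simp only [Finsupp.mem_support_iff]
    by_cases hi : i ∈ F <;> cases h0 : a i <;>
      simp [hi, PowerSeries.coeff_succ_X_mul, PowerSeries.coeff_one]
  rw [Finset.prod_congr rfl h, Finset.prod_boole]
  simp [Finset.ext_iff]

lemma supportSeries_mul_pow (F : Finset (Fin n)) :
    supportSeries F * (1 - PowerSeries.X) ^ n =
      PowerSeries.X ^ F.card * (1 - PowerSeries.X) ^ (n - F.card) := by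
  have h1 : (1 - PowerSeries.X : PowerSeries ℤ) ^ n = ∏ _i : Fin n, (1 - PowerSeries.X) := by
    simp
  have h2 : ∀ i : Fin n, (if i ∈ F then PowerSeries.X * PowerSeries.mk 1 else 1 : PowerSeries ℤ) *
      (1 - PowerSeries.X) = if i ∈ F then PowerSeries.X else 1 - PowerSeries.X := by
    intro i
    split_ifs
    · rw [mul_assoc, PowerSeries.mk_one_mul_one_sub_eq_one, mul_one]
    · rw [one_mul]
  rw [h1, supportSeries, ← Finset.prod_mul_distrib, Finset.prod_congr rfl fun i _ => h2 i,
    Finset.prod_ite, Finset.prod_const, Finset.prod_const, Finset.filter_not,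
    Finset.filter_mem_eq_inter, Finset.univ_inter, Finset.card_sdiff_of_subset (Finset.subset_univ F),
    Finset.card_univ, Fintype.card_fin]

open Classical in
/-- The polynomial `∑ t^|F| (1 - t)^(n - |F|)`, summed over the faces of the simplicial complex with
Stanley-Reisner ideal `I`. -/
noncomputable def facePolynomial (I : Ideal (MvPolynomial (Fin n) K)) : Polynomial ℤ :=
  ∑ F ∈ Finset.univ.filter fun F : Finset (Fin n) => sqfreeMonomial K F ∉ I,
    Polynomial.X ^ F.card * (1 - Polynomial.X) ^ (n - F.card)

/-- Monomials outside `I` are grouped by support, which ranges over the faces; each face `F`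
contributes (t/(1-t))^|F|. -/
theorem hilbertSeriesEq_facePolynomial {I : Ideal (MvPolynomial (Fin n) K)}
    (hI : IsSquarefreeMonomialIdeal I) : HilbertSeriesEq I (facePolynomial I) n := by
  classical
  have h : hilbertSeries I =
      ∑ F ∈ Finset.univ.filter fun F : Finset (Fin n) => sqfreeMonomial K F ∉ I,
        supportSeries F := by
    ext j
    rw [coeff_hilbertSeries hI, map_sum, Finset.sum_congr rfl fun F _ => coeff_supportSeries F j,
      Finset.sum_comm, Finset.card_filter]
    push_cast
    refine Finset.sum_congr rfl fun a _ => ?_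
    rw [Finset.sum_ite_eq]
    simp
  rw [HilbertSeriesEq, h, Finset.sum_mul, Finset.sum_congr rfl fun F _ => supportSeries_mul_pow F,
    facePolynomial, ← Polynomial.coeToPowerSeries.ringHom_apply, map_sum]
  refine Finset.sum_congr rfl fun F _ => ?_
  rw [Polynomial.coeToPowerSeries.ringHom_apply, Polynomial.coe_mul, coe_one_sub_X_pow,
    Polynomial.coe_pow, Polynomial.coe_X]

/-- Face polynomials of Alexander dual complexes. -/
lemma facePolynomial_alexanderDual (I : Ideal (MvPolynomial (Fin n) K)) :
    facePolynomial (alexanderDual I) = 1 - (facePolynomial I).comp (1 - Polynomial.X) := by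
  classical
  -- The sum over all subsets is (t + (1-t))^n = 1. It is split according to whether the complement
  -- is a face; complementation exchanges t and 1-t.
  have h1 := Fintype.sum_pow_mul_eq_add_pow (Fin n) (Polynomial.X : Polynomial ℤ)
    (1 - Polynomial.X)
  rw [add_sub_cancel, one_pow, Fintype.card_fin,
    ← Finset.sum_filter_add_sum_filter_not _ fun F : Finset (Fin n) => sqfreeMonomial K Fᶜ ∉ I]
    at h1
  refine eq_sub_iff_add_eq'.mpr (Eq.trans ?_ h1)
  congr 1
  · simp only [facePolynomial, Polynomial.sum_comp, Polynomial.mul_comp,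
      Polynomial.pow_comp, Polynomial.X_comp, Polynomial.sub_comp, Polynomial.one_comp,
      sub_sub_cancel]
    refine Finset.sum_nbij' compl compl ?_ ?_ (fun _ _ => compl_compl _) (fun _ _ => compl_compl _)
      fun F _ => ?_
    · intro F; simp
    · intro F; simp
    · have := F.card_le_univ
      rw [Fintype.card_fin] at this
      rw [Finset.card_compl, Fintype.card_fin, Nat.sub_sub_self this, mul_comm]
  · simp only [facePolynomial, sqfreeMonomial_mem_alexanderDual]

end HilbertSeries

end Squarefree

namespace Hilbert

/-! ### The polynomials h(c,p) and the tail of a numerator -/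

section Numerics

lemma hPoly_succ (c p : ℕ) : hPoly c (p + 1) =
    hPoly c p + Polynomial.C (((c + p - 1).choose p : ℕ) : ℤ) * Polynomial.X ^ p := by
  rw [hPoly, Finset.sum_range_succ, ← hPoly, Polynomial.C_mul_X_pow_eq_monomial]

/-- Boundary value starting the induction for the Bezout identity. With truncated subtraction,
binom(0+i-1, i) is 1 for i = 0 and 0 for i ≥ 1. -/
lemma hPoly_zero_succ (c : ℕ) : hPoly 0 (c + 1) = 1 := by
  rw [hPoly, Finset.sum_range_succ', Finset.sum_eq_zero]
  · simp
  · intro i _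
    simp

/-- As h(c,p) truncates (1-t)^(-c), multiplication by 1-t lowers c by one and leaves a boundary term
at the truncation degree; Pascal's rule proves it. -/
lemma one_sub_X_mul_hPoly (c p : ℕ) : (1 - Polynomial.X) * hPoly (c + 1) (p + 1) =
    hPoly c (p + 1) - Polynomial.C (((c + p).choose p : ℕ) : ℤ) * Polynomial.X ^ (p + 1) := by
  induction p with
  | zero => simp [hPoly]
  | succ p ih =>
    rw [hPoly_succ (c + 1), hPoly_succ c (p + 1), mul_add, ih]
    have h : (c + (p + 1)).choose (p + 1) = (c + p).choose p + (c + p).choose (p + 1) :=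
      Nat.choose_succ_succ _ _
    have h1 : c + 1 + (p + 1) - 1 = c + (p + 1) := by omega
    have h2 : c + (p + 1) - 1 = c + p := by omega
    rw [h1, h2, h]
    push_cast [map_add]
    ring

/-- The Bezout identity for `(1 - t)^c` and `t^p`. -/
lemma one_sub_X_pow_mul_hPoly (c p : ℕ) :
    (1 - Polynomial.X) ^ (c + 1) * hPoly (c + 1) p +
      Polynomial.X ^ p * (hPoly p (c + 1)).comp (1 - Polynomial.X) = 1 := by
  induction p with
  | zero => rw [hPoly_zero_succ]; simp [hPoly]
  | succ p ih =>
    have h := congrArg (fun f => f.comp (1 - Polynomial.X)) (one_sub_X_mul_hPoly p c)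
    simp only [Polynomial.mul_comp, Polynomial.sub_comp, Polynomial.one_comp, Polynomial.X_comp,
      Polynomial.pow_comp, Polynomial.C_comp, sub_sub_cancel] at h
    have h1 : (c + 1 + p - 1).choose p = (p + c).choose c := by
      rw [show c + 1 + p - 1 = p + c by omega, Nat.choose_symm_add]
    -- The new top term of the first summand cancels the boundary term of the second, obtained from
    -- `one_sub_X_mul_hPoly` by t ↦ 1-t.
    rw [hPoly_succ, h1, pow_succ Polynomial.X, mul_assoc _ Polynomial.X, h]
    refine Eq.trans ?_ ih
    ring

lemma natDegree_hPoly_lt (c p : ℕ) (hp : 0 < p) : (hPoly c p).natDegree < p := by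
  refine (Polynomial.natDegree_sum_le_of_forall_le _ _ (n := p - 1) fun i hi => ?_).trans_lt
    (Nat.sub_lt hp one_pos)
  refine (Polynomial.natDegree_monomial_le _).trans ?_
  have := Finset.mem_range.mp hi
  omega

/-- The polynomial `∑ s_{δ-i} t^{i-1}`. -/
noncomputable def tail {δ : ℕ} (s : Fin δ → ℤ) : Polynomial ℤ :=
  ∑ i : Fin δ, Polynomial.C (s i.rev) * Polynomial.X ^ (i : ℕ)

lemma comp_one_sub_X_comp (f : Polynomial ℤ) :
    (f.comp (1 - Polynomial.X)).comp (1 - Polynomial.X) = f := by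
  rw [Polynomial.comp_assoc]
  simp

lemma numerator_eq (c p : ℕ) {δ : ℕ} (s : Fin δ → ℤ) :
    numerator c p s = hPoly c p - Polynomial.X ^ p * (tail s).comp (1 - Polynomial.X) := by
  rw [numerator, tail, Polynomial.sum_comp]
  simp

lemma dualNumerator_eq (c p : ℕ) {δ : ℕ} (s : Fin δ → ℤ) :
    dualNumerator c p s = hPoly p c + Polynomial.X ^ c * tail s := rfl

lemma coeff_tail {δ : ℕ} (s : Fin δ → ℤ) (k : ℕ) :
    (tail s).coeff k = if h : k < δ then s (Fin.rev ⟨k, h⟩) else 0 := by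
  simp only [tail, Polynomial.finsetSum_coeff, Polynomial.coeff_C_mul_X_pow]
  split_ifs with h
  · rw [Finset.sum_eq_single ⟨k, h⟩]
    · simp
    · intro i _ hi
      rw [if_neg]
      exact fun h1 => hi (Fin.ext h1.symm)
    · simp
  · refine Finset.sum_eq_zero fun i _ => if_neg ?_
    have := i.2
    omega

lemma tail_injective {δ : ℕ} : Function.Injective (tail : (Fin δ → ℤ) → Polynomial ℤ) := by
  intro s s' h
  funext i
  have h1 := congrArg (fun f => f.coeff (i.rev : ℕ)) h
  simpa only [coeff_tail, dif_pos i.rev.2, Fin.eta, Fin.rev_rev] using h1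

/-- Turns the length of the sequence into a degree bound, which is how `delta` is analysed. -/
lemma exists_tail_eq {R : Polynomial ℤ} {δ : ℕ} :
    (∃ s : Fin δ → ℤ, tail s = R) ↔ ∀ k, δ ≤ k → R.coeff k = 0 := by
  constructor
  · rintro ⟨s, rfl⟩ k hk
    rw [coeff_tail, dif_neg (by omega)]
  · intro h
    refine ⟨fun i => R.coeff i.rev, Polynomial.ext fun k => ?_⟩
    rw [coeff_tail]
    split_ifs with hk
    · simp
    · exact (h k (by omega)).symm

end Numerics

/-! ### The remainder polynomial and the meaning of `delta` -/

section Remainder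

variable {K : Type*} [Field K] {n : ℕ} {I : Ideal (MvPolynomial (Fin n) K)}

lemma isUnit_one_sub_X : IsUnit (1 - PowerSeries.X : PowerSeries ℤ) :=
  IsUnit.of_mul_eq_one_right _ (PowerSeries.mk_one_mul_one_sub_eq_one ℤ)

lemma _root_.LinearIdeals.HilbertSeriesEq.eq {N N' : Polynomial ℤ} {e : ℕ}
    (h : HilbertSeriesEq I N e) (h' : HilbertSeriesEq I N' e) : N = N' :=
  Polynomial.coe_injective ℤ (h.symm.trans h')

lemma one_le_of_height_eq {c : ℕ} (hI : I ≠ ⊥) (hc : I.height = c) : 1 ≤ c := by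
  by_contra h
  have h0 : c = 0 := by omega
  subst h0
  exact hI (Ideal.height_eq_zero_iff_eq_bot.mp hc)

lemma hilbertSeries_bot_mul :
    hilbertSeries (⊥ : Ideal (MvPolynomial (Fin n) K)) * (1 - PowerSeries.X) ^ n = 1 := by
  classical
  have hbot : Squarefree.facePolynomial (⊥ : Ideal (MvPolynomial (Fin n) K)) = 1 := by
    have h1 := Fintype.sum_pow_mul_eq_add_pow (Fin n) (Polynomial.X : Polynomial ℤ)
      (1 - Polynomial.X)
    rw [add_sub_cancel, one_pow, Fintype.card_fin] at h1
    rw [Squarefree.facePolynomial, Finset.filter_true_of_mem, h1]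
    intro F _ hF
    rw [Squarefree.sqfreeMonomial_eq] at hF
    simp at hF
  have h := Squarefree.hilbertSeriesEq_facePolynomial (K := K) (n := n) (I := ⊥) ⟨∅, by simp⟩
  rw [HilbertSeriesEq, hbot, Polynomial.coe_one] at h
  exact h

lemma X_pow_dvd_hilbertSeries_sub {p : ℕ} (hp : IsLeastGeneratorDegree I p) :
    PowerSeries.X ^ p ∣ hilbertSeries (⊥ : Ideal (MvPolynomial (Fin n) K)) - hilbertSeries I := by
  rw [PowerSeries.X_pow_dvd_iff]
  intro m hm
  have h : gradedDim I m = gradedDim (⊥ : Ideal (MvPolynomial (Fin n) K)) m := by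
    refine gradedDim_congr fun f hf => ⟨fun hfI => ?_, fun h => ?_⟩
    · rw [Ideal.mem_bot]
      ext a
      rw [coeff_zero]
      by_cases ha : a.degree = m
      · exact hp.coeff_eq_zero hfI (by omega)
      · exact hf.coeff_eq_zero ha
    · rw [(Ideal.mem_bot).mp h]
      exact I.zero_mem
  simp [hilbertSeries_eq, idealSeries, h]

/-- The numerator of the Hilbert series is congruent to `h(c,p)` modulo `t^p`. -/
theorem exists_remainder (hI : IsGradedIdeal I) (hI0 : I ≠ ⊥) (hI1 : I ≠ ⊤) {c p : ℕ}
    (hc : I.height = c) (hp : IsLeastGeneratorDegree I p) :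
    ∃ R : Polynomial ℤ, HilbertSeriesEq I
      (hPoly c p - Polynomial.X ^ p * R.comp (1 - Polynomial.X)) (n - c) := by
  obtain ⟨hcn, N, hN⟩ := exists_hilbertSeriesEq hI hI1 hc
  have hc1 := one_le_of_height_eq hI0 hc
  -- The series of S/I and of S agree below degree p; multiply by (1-t)^n.
  have h1 : PowerSeries.X ^ p ∣ (1 - (1 - PowerSeries.X) ^ c * (N : PowerSeries ℤ)) := by
    have h2 := (X_pow_dvd_hilbertSeries_sub hp).mul_right ((1 - PowerSeries.X) ^ n)
    rw [sub_mul, hilbertSeries_bot_mul] at h2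
    have h3 : (1 - PowerSeries.X : PowerSeries ℤ) ^ n =
        (1 - PowerSeries.X) ^ (n - c) * (1 - PowerSeries.X) ^ c := by
      rw [← pow_add, Nat.sub_add_cancel hcn]
    rw [h3, ← mul_assoc, hN, mul_comm (N : PowerSeries ℤ)] at h2
    exact h2
  -- The Bezout identity gives the same congruence for h(c,p), so the unit (1-t)^c can be cancelled
  -- in the difference.
  have h2 : PowerSeries.X ^ p ∣ (1 - (1 - PowerSeries.X) ^ c * (hPoly c p : PowerSeries ℤ)) := by
    obtain ⟨c, rfl⟩ := Nat.exists_eq_add_of_le' hc1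
    have h3 := congrArg (fun f : Polynomial ℤ => (f : PowerSeries ℤ)) (one_sub_X_pow_mul_hPoly c p)
    simp only [Polynomial.coe_add, Polynomial.coe_mul, Polynomial.coe_pow, Polynomial.coe_sub,
      Polynomial.coe_X, Polynomial.coe_one] at h3
    exact ⟨_, sub_eq_of_eq_add' h3.symm⟩
  have h3 : PowerSeries.X ^ p ∣ ((hPoly c p - N : Polynomial ℤ) : PowerSeries ℤ) := by
    rw [← (isUnit_one_sub_X.pow c).dvd_mul_left, Polynomial.coe_sub]
    have h4 := dvd_sub h1 h2
    rwa [sub_sub_sub_cancel_left, ← mul_sub] at h4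
  have h4 : Polynomial.X ^ p ∣ hPoly c p - N := by
    rw [Polynomial.X_pow_dvd_iff]
    intro d hd
    rw [← Polynomial.coeff_coe]
    exact PowerSeries.X_pow_dvd_iff.mp h3 d hd
  obtain ⟨R, hR⟩ := h4
  refine ⟨R.comp (1 - Polynomial.X), ?_⟩
  rwa [comp_one_sub_X_comp, ← hR, sub_sub_cancel]

/-- The series determines its numerator, t^p cancels, and t ↦ 1-t is an involution; all questions
about `s` thus become questions about one polynomial `R`. -/
lemma hilbertSeriesEq_numerator_iff {c p e : ℕ} {R : Polynomial ℤ}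
    (hR : HilbertSeriesEq I (hPoly c p - Polynomial.X ^ p * R.comp (1 - Polynomial.X)) e)
    {δ : ℕ} (s : Fin δ → ℤ) : HilbertSeriesEq I (numerator c p s) e ↔ tail s = R := by
  constructor
  · intro h
    have h1 := h.eq hR
    rw [numerator_eq, sub_right_inj] at h1
    have h2 := mul_left_cancel₀ (pow_ne_zero p Polynomial.X_ne_zero) h1
    rw [← comp_one_sub_X_comp (tail s), h2, comp_one_sub_X_comp]
  · rintro rfl
    rwa [numerator_eq]

lemma existsUnique_tail_eq_of_delta_le {c p : ℕ} {R : Polynomial ℤ}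
    (hR : HilbertSeriesEq I (hPoly c p - Polynomial.X ^ p * R.comp (1 - Polynomial.X)) (n - c))
    {δ : ℕ} (hδ : delta I c p ≤ δ) : ∃! s : Fin δ → ℤ, tail s = R := by
  have h : {δ | ∃ s : Fin δ → ℤ, HilbertSeriesEq I (numerator c p s) (n - c)} =
      {δ | ∀ k, δ ≤ k → R.coeff k = 0} := by
    ext δ
    simp only [hilbertSeriesEq_numerator_iff hR, Set.mem_ofPred_eq, exists_tail_eq]
  -- The set defining `delta` is nonempty, since deg R + 1 belongs to it, so `sInf` is attained and
  -- is not the default value 0 of an empty set.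
  have hmem : delta I c p ∈ {δ | ∀ k, δ ≤ k → R.coeff k = 0} := by
    rw [delta, h]
    exact Nat.sInf_mem ⟨R.natDegree + 1, fun k hk =>
      Polynomial.coeff_eq_zero_of_natDegree_lt (by omega)⟩
  obtain ⟨s, hs⟩ := exists_tail_eq.mpr fun k hk => hmem k (hδ.trans hk)
  exact ⟨s, hs, fun s' hs' => tail_injective (hs'.trans hs.symm)⟩

end Remainder

end Hilbert

namespace Squarefree

/-! ### Transfer of numerators to the Alexander dual -/

section Duality

variable {K : Type*} [Field K] {n : ℕ} {I : Ideal (MvPolynomial (Fin n) K)}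

open Hilbert

lemma isGradedIdeal (hI : IsSquarefreeMonomialIdeal I) : IsGradedIdeal I := by
  intro f hf d
  rw [mem_iff hI] at hf ⊢
  intro a ha
  rw [coeff_homogeneousComponent] at ha
  exact hf a fun h => ha (by rw [h, ite_self])

/-- The numerators of the Hilbert series of Alexander dual ideals determine each other. -/
theorem hilbertSeriesEq_alexanderDual (hI : IsSquarefreeMonomialIdeal I) {c p : ℕ}
    (hc : 1 ≤ c) (hcn : c ≤ n) (hpn : p ≤ n) {R : Polynomial ℤ}
    (hR : HilbertSeriesEq I (hPoly c p - Polynomial.X ^ p * R.comp (1 - Polynomial.X)) (n - c)) :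
    HilbertSeriesEq (alexanderDual I) (hPoly p c + Polynomial.X ^ c * R) (n - p) := by
  obtain ⟨c, rfl⟩ := Nat.exists_eq_add_of_le' hc
  have h1 : facePolynomial I = (1 - Polynomial.X) ^ (c + 1) *
      (hPoly (c + 1) p - Polynomial.X ^ p * R.comp (1 - Polynomial.X)) := by
    apply Polynomial.coe_injective ℤ
    rw [← hilbertSeriesEq_facePolynomial hI, Polynomial.coe_mul, coe_one_sub_X_pow, ← hR,
      mul_left_comm, ← pow_add, Nat.add_sub_cancel' hcn]
  -- In 1 - f(1-t), the Bezout identity at 1-t replaces 1 - t^c h(c,p)(1-t) by (1-t)^p h(p,c), and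
  -- the remainder term becomes (1-t)^p t^c R.
  have h2 : facePolynomial (alexanderDual I) =
      (hPoly p (c + 1) + Polynomial.X ^ (c + 1) * R) * (1 - Polynomial.X) ^ p := by
    have h3 := congrArg (fun f => f.comp (1 - Polynomial.X)) (one_sub_X_pow_mul_hPoly c p)
    simp only [Polynomial.mul_comp, Polynomial.sub_comp, Polynomial.one_comp, Polynomial.X_comp,
      Polynomial.pow_comp, Polynomial.add_comp, sub_sub_cancel, comp_one_sub_X_comp] at h3
    rw [facePolynomial_alexanderDual, h1]
    simp only [Polynomial.mul_comp, Polynomial.sub_comp, Polynomial.one_comp, Polynomial.X_comp,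
      Polynomial.pow_comp, sub_sub_cancel, comp_one_sub_X_comp]
    linear_combination -h3
  have h4 := hilbertSeriesEq_facePolynomial (isSquarefreeMonomialIdeal_alexanderDual I)
  rw [HilbertSeriesEq, h2, Polynomial.coe_mul, coe_one_sub_X_pow] at h4
  refine mul_right_cancel₀ (pow_ne_zero p one_sub_X_ne_zero) ?_
  rw [← h4, mul_assoc, ← pow_add, Nat.sub_add_cancel hpn]

lemma natDegree_facePolynomial_le : (facePolynomial I).natDegree ≤ n := by
  classical
  refine Polynomial.natDegree_sum_le_of_forall_le _ _ fun F _ => ?_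
  have hF := F.card_le_univ
  rw [Fintype.card_fin] at hF
  refine Polynomial.natDegree_mul_le.trans ?_
  have h1 : (1 - Polynomial.X : Polynomial ℤ).natDegree ≤ 1 := by compute_degree
  have h2 := (Polynomial.natDegree_pow_le (p := (1 - Polynomial.X : Polynomial ℤ))
    (n := n - F.card)).trans (Nat.mul_le_mul_left _ h1)
  have h3 := Polynomial.natDegree_X_pow_le (R := ℤ) F.card
  omega

/-- The numerator of the Hilbert series of a Stanley-Reisner ring of dimension `d` has degree at
most `d`. -/
lemma natDegree_le_of_hilbertSeriesEq (hI : IsSquarefreeMonomialIdeal I) {p : ℕ} (hp : p ≤ n)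
    {N : Polynomial ℤ} (hN : HilbertSeriesEq I N (n - p)) : N.natDegree ≤ n - p := by
  have h1 : facePolynomial I = N * (1 - Polynomial.X) ^ p := by
    apply Polynomial.coe_injective ℤ
    rw [← hilbertSeriesEq_facePolynomial hI, Polynomial.coe_mul, coe_one_sub_X_pow, ← hN,
      mul_assoc, ← pow_add, Nat.sub_add_cancel hp]
  have h2 := natDegree_facePolynomial_le (I := I)
  have h3 : (1 - Polynomial.X : Polynomial ℤ).natDegree = 1 := by
    rw [← neg_sub, Polynomial.natDegree_neg]
    exact Polynomial.natDegree_X_sub_C 1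
  have h4 : (1 - Polynomial.X : Polynomial ℤ) ≠ 0 := fun h => by simp [h] at h3
  rcases eq_or_ne N 0 with rfl | hN0
  · simp
  rw [h1, Polynomial.natDegree_mul hN0 (pow_ne_zero p h4), Polynomial.natDegree_pow, h3] at h2
  omega

end Duality

end Squarefree

/-! ### The main theorem -/

open Hilbert Squarefree

theorem mainTheorem5 (K : Type*) [Field K] (n : ℕ) :
    -- an arbitrary nontrivial homogeneous ideal
    (∀ (I : Ideal (MvPolynomial (Fin n) K)) (c p : ℕ),
      I.IsHomogeneous (homogeneousSubmodule (Fin n) K) → I ≠ ⊥ → I ≠ ⊤ →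
      I.height = c → IsLeastGeneratorDegree I p →
      ∀ δ : ℕ, delta I c p ≤ δ →
        ∃! s : Fin δ → ℤ, HilbertSeriesEq I (numerator c p s) (n - c)) ∧
    -- the Alexander dual of a squarefree monomial ideal with Cohen-Macaulay quotient
    (∀ (J : Ideal (MvPolynomial (Fin n) K)) (c p : ℕ),
      IsSquarefreeMonomialIdeal J → J ≠ ⊥ → J ≠ ⊤ →
      IsCohenMacaulay (MvPolynomial (Fin n) K ⧸ J) →
      J.height = p → (alexanderDual J).height = c →
      HasLinearResolution (alexanderDual J) p ∧
      ∃ s : Fin (n - c) → ℤ,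
        HilbertSeriesEq (alexanderDual J) (numerator c p s) (n - c) ∧
        HilbertSeriesEq J (dualNumerator c p s) (n - p) ∧
        ∀ s' : Fin (n - c) → ℤ,
          HilbertSeriesEq (alexanderDual J) (numerator c p s') (n - c) → s' = s) ∧
    -- an arbitrary nontrivial squarefree monomial ideal
    (∀ (I : Ideal (MvPolynomial (Fin n) K)) (c p : ℕ),
      IsSquarefreeMonomialIdeal I → I ≠ ⊥ → I ≠ ⊤ →
      I.height = c → IsLeastGeneratorDegree I p →
      (alexanderDual I).height = p ∧
      IsLeastGeneratorDegree (alexanderDual I) c ∧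
      ∀ δ : ℕ, delta I c p ≤ δ →
        ∃ s : Fin δ → ℤ,
          HilbertSeriesEq I (numerator c p s) (n - c) ∧
          HilbertSeriesEq (alexanderDual I) (dualNumerator c p s) (n - p) ∧
          ∀ s' : Fin δ → ℤ,
            HilbertSeriesEq I (numerator c p s') (n - c) → s' = s) := by
  refine ⟨?_, ?_, ?_⟩
  · intro I c p hI hI0 hI1 hc hp δ hδ
    obtain ⟨R, hR⟩ := exists_remainder
      (fun f hf d => homogeneousComponent_mem_of_mem hI hf d) hI0 hI1 hc hp
    simp only [hilbertSeriesEq_numerator_iff hR]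
    exact existsUnique_tail_eq_of_delta_le hR hδ
  · intro J c p hJ hJ0 hJ1 hCM hp hc
    have hI := isSquarefreeMonomialIdeal_alexanderDual J
    have hI0 : alexanderDual J ≠ ⊥ := alexanderDual_ne_bot hJ1
    have hI1 : alexanderDual J ≠ ⊤ := alexanderDual_ne_top hJ hJ0
    have hgen : IsLeastGeneratorDegree (alexanderDual J) p :=
      isLeastGeneratorDegree_alexanderDual hJ hp
    obtain ⟨R, hR⟩ := exists_remainder (isGradedIdeal hI) hI0 hI1 hc hgen
    have hcn := (exists_hilbertSeriesEq (isGradedIdeal hI) hI1 hc).1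
    have hpn := (exists_hilbertSeriesEq (isGradedIdeal hJ) hJ1 hp).1
    have hc1 := one_le_of_height_eq hI0 hc
    have hp1 := one_le_of_height_eq hJ0 hp
    have hdual := hilbertSeriesEq_alexanderDual hI hc1 hcn hpn hR
    rw [alexanderDual_alexanderDual hJ] at hdual
    have hdeg := natDegree_le_of_hilbertSeriesEq hJ hpn hdual
    obtain ⟨s, hs⟩ : ∃ s : Fin (n - c) → ℤ, tail s = R := by
      -- The numerator h(p,c) + t^c R of S/J has degree at most n - p, and h(p,c) has degree below
      -- c. For k ≥ n - c one has k + c ≥ n > n - p because p ≥ 1, so the coefficient of R at k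
      -- vanishes.
      refine exists_tail_eq.mpr fun k hk => ?_
      have h1 := Polynomial.coeff_eq_zero_of_natDegree_lt (n := k + c) (hdeg.trans_lt (by omega))
      rwa [Polynomial.coeff_add, Polynomial.coeff_X_pow_mul,
        Polynomial.coeff_eq_zero_of_natDegree_lt
          ((natDegree_hPoly_lt p c hc1).trans_le (Nat.le_add_left c k)), zero_add] at h1
    refine ⟨hasLinearResolution_alexanderDual hJ hJ1 hCM hp, s,
      (hilbertSeriesEq_numerator_iff hR s).mpr hs, ?_, fun s' hs' => ?_⟩
    · rwa [dualNumerator_eq, hs]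
    · exact tail_injective (((hilbertSeriesEq_numerator_iff hR s').mp hs').trans hs.symm)
  · intro I c p hI hI0 hI1 hc hp
    have hht : (alexanderDual I).height = p := height_alexanderDual hI hp
    refine ⟨hht, isLeastGeneratorDegree_alexanderDual hI hc, fun δ hδ => ?_⟩
    obtain ⟨R, hR⟩ := exists_remainder (isGradedIdeal hI) hI0 hI1 hc hp
    have hcn := (exists_hilbertSeriesEq (isGradedIdeal hI) hI1 hc).1
    have hpn := (exists_hilbertSeriesEq
      (isGradedIdeal (isSquarefreeMonomialIdeal_alexanderDual I))
      (alexanderDual_ne_top hI hI0) hht).1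
    obtain ⟨s, hs, hsu⟩ := existsUnique_tail_eq_of_delta_le hR hδ
    refine ⟨s, (hilbertSeriesEq_numerator_iff hR s).mpr hs, ?_,
      fun s' hs' => hsu s' ((hilbertSeriesEq_numerator_iff hR s').mp hs')⟩
    rw [dualNumerator_eq, hs]
    exact hilbertSeriesEq_alexanderDual hI (one_le_of_height_eq hI0 hc) hcn hpn hR
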